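/- Let $\mathcal S$ be the space of pairs $h=(f,g)$ of continuous functions $f,g:[0,1]\to\mathbb R$ with $f(0)=f(1)=g(0)=g(1)=0$, with the uniform topology and its Borel $\sigma$-algebra. For continuous $f:[0,1]\to\mathbb R$ put $$d_f(s,t)=f(s)+f(t)-2\max\Big(\inf_{[s\wedge t,\,s\vee t]}f,\ \inf_{[0,s\wedge t]\cup[s\vee t,1]}f\Big),$$ and let $s_*(f)$ be the first time at which $f$ attains its minimum. For $h=(f,g)\in\mathcal S$ let $$d_h(s,t)=\inf\Big\{\sum_{i=1}^k d_g(s_i,t_i):\ k\ge 1,\ s_1=s,\ t_k=t,\ d_f(t_j,s_{j+1})=0\text{ for }1\le j\le k-1\Big\},$$ let $X_h=[0,1]/\{d_h=0\}$ with the distance inherited from $d_h$ and canonical projection $p_h:[0,1]\to X_h$, let $\mu_h=(p_h)_*\mathrm{Leb}_{[0,1]}$, $x_h^0=p_h(s_*(f))$ and $x_h^1=p_h(s_*(g))$ (any other minimizers of $f$ and $g$ give the same points). Let $\psi(h)=[X_h,d_h,\mu_h,x_h^0,x_h^1]$ be the isometry class of this compact metric measure space with two marked points, an element of the space $m\mathcal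 M^{2\bullet}$ of all such isometry classes with the Gromov--Hausdorff--Prokhorov topology and its Borel $\sigma$-algebra. Put $\epsilon_h=1$ if $s_*(g)\le 1/2$ and $\epsilon_h=-1$ if $s_*(g)>1/2$. Let $\mathbb P_{\mathrm{Snake}}$ be the law on $\mathcal S$ of the Brownian snake $(\mathbf e,Z)$, where $\mathbf e$ is a normalized Brownian excursion and, conditionally given $\mathbf e$, $Z$ is a continuous centered Gaussian process with $\mathrm{Cov}(Z_s,Z_t)=\inf_{[s\wedge t,\,s\vee t]}\mathbf e$. Then, under $\mathbb P_{\mathrm{Snake}}(dh)$, the maps $h\mapsto\psi(h)$ and $h\mapsto\epsilon_h$ are random variables (that is, measurable), they are independent, and $\epsilon_h$ has the Rademacher distribution: it equals $1$ and $-1$ with probability $1/2$ each. -/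

import Mathlib

open MeasureTheory ProbabilityTheory Set unitInterval
open scoped ENNReal

noncomputable section

namespace BrownianSphere

/-! ### The space of encoding pairs -/

/-- Continuous real functions on `[0,1]` carry the Borel σ-algebra of the uniform topology. -/
instance instMeasurableSpacePath : MeasurableSpace C(I, ℝ) := borel _

instance instBorelSpacePath : BorelSpace C(I, ℝ) := ⟨rfl⟩

/-- The space `𝒮` of pairs `h = (f, g)` of continuous functions on `[0,1]` taking the value `0`
at `0` and `1`, with the topology of uniform convergence and its Borel σ-algebra (as a subspace of
the product). -/
abbrev SnakeSpace : Type :=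
  {h : C(I, ℝ) × C(I, ℝ) // (h.1 0 = 0 ∧ h.1 1 = 0) ∧ (h.2 0 = 0 ∧ h.2 1 = 0)}

/-- The first coordinate `f` of `h = (f, g)`. -/
def SnakeSpace.f (h : SnakeSpace) : C(I, ℝ) := h.1.1

/-- The second coordinate `g` of `h = (f, g)`. -/
def SnakeSpace.g (h : SnakeSpace) : C(I, ℝ) := h.1.2

/-! ### Pseudometrics coded by functions -/

/-- The tree pseudometric
`d_f(s,t) = f(s) + f(t) - 2 max (inf_{[s∧t,s∨t]} f, inf_{[0,s∧t]∪[s∨t,1]} f)`. -/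
def treeDist (f : C(I, ℝ)) (s t : I) : ℝ :=
  f s + f t - 2 * max (sInf (f '' Icc (s ⊓ t) (s ⊔ t))) (sInf (f '' (Icc 0 (s ⊓ t) ∪ Icc (s ⊔ t) 1)))

/-- `s_*(f)`: the first time at which `f` attains its minimum. -/
def firstArgmin (f : C(I, ℝ)) : I := sInf {t | ∀ u, f t ≤ f u}

/-- The set of lengths `∑ᵢ d_g(sᵢ,tᵢ)` of chains `s = s₀, t₀, s₁, t₁, …, s_k, t_k = t` with
`d_f(t_j, s_{j+1}) = 0` for all `j < k`. -/
def chainLengths (h : SnakeSpace) (s t : I) : Set ℝ :=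
  {r | ∃ (k : ℕ) (a b : ℕ → I), a 0 = s ∧ b k = t ∧
    (∀ j < k, treeDist h.f (b j) (a (j + 1)) = 0) ∧
    r = ∑ i ∈ Finset.range (k + 1), treeDist h.g (a i) (b i)}

/-- The mating of trees pseudometric `d_h`. -/
def matingDist (h : SnakeSpace) (s t : I) : ℝ := sInf (chainLengths h s t)

lemma bddBelow_image (f : C(I, ℝ)) (A : Set I) : BddBelow (f '' A) :=
  ((isCompact_range f.continuous).bddBelow).mono (image_subset_range _ _)

lemma treeDist_comm (f : C(I, ℝ)) (s t : I) : treeDist f s t = treeDist f t s := by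
  simp only [treeDist, inf_comm s t, sup_comm s t, add_comm (f s)]

lemma treeDist_self (f : C(I, ℝ)) (s : I) : treeDist f s s = 0 := by
  have h1 : sInf (f '' Icc s s) = f s := by simp
  have h2 : sInf (f '' (Icc 0 s ∪ Icc s 1)) ≤ f s :=
    csInf_le (bddBelow_image _ _) ⟨s, Or.inl ⟨bot_le, le_rfl⟩, rfl⟩
  simp only [treeDist, inf_idem, sup_idem, h1, max_eq_left h2]
  ring

lemma treeDist_nonneg (f : C(I, ℝ)) (s t : I) : 0 ≤ treeDist f s t := by
  have key : ∀ A : Set I, s ∈ A → t ∈ A → 2 * sInf (f '' A) ≤ f s + f t := fun A hs ht => by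
    have h1 := csInf_le (bddBelow_image f A) ⟨s, hs, rfl⟩
    have h2 := csInf_le (bddBelow_image f A) ⟨t, ht, rfl⟩
    linarith
  have h1 := key (Icc (s ⊓ t) (s ⊔ t)) ⟨inf_le_left, le_sup_left⟩ ⟨inf_le_right, le_sup_right⟩
  have h2 := key (Icc 0 (s ⊓ t) ∪ Icc (s ⊔ t) 1) (by
      rcases le_total s t with h | h
      · exact Or.inl ⟨bot_le, le_inf le_rfl h⟩
      · exact Or.inr ⟨sup_le le_rfl h, le_top⟩) (by
      rcases le_total s t with h | h
      · exact Or.inr ⟨sup_le h le_rfl, le_top⟩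
      · exact Or.inl ⟨bot_le, le_inf h le_rfl⟩)
  unfold treeDist
  rcases max_choice (sInf (f '' Icc (s ⊓ t) (s ⊔ t)))
    (sInf (f '' (Icc 0 (s ⊓ t) ∪ Icc (s ⊔ t) 1))) with h | h <;> rw [h] <;> linarith

lemma treeDist_eq_zero_of_isMin (f : C(I, ℝ)) {s t : I} (hs : ∀ u, f s ≤ f u)
    (ht : ∀ u, f t ≤ f u) : treeDist f s t = 0 := by
  have h0 : f s = f t := le_antisymm (hs t) (ht s)
  have h1 : f s ≤ sInf (f '' Icc (s ⊓ t) (s ⊔ t)) :=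
    le_csInf ⟨f s, s, ⟨inf_le_left, le_sup_left⟩, rfl⟩ (by rintro _ ⟨u, -, rfl⟩; exact hs u)
  have h2 := treeDist_nonneg f s t
  have h3 := le_max_left (sInf (f '' Icc (s ⊓ t) (s ⊔ t)))
    (sInf (f '' (Icc 0 (s ⊓ t) ∪ Icc (s ⊔ t) 1)))
  unfold treeDist at *
  linarith

lemma chainLengths_nonneg (h : SnakeSpace) (s t : I) : ∀ r ∈ chainLengths h s t, 0 ≤ r := by
  rintro r ⟨k, a, b, -, -, -, rfl⟩
  exact Finset.sum_nonneg fun i _ => treeDist_nonneg _ _ _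

lemma bddBelow_chainLengths (h : SnakeSpace) (s t : I) : BddBelow (chainLengths h s t) :=
  ⟨0, chainLengths_nonneg h s t⟩

lemma treeDist_mem_chainLengths (h : SnakeSpace) (s t : I) :
    treeDist h.g s t ∈ chainLengths h s t :=
  ⟨0, fun _ => s, fun _ => t, rfl, rfl, fun _ hj => absurd hj (Nat.not_lt_zero _), by simp⟩

lemma chainLengths_swap (h : SnakeSpace) (s t : I) :
    chainLengths h s t ⊆ chainLengths h t s := by
  rintro r ⟨k, a, b, ha, hb, hc, rfl⟩
  refine ⟨k, fun i => b (k - i), fun i => a (k - i), by simpa using hb, by simpa using ha,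
    fun j hj => ?_, ?_⟩
  · have := hc (k - (j + 1)) (by omega)
    rw [treeDist_comm]
    rwa [show k - (j + 1) + 1 = k - j by omega] at this
  · rw [← Finset.sum_range_reflect]
    refine Finset.sum_congr rfl fun i hi => ?_
    rw [show k + 1 - 1 - i = k - i by omega, treeDist_comm]

lemma chainLengths_add (h : SnakeSpace) {s t u : I} {r r' : ℝ} (hr : r ∈ chainLengths h s t)
    (hr' : r' ∈ chainLengths h t u) : r + r' ∈ chainLengths h s u := by
  obtain ⟨k, a, b, ha, hb, hc, rfl⟩ := hr
  obtain ⟨l, a', b', ha', hb', hc', rfl⟩ := hr'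
  refine ⟨k + 1 + l, fun i => if i < k + 1 then a i else a' (i - (k + 1)),
    fun i => if i < k + 1 then b i else b' (i - (k + 1)), by simpa using ha, ?_,
    fun j hj => ?_, ?_⟩
  · simpa [show ¬ k + 1 + l < k + 1 by omega] using hb'
  · rcases lt_trichotomy j k with h1 | h1 | h1
    · simpa [show j < k + 1 by omega, show j + 1 < k + 1 by omega] using hc j h1
    · subst h1
      simp [hb, ha', treeDist_self]
    · have := hc' (j - (k + 1)) (by omega)
      simp only [show ¬ j < k + 1 by omega, show ¬ j + 1 < k + 1 by omega, if_false]
      rwa [show j + 1 - (k + 1) = j - (k + 1) + 1 by omega]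
  · rw [add_assoc (k + 1), Finset.sum_range_add _ (k + 1) (l + 1)]
    congr 1
    · exact Finset.sum_congr rfl fun i hi => by simp only [Finset.mem_range.1 hi, if_true]
    · refine Finset.sum_congr rfl fun i _ => ?_
      simp only [show ¬ k + 1 + i < k + 1 by omega, if_false, Nat.add_sub_cancel_left]

lemma matingDist_nonneg (h : SnakeSpace) (s t : I) : 0 ≤ matingDist h s t :=
  le_csInf ⟨_, treeDist_mem_chainLengths h s t⟩ (chainLengths_nonneg h s t)

lemma matingDist_le_treeDist (h : SnakeSpace) (s t : I) : matingDist h s t ≤ treeDist h.g s t :=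
  csInf_le (bddBelow_chainLengths h s t) (treeDist_mem_chainLengths h s t)

lemma matingDist_self (h : SnakeSpace) (s : I) : matingDist h s s = 0 :=
  le_antisymm ((matingDist_le_treeDist h s s).trans_eq (treeDist_self _ _))
    (matingDist_nonneg h s s)

lemma matingDist_comm (h : SnakeSpace) (s t : I) : matingDist h s t = matingDist h t s := by
  unfold matingDist
  rw [(chainLengths_swap h s t).antisymm (chainLengths_swap h t s)]

lemma matingDist_triangle (h : SnakeSpace) (s t u : I) :
    matingDist h s u ≤ matingDist h s t + matingDist h t u := by
  refine le_of_forall_pos_lt_add fun ε hε => ?_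
  obtain ⟨r, hr, hr2⟩ := exists_lt_of_csInf_lt ⟨_, treeDist_mem_chainLengths h s t⟩
    (show sInf (chainLengths h s t) < matingDist h s t + ε / 2 by unfold matingDist; linarith)
  obtain ⟨r', hr', hr2'⟩ := exists_lt_of_csInf_lt ⟨_, treeDist_mem_chainLengths h t u⟩
    (show sInf (chainLengths h t u) < matingDist h t u + ε / 2 by unfold matingDist; linarith)
  have := csInf_le (bddBelow_chainLengths h s u) (chainLengths_add h hr hr')
  unfold matingDist at *
  linarith

/-! ### The mating of trees -/

/-- The interval `[0,1]` equipped with the pseudometric `d_h`. -/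
def PreMating (_h : SnakeSpace) : Type := I

instance instPseudoMetricSpacePreMating (h : SnakeSpace) : PseudoMetricSpace (PreMating h) where
  dist := matingDist h
  dist_self := matingDist_self h
  dist_comm := matingDist_comm h
  dist_triangle := matingDist_triangle h

/-- The quotient `X_h = [0,1]/{d_h = 0}`, a metric space for the distance inherited from `d_h`. -/
abbrev Mating (h : SnakeSpace) : Type := SeparationQuotient (PreMating h)

instance instMeasurableSpaceMating (h : SnakeSpace) : MeasurableSpace (Mating h) := borel _

instance instBorelSpaceMating (h : SnakeSpace) : BorelSpace (Mating h) := ⟨rfl⟩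

/-- The canonical projection `p_h : [0,1] → X_h`. -/
def Mating.proj (h : SnakeSpace) (s : I) : Mating h := SeparationQuotient.mk (X := PreMating h) s

lemma Mating.dist_proj (h : SnakeSpace) (s t : I) :
    dist (Mating.proj h s) (Mating.proj h t) = matingDist h s t := rfl

lemma Mating.proj_surjective (h : SnakeSpace) : Function.Surjective (Mating.proj h) :=
  SeparationQuotient.surjective_mk (X := PreMating h)

lemma Mating.continuous_proj (h : SnakeSpace) : Continuous (Mating.proj h) := by
  refine continuous_iff_continuousAt.2 fun t => Metric.tendsto_nhds.2 fun ε hε => ?_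
  obtain ⟨δ, hδ, H⟩ := Metric.uniformContinuous_iff.1
    (CompactSpace.uniformContinuous_of_continuous h.g.continuous) (ε / 4) (by linarith)
  filter_upwards [Metric.ball_mem_nhds t hδ] with s hst
  rw [Metric.mem_ball] at hst
  rw [Mating.dist_proj]
  refine (matingDist_le_treeDist h s t).trans_lt ?_
  have h1 : h.g t - ε / 4 ≤ sInf (h.g '' Icc (s ⊓ t) (s ⊔ t)) := by
    refine le_csInf ⟨h.g s, s, ⟨inf_le_left, le_sup_left⟩, rfl⟩ ?_
    rintro _ ⟨u, hu, rfl⟩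
    have hu' : dist u t < δ := by
      refine lt_of_le_of_lt ?_ hst
      rw [Subtype.dist_eq, Subtype.dist_eq, Real.dist_eq, Real.dist_eq]
      rcases le_total s t with hle | hle
      · rw [inf_eq_left.2 hle, sup_eq_right.2 hle] at hu
        have a1 : (s : ℝ) ≤ u := hu.1
        have a2 : (u : ℝ) ≤ t := hu.2
        rw [abs_of_nonpos (by linarith), abs_of_nonpos (by linarith)]
        linarith
      · rw [inf_eq_right.2 hle, sup_eq_left.2 hle] at hu
        have a1 : (t : ℝ) ≤ u := hu.1
        have a2 : (u : ℝ) ≤ s := hu.2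
        rw [abs_of_nonneg (by linarith), abs_of_nonneg (by linarith)]
        linarith
    have := (abs_lt.1 (Real.dist_eq _ _ ▸ H hu')).1
    linarith
  have h2 := (abs_lt.1 (Real.dist_eq _ _ ▸ H hst)).2
  have h3 := le_max_left (sInf (h.g '' Icc (s ⊓ t) (s ⊔ t)))
    (sInf (h.g '' (Icc 0 (s ⊓ t) ∪ Icc (s ⊔ t) 1)))
  unfold treeDist
  linarith

instance instCompactSpaceMating (h : SnakeSpace) : CompactSpace (Mating h) := by
  have := isCompact_range (Mating.continuous_proj h)
  rw [(Mating.proj_surjective h).range_eq] at this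
  exact ⟨this⟩

/-- The area measure `μ_h = (p_h)_* Leb` on `X_h`. -/
def areaMeasure (h : SnakeSpace) : Measure (Mating h) := (volume : Measure I).map (Mating.proj h)

instance instIsFiniteMeasureArea (h : SnakeSpace) : IsFiniteMeasure (areaMeasure h) := by
  unfold areaMeasure; infer_instance

/-- The marked point `x_h^0 = p_h(argmin f)`. -/
def markedPoint₀ (h : SnakeSpace) : Mating h := Mating.proj h (firstArgmin h.f)

/-- The marked point `x_h^1 = p_h(argmin g)`. -/
def markedPoint₁ (h : SnakeSpace) : Mating h := Mating.proj h (firstArgmin h.g)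

lemma isMin_firstArgmin (f : C(I, ℝ)) (u : I) : f (firstArgmin f) ≤ f u := by
  have hcl : IsClosed {t : I | ∀ u, f t ≤ f u} := by
    have : {t : I | ∀ u, f t ≤ f u} = ⋂ u, {t : I | f t ≤ f u} := by ext; simp
    rw [this]
    exact isClosed_iInter fun u => isClosed_le f.continuous continuous_const
  obtain ⟨t, -, ht⟩ := isCompact_univ.exists_isMinOn univ_nonempty f.continuous.continuousOn
  have hne : {t : I | ∀ u, f t ≤ f u}.Nonempty := ⟨t, isMinOn_univ_iff.1
    (by simpa using ht)⟩
  exact hcl.sInf_mem hne u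

/-- `x_h^0` does not depend on the choice of a minimizer of `f`. -/
lemma markedPoint₀_eq (h : SnakeSpace) {s : I} (hs : ∀ u, h.f s ≤ h.f u) :
    Mating.proj h s = markedPoint₀ h := by
  refine eq_of_dist_eq_zero (le_antisymm ?_ dist_nonneg)
  rw [markedPoint₀, Mating.dist_proj]
  refine csInf_le (bddBelow_chainLengths _ _ _) ⟨1, fun i => if i = 0 then s else firstArgmin h.f,
    fun i => if i = 0 then s else firstArgmin h.f, by simp, by simp, fun j hj => ?_, ?_⟩
  · obtain rfl : j = 0 := by omega
    simpa using treeDist_eq_zero_of_isMin _ hs (isMin_firstArgmin _)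
  · simp [treeDist_self]

/-- `x_h^1` does not depend on the choice of a minimizer of `g`. -/
lemma markedPoint₁_eq (h : SnakeSpace) {s : I} (hs : ∀ u, h.g s ≤ h.g u) :
    Mating.proj h s = markedPoint₁ h := by
  refine eq_of_dist_eq_zero (le_antisymm ?_ dist_nonneg)
  rw [markedPoint₁, Mating.dist_proj]
  exact (matingDist_le_treeDist _ _ _).trans_eq
    (treeDist_eq_zero_of_isMin _ hs (isMin_firstArgmin _))

/-! ### The Gromov–Hausdorff–Prokhorov space -/

/-- A compact metric space with a finite Borel measure and `n` distinguished points. -/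
structure MarkedSpace (n : ℕ) where
  carrier : Type
  [metric : MetricSpace carrier]
  [compact : CompactSpace carrier]
  [measurable : MeasurableSpace carrier]
  [borel : BorelSpace carrier]
  μ : Measure carrier
  [finite : IsFiniteMeasure μ]
  pt : Fin n → carrier

attribute [instance] MarkedSpace.metric MarkedSpace.compact MarkedSpace.measurable
  MarkedSpace.borel MarkedSpace.finite

/-- Two marked compact metric measure spaces are isometric if there is a bijective isometry that
preserves the measures and the marked points. -/
def MarkedSpace.Isometric {n : ℕ} (X Y : MarkedSpace n) : Prop :=
  ∃ φ : X.carrier ≃ᵢ Y.carrier, X.μ.map φ = Y.μ ∧ ∀ i, φ (X.pt i) = Y.pt i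

instance instSetoidMarkedSpace (n : ℕ) : Setoid (MarkedSpace n) where
  r := MarkedSpace.Isometric
  iseqv :=
    { refl := fun X => ⟨IsometryEquiv.refl _, Measure.map_id, fun _ => rfl⟩
      symm := by
        rintro X Y ⟨φ, hμ, hp⟩
        refine ⟨φ.symm, ?_, fun i => by rw [← hp i, φ.symm_apply_apply]⟩
        rw [← hμ, Measure.map_map φ.symm.continuous.measurable φ.continuous.measurable]
        rw [show (φ.symm ∘ φ : X.carrier → X.carrier) = id from
          funext φ.symm_apply_apply, Measure.map_id]
      trans := by
        rintro X Y Z ⟨φ, hμ, hp⟩ ⟨χ, hν, hq⟩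
        refine ⟨φ.trans χ, ?_, fun i => by simp [hp, hq]⟩
        rw [← hν, ← hμ, Measure.map_map χ.continuous.measurable φ.continuous.measurable]
        rfl }

/-- The set of isometry classes of compact metric measure spaces with `n` marked points. -/
def GHPSpace (n : ℕ) : Type 1 := Quotient (instSetoidMarkedSpace n)

/-- The isometry class of a marked compact metric measure space. -/
def MarkedSpace.toGHP {n : ℕ} (X : MarkedSpace n) : GHPSpace n := Quotient.mk _ X

/-- The Gromov–Hausdorff–Prokhorov distance: the infimum, over all isometric embeddings of
representatives into a common metric space, of the maximum of the Hausdorff distance between the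
images, the Prokhorov distance between the image measures, and the distances between the images of
corresponding marked points. -/
def ghpDist {n : ℕ} (A B : GHPSpace n) : ℝ≥0∞ :=
  sInf {r | ∃ X Y : MarkedSpace n, X.toGHP = A ∧ Y.toGHP = B ∧
    ∃ (Z : Type) (_ : MetricSpace Z) (_ : MeasurableSpace Z) (_ : BorelSpace Z)
      (φ : X.carrier → Z) (χ : Y.carrier → Z), Isometry φ ∧ Isometry χ ∧
      r = max (max (Metric.hausdorffEDist (range φ) (range χ))
            (levyProkhorovEDist (X.μ.map φ) (Y.μ.map χ)))
          (⨆ i, edist (φ (X.pt i)) (χ (Y.pt i)))}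

/-- The Gromov–Hausdorff–Prokhorov topology: a set is open if it contains a ball of `ghpDist`
around each of its points. -/
instance instTopologicalSpaceGHP (n : ℕ) : TopologicalSpace (GHPSpace n) where
  IsOpen U := ∀ A ∈ U, ∃ ε : ℝ≥0∞, 0 < ε ∧ ∀ B, ghpDist A B < ε → B ∈ U
  isOpen_univ := fun _ _ => ⟨1, one_pos, fun _ _ => mem_univ _⟩
  isOpen_inter := by
    intro U V hU hV A hA
    obtain ⟨ε, hε, H⟩ := hU A hA.1
    obtain ⟨δ, hδ, K⟩ := hV A hA.2
    exact ⟨min ε δ, lt_min hε hδ, fun B hB =>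
      ⟨H B (hB.trans_le (min_le_left _ _)), K B (hB.trans_le (min_le_right _ _))⟩⟩
  isOpen_sUnion := by
    rintro 𝒰 h𝒰 A ⟨U, hU, hA⟩
    obtain ⟨ε, hε, H⟩ := h𝒰 U hU A hA
    exact ⟨ε, hε, fun B hB => ⟨U, hU, H B hB⟩⟩

instance instMeasurableSpaceGHP (n : ℕ) : MeasurableSpace (GHPSpace n) := borel _

instance instBorelSpaceGHP (n : ℕ) : BorelSpace (GHPSpace n) := ⟨rfl⟩

/-- The doubly marked space `(X_h, d_h, μ_h, x_h^0, x_h^1)`. -/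
def matingSpace (h : SnakeSpace) : MarkedSpace 2 where
  carrier := Mating h
  μ := areaMeasure h
  pt := ![markedPoint₀ h, markedPoint₁ h]

/-- The continuum CVS mapping `ψ`, sending `h` to the isometry class of
`(X_h, d_h, μ_h, x_h^0, x_h^1)`. -/
def ψ (h : SnakeSpace) : GHPSpace 2 := (matingSpace h).toGHP

/-- The orientation sign: `ε_h = 1` if `s_*(g) ≤ 1/2` and `ε_h = -1` otherwise. -/
def orientationSign (h : SnakeSpace) : ℤ := if (firstArgmin h.g : ℝ) ≤ 1 / 2 then 1 else -1

/-! ### The law of the Brownian snake -/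

/-- The density at time `t` of the first hitting time of `x > 0` by Brownian motion from `0`. -/
def hitDensity (t x : ℝ) : ℝ := x / √(2 * Real.pi * t ^ 3) * Real.exp (-x ^ 2 / (2 * t))

/-- The transition density of Brownian motion killed when it hits `0`. -/
def killedDensity (t x y : ℝ) : ℝ :=
  (Real.exp (-(y - x) ^ 2 / (2 * t)) - Real.exp (-(y + x) ^ 2 / (2 * t))) / √(2 * Real.pi * t)

/-- The joint density at `(x₀,…,x_n)` of the values at times `0 < t₀ < … < t_n < 1` of the
normalized Brownian excursion. -/
def excursionDensity {n : ℕ} (t x : Fin (n + 1) → ℝ) : ℝ :=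
  open Classical in
  if ∀ i, 0 < x i then
    2 * √(2 * Real.pi) * hitDensity (t 0) (x 0) *
      (∏ i : Fin n, killedDensity (t i.succ - t i.castSucc) (x i.castSucc) (x i.succ)) *
      hitDensity (1 - t (Fin.last n)) (x (Fin.last n))
  else 0

/-- `ν` is the law on `C([0,1])` of the normalized Brownian excursion, given through its
finite-dimensional distributions. -/
def IsExcursionLaw (ν : Measure C(I, ℝ)) : Prop :=
  ∀ (n : ℕ) (t : Fin (n + 1) → I), StrictMono t → 0 < t 0 → t (Fin.last n) < 1 →
    ν.map (fun e i => e (t i)) =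
      (volume : Measure (Fin (n + 1) → ℝ)).withDensity
        (fun x => ENNReal.ofReal (excursionDensity (fun i => (t i : ℝ)) x))

/-- `ν` is the law on `C([0,1])` of a continuous centered Gaussian process with covariance function
`Cov(Z_s, Z_t) = inf_{[s∧t, s∨t]} e`. -/
def IsLabelLaw (e : C(I, ℝ)) (ν : Measure C(I, ℝ)) : Prop :=
  IsGaussianProcess (fun (t : I) (z : C(I, ℝ)) => z t) ν ∧
  (∀ t : I, ∫ z, z t ∂ν = 0) ∧
  ∀ s t : I, covariance (fun z : C(I, ℝ) => z s) (fun z => z t) ν =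
    sInf (e '' Icc (s ⊓ t) (s ⊔ t))

/-- `P` is the law on `𝒮` of the Brownian snake `(e, Z)`: the first coordinate `e` is a normalized
Brownian excursion and, conditionally given `e`, the second coordinate `Z` is a continuous centered
Gaussian process with covariance `inf_{[s∧t, s∨t]} e`. -/
structure IsSnakeLaw (P : Measure SnakeSpace) : Prop where
  isProbabilityMeasure : IsProbabilityMeasure P
  excursion : IsExcursionLaw (P.map SnakeSpace.f)
  labels : ∃ κ : Kernel C(I, ℝ) C(I, ℝ), IsMarkovKernel κ ∧
    P.map (fun h => (h.f, h.g)) = (P.map SnakeSpace.f).compProd κ ∧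
    ∀ᵐ e ∂(P.map SnakeSpace.f), IsLabelLaw e (κ e)

end BrownianSphere

end

open MeasureTheory ProbabilityTheory Set unitInterval
open scoped ENNReal

noncomputable section

namespace BrownianSphere

section

/-! ### Measurability on spaces of continuous functions -/

/-! Reversing time, `t ↦ 1 - t`, in both coordinates preserves the law of the snake
(`IsSnakeLaw.map_revSnake`). It induces an isometry of the glued spaces that respects area and
marked points, so `ψ` is unchanged (`ψ_revSnake`). It exchanges the two sides of `1/2`, so the sign
is reversed unless `g` has the same minimum over both halves (`orientationSign_revSnake`). Once such
ties are negligible, `{ψ ∈ A, ε = 1}` and `{ψ ∈ A, ε = -1}` have equal probability for every `A`,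
which is independence and the Rademacher law at once. The real work is to exclude ties
(`IsSnakeLaw.ae_infOn_ne`).

Fix the tree coded by `e`. The ancestral line of time `1/2`, called the spine, is visited after
`1/2` at the times when `e` equals its running minimum; the excursions above this minimum are
branches grafted on the spine. If the minimum over `[1/2, 1]` is reached inside a branch, the
Gaussian increment from the spine to that branch, after removal of its projection from all other
labels, moves this minimum strictly and leaves the labels on `[0, 1/2]` fixed. A tie then forces one
value of a variable without atoms (`IsLabelLaw.measure_tie_branch`).

It remains to find a label below the minimum over the spine. Along the spine the labels form a
Brownian motion in the height, so their minimum sits at a height `x` strictly between the ends, and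
Lévy's modulus bounds their variation over heights `2⁻ᵏ` by a multiple of `√(k 2⁻ᵏ)`. If, for
infinitely many `k`, a branch grafted within `2⁻ᵏ` above `x` rises to `200 k 2⁻ᵏ` above `x`, its
label increments, independent of the spine, beat that modulus infinitely often by Borel–Cantelli
(`exists_lt_spine`).

The law of `x` does not depend on `e`, so by Fubini such steep branches are needed only above a
fixed level `h`. Up to a constant, the excursion is dominated by a Gaussian random walk on any
uniform grid. Between its passages below `h + 2⁻ᵏ` and `h + 2⁻ᵏ⁻¹` the walk climbs that high with
probability of order `1/k`; the harmonic series diverges, so avoiding all steep climbs has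
probability zero (`IsExcursionLaw.measure_flatPaths`). -/

lemma measurable_eval_path {X : Type*} [TopologicalSpace X] [MeasurableSpace C(X, ℝ)]
    [BorelSpace C(X, ℝ)] (x : X) : Measurable fun f : C(X, ℝ) => f x :=
  (by fun_prop : Continuous fun f : C(X, ℝ) => f x).measurable

section ContinuousFunctions

variable {X : Type*} [TopologicalSpace X] [CompactSpace X] [TopologicalSpace.MetrizableSpace X]
  [MeasurableSpace C(X, ℝ)] [BorelSpace C(X, ℝ)] {Ω : Type*} [MeasurableSpace Ω]

/-- Restriction to a countable dense set is a continuous injection between Polish spaces, so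
Lusin–Souslin applies. This reduces measurability and equality of laws on `C(X, ℝ)` to countably
many evaluations. -/
lemma measurableEmbedding_restrict {s : Set X} (hs : s.Countable) (hd : Dense s) :
    MeasurableEmbedding (fun (f : C(X, ℝ)) (x : s) => f x) := by
  have := hs.to_subtype
  let := TopologicalSpace.metrizableSpaceMetric X
  refine Continuous.measurableEmbedding (by fun_prop) fun f g hfg => ?_
  refine DFunLike.coe_injective (f.continuous.ext_on hd g.continuous fun x hx => ?_)
  exact congrFun hfg ⟨x, hx⟩

lemma measurable_of_dense {s : Set X} (hs : s.Countable) (hd : Dense s) {F : Ω → C(X, ℝ)}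
    (hF : ∀ x ∈ s, Measurable fun ω => F ω x) : Measurable F := by
  refine (measurableEmbedding_restrict hs hd).measurable_comp_iff.1 ?_
  exact measurable_pi_lambda _ fun x => hF x x.2

lemma measurable_of_eval {F : Ω → C(X, ℝ)} (hF : ∀ x, Measurable fun ω => F ω x) :
    Measurable F := by
  let := TopologicalSpace.metrizableSpaceMetric X
  obtain ⟨s, hs, hd⟩ := TopologicalSpace.exists_countable_dense X
  exact measurable_of_dense hs hd fun x _ => hF x

/-- Independence results for Gaussian processes concern the family of evaluations; this identity
turns them into independence of the path as a `C(X, ℝ)`-valued variable. -/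
lemma comap_eval_eq :
    MeasurableSpace.comap (fun (f : C(X, ℝ)) (x : X) => f x) MeasurableSpace.pi =
      ‹MeasurableSpace C(X, ℝ)› := by
  let := TopologicalSpace.metrizableSpaceMetric X
  refine le_antisymm ?_ ?_
  · exact Measurable.comap_le (measurable_pi_lambda _ measurable_eval_path)
  · obtain ⟨s, hs, hd⟩ := TopologicalSpace.exists_countable_dense X
    rw [← (measurableEmbedding_restrict hs hd).comap_eq]
    have : (fun (f : C(X, ℝ)) (x : s) => f x) =
      (fun (g : X → ℝ) (x : s) => g x) ∘ fun (f : C(X, ℝ)) (x : X) => f x := rfl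
    rw [this, ← MeasurableSpace.comap_comp]
    exact MeasurableSpace.comap_mono (Measurable.comap_le (by fun_prop))

/-- A finite measure on `C(X, ℝ)` is determined by its finite-dimensional distributions on a
dense set. -/
lemma ext_of_dense {μ ν : Measure C(X, ℝ)} [IsFiniteMeasure μ] {s : Set X} (hd : Dense s)
    (h : ∀ t : Finset X, (t : Set X) ⊆ s →
      μ.map (fun f (x : t) => f x) = ν.map (fun f (x : t) => f x)) :
    μ = ν := by
  let := TopologicalSpace.metrizableSpaceMetric X
  obtain ⟨c, hcs, hc, hcd⟩ := hd.exists_countable_dense_subset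
  have hE := measurableEmbedding_restrict hc hcd
  -- Over the countable index set both images are projective limits of the same finite-dimensional
  -- laws; the embedding then pulls the equality back to `C(X, ℝ)`.
  have key : μ.map (fun f (x : c) => f x) = ν.map (fun f (x : c) => f x) := by
    have h1 : IsProjectiveLimit (μ.map (fun f (x : c) => f x))
        (fun J : Finset c => μ.map (fun f (x : J) => f x)) := by
      intro J
      rw [Measure.map_map (Finset.measurable_restrict _) hE.measurable]
      rfl
    have h2 : IsProjectiveLimit (ν.map (fun f (x : c) => f x))
        (fun J : Finset c => μ.map (fun f (x : J) => f x)) := by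
      intro J
      rw [Measure.map_map (Finset.measurable_restrict _) hE.measurable]
      have := h (J.map (Function.Embedding.subtype _)) (by
        intro x hx
        simp only [Finset.coe_map, Function.Embedding.subtype_apply, mem_image] at hx
        obtain ⟨y, -, rfl⟩ := hx
        exact hcs y.2)
      have h3 := congrArg (Measure.map (fun (g : (J.map (Function.Embedding.subtype _) : Finset X) → ℝ)
        (x : J) => g ⟨x.1.1, by simp⟩)) this
      rw [Measure.map_map (by fun_prop)
        (measurable_pi_lambda _ fun x => measurable_eval_path _), Measure.map_map (by fun_prop)
        (measurable_pi_lambda _ fun x => measurable_eval_path _)] at h3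
      exact h3.symm
    exact h1.unique h2
  rw [← hE.comap_map μ, ← hE.comap_map ν, key]

end ContinuousFunctions

/-! ### Laws of centered Gaussian processes -/

section GaussianLaw

variable {T Ω Ω' : Type*} [MeasurableSpace Ω] [MeasurableSpace Ω'] {P : Measure Ω}
  {P' : Measure Ω'}

/-- Mean and covariance determine a Gaussian law. The detour through `toLp 2` gives the inner
product structure on which `covarianceBilin` and `IsGaussian.ext` live; by symmetry the two forms
need comparing only on the diagonal. -/
lemma gaussian_vector_law_eq {ι : Type*} [Fintype ι] {X : ι → Ω → ℝ} {Y : ι → Ω' → ℝ}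
    (hX : HasGaussianLaw (fun ω i => X i ω) P) (hY : HasGaussianLaw (fun ω i => Y i ω) P')
    (hX0 : ∀ i, ∫ ω, X i ω ∂P = 0) (hY0 : ∀ i, ∫ ω, Y i ω ∂P' = 0)
    (hc : ∀ i j, covariance (X i) (X j) P = covariance (Y i) (Y j) P') :
    P.map (fun ω i => X i ω) = P'.map (fun ω i => Y i ω) := by
  apply (MeasurableEquiv.toLp 2 (_ → ℝ)).map_measurableEquiv_injective
  rw [MeasurableEquiv.coe_toLp, ← PiLp.coe_symm_continuousLinearEquiv 2 ℝ]
  have := hX.isGaussian_map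
  have := hY.isGaussian_map
  have mX := hX.aemeasurable
  have mY := hY.aemeasurable
  apply IsGaussian.ext
  · rw [integral_map (by fun_prop) (by fun_prop), integral_map mX (by fun_prop),
      integral_map (by fun_prop) (by fun_prop), integral_map mY (by fun_prop)]
    simp only [id_eq]
    rw [ContinuousLinearEquiv.integral_comp_comm, ContinuousLinearEquiv.integral_comp_comm]
    congr 1
    ext i
    rw [eval_integral (fun i => (hX.eval i).integrable),
      eval_integral (fun i => (hY.eval i).integrable), hX0, hY0]
  · rw [← ContinuousLinearMap.toBilinForm_inj]
    refine LinearMap.BilinForm.ext_of_isSymm isPosSemidef_covarianceBilin.isSymm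
      isPosSemidef_covarianceBilin.isSymm fun x ↦ ?_
    simp only [ContinuousLinearMap.toBilinForm_apply]
    rw [PiLp.coe_symm_continuousLinearEquiv, covarianceBilin_apply_pi, covarianceBilin_apply_pi]
    · congrm ∑ i, ∑ j, _ * ?_
      have hm : ∀ k : ι, Measurable fun x : ι → ℝ => x k := fun k => by fun_prop
      rw [covariance_map (hm i).aestronglyMeasurable (hm j).aestronglyMeasurable mX,
        covariance_map (hm i).aestronglyMeasurable (hm j).aestronglyMeasurable mY]
      exact hc i j
    · exact fun i ↦ ((hY.isGaussian_map).hasGaussianLaw_id.eval i).memLp_two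
    · exact fun i ↦ ((hX.isGaussian_map).hasGaussianLaw_id.eval i).memLp_two

/-- Two centered Gaussian processes with the same covariance function have the same law. -/
lemma gaussian_process_law_eq {X : T → Ω → ℝ} {Y : T → Ω' → ℝ}
    (hX : IsGaussianProcess X P) (hY : IsGaussianProcess Y P')
    (mX : ∀ t, Measurable (X t)) (mY : ∀ t, Measurable (Y t))
    (hX0 : ∀ i, ∫ ω, X i ω ∂P = 0) (hY0 : ∀ i, ∫ ω, Y i ω ∂P' = 0)
    (hc : ∀ i j, covariance (X i) (X j) P = covariance (Y i) (Y j) P') :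
    P.map (fun ω t => X t ω) = P'.map (fun ω t => Y t ω) := by
  have := hX.isProbabilityMeasure
  have := hY.isProbabilityMeasure
  have h1 : IsProjectiveLimit (P.map (fun ω t => X t ω))
      (fun J : Finset T => P.map (fun ω (t : J) => X t ω)) := fun J => by
    rw [Measure.map_map (Finset.measurable_restrict _) (by fun_prop)]
    rfl
  have h2 : IsProjectiveLimit (P'.map (fun ω t => Y t ω))
      (fun J : Finset T => P.map (fun ω (t : J) => X t ω)) := fun J => by
    rw [Measure.map_map (Finset.measurable_restrict _) (by fun_prop)]
    exact (gaussian_vector_law_eq (hX.hasGaussianLaw J) (hY.hasGaussianLaw J) (fun i => hX0 i)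
      (fun i => hY0 i) fun i j => hc i j).symm
  exact h1.unique h2

/-- Processes whose values are linear combinations of at most three values of a Gaussian process
are Gaussian. -/
lemma isGaussianProcess_of_comb {S : Type*} {X : T → Ω → ℝ} (hX : IsGaussianProcess X P)
    {Y : S → Ω → ℝ} (hY : ∀ s, ∃ a b d : T, ∃ x y w : ℝ, ∀ ω,
      Y s ω = x * X a ω + y * X b ω + w * X d ω) : IsGaussianProcess Y P := by
  classical
  refine hX.of_isGaussianProcess fun s => ?_
  obtain ⟨a, b, d, x, y, w, hz⟩ := hY s
  refine ⟨{a, b, d}, x • ContinuousLinearMap.proj ⟨a, by simp⟩ +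
    y • ContinuousLinearMap.proj ⟨b, by simp⟩ + w • ContinuousLinearMap.proj ⟨d, by simp⟩,
    fun z => ?_⟩
  rw [hz]
  simp [Finset.restrict]

end GaussianLaw

end

/-! ### Infima over subintervals -/

/-- The minimum of `f` over `[a, b]`. -/
def infOn (f : C(I, ℝ)) (a b : I) : ℝ := sInf (f '' Icc a b)

lemma infOn_le (f : C(I, ℝ)) {a b u : I} (h1 : a ≤ u) (h2 : u ≤ b) : infOn f a b ≤ f u :=
  csInf_le (bddBelow_image f _) ⟨u, ⟨h1, h2⟩, rfl⟩

lemma exists_infOn_eq (f : C(I, ℝ)) {a b : I} (h : a ≤ b) :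
    ∃ u, a ≤ u ∧ u ≤ b ∧ f u = infOn f a b := by
  have hne : (f '' Icc a b).Nonempty := (nonempty_Icc.2 h).image f
  have := (isCompact_Icc.image f.continuous).sInf_mem hne
  obtain ⟨u, hu, h2⟩ := this
  exact ⟨u, hu.1, hu.2, h2⟩

lemma le_infOn (f : C(I, ℝ)) {a b : I} (h : a ≤ b) {r : ℝ}
    (hr : ∀ u, a ≤ u → u ≤ b → r ≤ f u) : r ≤ infOn f a b :=
  le_csInf ((nonempty_Icc.2 h).image f) (by rintro _ ⟨u, hu, rfl⟩; exact hr u hu.1 hu.2)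

/-- Clamping moves the dependence on the end points from the domain of the infimum into the
function. The infimum is then over a fixed compact set, hence jointly continuous in `f`, `a` and
`b`. -/
lemma infOn_eq_clamp (f : C(I, ℝ)) {a b : I} (h : a ≤ b) :
    infOn f a b = sInf ((fun u => f (max a (min u b))) '' univ) := by
  unfold infOn
  congr 1
  ext r
  constructor
  · rintro ⟨u, hu, rfl⟩
    exact ⟨u, mem_univ _, by simp [hu.1, hu.2]⟩
  · rintro ⟨u, -, rfl⟩
    exact ⟨_, ⟨le_max_left _ _, max_le h (min_le_right _ _)⟩, rfl⟩

lemma continuous_clampInf : Continuous fun p : C(I, ℝ) × I × I =>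
    sInf ((fun u => p.1 (max p.2.1 (min u p.2.2))) '' univ) := by
  refine IsCompact.continuous_sInf (f := fun (p : C(I, ℝ) × I × I) (u : I) =>
    p.1 (max p.2.1 (min u p.2.2))) isCompact_univ ?_
  fun_prop

lemma continuous_infOn {Y : Type*} [TopologicalSpace Y] {f : Y → C(I, ℝ)} {a b : Y → I}
    (hf : Continuous f) (ha : Continuous a) (hb : Continuous b) (h : ∀ y, a y ≤ b y) :
    Continuous fun y => infOn (f y) (a y) (b y) := by
  simp_rw [infOn_eq_clamp _ (h _)]
  exact continuous_clampInf.comp (hf.prodMk (ha.prodMk hb))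

lemma treeDist_eq (f : C(I, ℝ)) (s t : I) :
    treeDist f s t = f s + f t - 2 * max (infOn f (s ⊓ t) (s ⊔ t))
      (min (infOn f 0 (s ⊓ t)) (infOn f (s ⊔ t) 1)) := by
  unfold treeDist infOn
  have h0 : (0 : I) ≤ s ⊓ t := bot_le
  have h1 : s ⊔ t ≤ 1 := le_top
  rw [image_union, csInf_union (bddBelow_image _ _) ((nonempty_Icc.2 h0).image _)
    (bddBelow_image _ _) ((nonempty_Icc.2 h1).image _)]

lemma continuous_treeDist {Y : Type*} [TopologicalSpace Y] {f : Y → C(I, ℝ)} {a b : Y → I}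
    (hf : Continuous f) (ha : Continuous a) (hb : Continuous b) :
    Continuous fun y => treeDist (f y) (a y) (b y) := by
  simp_rw [treeDist_eq]
  have h1 := continuous_infOn hf (ha.inf hb) (ha.sup hb) fun y => inf_le_sup
  have h2 := continuous_infOn hf (continuous_const (y := (0 : I))) (ha.inf hb) fun y => bot_le
  have h3 := continuous_infOn hf (ha.sup hb) (continuous_const (y := (1 : I))) fun y => le_top
  fun_prop

/-! ### Measurability of the pseudometric and of the marked points -/

lemma isClosed_forall {ι : Sort*} {Y : Type*} [TopologicalSpace Y] {p : ι → Y → Prop}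
    (h : ∀ i, IsClosed {y | p i y}) : IsClosed {y | ∀ i, p i y} := by
  convert isClosed_iInter h
  ext; simp

lemma continuous_f : Continuous SnakeSpace.f := continuous_fst.comp continuous_subtype_val

lemma continuous_g : Continuous SnakeSpace.g := continuous_snd.comp continuous_subtype_val

instance instBorelSpaceSnake : BorelSpace SnakeSpace := Subtype.borelSpace _

/-- For a fixed number of links and a non-strict bound on the length, the admissible pairs (path,
chain) form a closed set. Chains, written as full sequences, range over a compact space, so the
projection to the path is closed, and the strict sublevel set is a countable union of such
projections. -/
lemma measurable_matingDist (s t : I) : Measurable fun h => matingDist h s t := by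
  refine measurable_of_Iio fun r => ?_
  have hset : (fun h => matingDist h s t) ⁻¹' Iio r = ⋃ (k : ℕ) (n : ℕ),
      Prod.fst '' {p : SnakeSpace × (ℕ → I) × (ℕ → I) | p.2.1 0 = s ∧ p.2.2 k = t ∧
        (∀ j < k, treeDist p.1.f (p.2.2 j) (p.2.1 (j + 1)) = 0) ∧
        ∑ i ∈ Finset.range (k + 1), treeDist p.1.g (p.2.1 i) (p.2.2 i) ≤ r - 1 / (n + 1)} := by
    ext h
    simp only [mem_preimage, mem_Iio, mem_iUnion, mem_image, mem_ofPred_eq]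
    constructor
    · intro hlt
      obtain ⟨_, ⟨k, a, b, ha, hb, hc, rfl⟩, hr⟩ :=
        exists_lt_of_csInf_lt ⟨_, treeDist_mem_chainLengths h s t⟩ hlt
      obtain ⟨n, hn⟩ := exists_nat_one_div_lt (sub_pos.2 hr)
      exact ⟨k, n, ⟨h, a, b⟩, ⟨ha, hb, hc, by linarith⟩, rfl⟩
    · rintro ⟨k, n, ⟨h', a, b⟩, ⟨ha, hb, hc, hs⟩, rfl⟩
      have h1 := csInf_le (bddBelow_chainLengths h' s t) ⟨k, a, b, ha, hb, hc, rfl⟩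
      have h2 : (0 : ℝ) < 1 / (n + 1) := Nat.one_div_pos_of_nat
      unfold matingDist
      linarith
  rw [hset]
  refine MeasurableSet.iUnion fun k => MeasurableSet.iUnion fun n => ?_
  refine (isClosedMap_fst_of_compactSpace _ ?_).measurableSet
  have cf : Continuous fun p : SnakeSpace × (ℕ → I) × (ℕ → I) => p.1.f :=
    continuous_f.comp continuous_fst
  have cg : Continuous fun p : SnakeSpace × (ℕ → I) × (ℕ → I) => p.1.g :=
    continuous_g.comp continuous_fst
  have ca : ∀ i, Continuous fun p : SnakeSpace × (ℕ → I) × (ℕ → I) => p.2.1 i := fun i => by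
    fun_prop
  have cb : ∀ i, Continuous fun p : SnakeSpace × (ℕ → I) × (ℕ → I) => p.2.2 i := fun i => by
    fun_prop
  refine (isClosed_eq (ca 0) continuous_const).inter
    ((isClosed_eq (cb k) continuous_const).inter (IsClosed.inter ?_ ?_))
  · exact isClosed_forall fun j => isClosed_forall fun _ =>
      isClosed_eq (continuous_treeDist cf (cb j) (ca (j + 1))) continuous_const
  · exact isClosed_le (continuous_finsetSum _ fun i _ => continuous_treeDist cg (ca i) (cb i))
      continuous_const

lemma firstArgmin_le {f : C(I, ℝ)} {t : I} (ht : ∀ u, f t ≤ f u) : firstArgmin f ≤ t :=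
  sInf_le ht

/-- The first minimizer is at most `c` iff some minimizer is; this is the projection of a closed set
along the compact interval. -/
lemma measurable_firstArgmin : Measurable firstArgmin := by
  refine measurable_of_Iic fun c => ?_
  have : firstArgmin ⁻¹' Iic c =
      Prod.fst '' {p : C(I, ℝ) × I | p.2 ≤ c ∧ ∀ u, p.1 p.2 ≤ p.1 u} := by
    ext f
    simp only [mem_preimage, mem_Iic, mem_image, mem_ofPred_eq]
    constructor
    · exact fun h => ⟨⟨f, firstArgmin f⟩, ⟨h, isMin_firstArgmin f⟩, rfl⟩
    · rintro ⟨⟨f', t⟩, ⟨h1, h2⟩, rfl⟩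
      exact (firstArgmin_le h2).trans h1
  rw [this]
  refine (isClosedMap_fst_of_compactSpace _ ?_).measurableSet
  refine (isClosed_le continuous_snd continuous_const).inter ?_
  exact isClosed_forall fun u => isClosed_le (by fun_prop) (by fun_prop)

lemma measurable_orientationSign : Measurable orientationSign := by
  refine Measurable.ite ?_ measurable_const measurable_const
  exact measurableSet_le (measurable_subtype_coe.comp
    (measurable_firstArgmin.comp continuous_g.measurable)) measurable_const

/-! ### Measurability of `ψ` -/

lemma continuous_matingDist (h : SnakeSpace) : Continuous fun p : I × I => matingDist h p.1 p.2 := by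
  have := Mating.continuous_proj h
  have h2 : Continuous fun p : I × I => dist (Mating.proj h p.1) (Mating.proj h p.2) :=
    (this.comp continuous_fst).dist (this.comp continuous_snd)
  exact h2

/-- The pseudometric `d_h` as a continuous function on `[0,1]²`. -/
def matingMap (h : SnakeSpace) : C(I × I, ℝ) := ⟨fun p => matingDist h p.1 p.2, continuous_matingDist h⟩

instance instMeasurableSpaceSquare : MeasurableSpace C(I × I, ℝ) := borel _

instance instBorelSpaceSquare : BorelSpace C(I × I, ℝ) := ⟨rfl⟩

lemma measurable_matingMap : Measurable matingMap :=
  measurable_of_eval fun p => measurable_matingDist p.1 p.2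

/-- The Kuratowski embedding of the mating of trees into the space of continuous functions. -/
def kuratowski (h : SnakeSpace) : Mating h → C(I, ℝ) := fun x =>
  ⟨fun u => dist x (Mating.proj h u), continuous_const.dist (Mating.continuous_proj h)⟩

lemma isometry_kuratowski (h : SnakeSpace) : Isometry (kuratowski h) := by
  refine Isometry.of_dist_eq fun x y => le_antisymm ?_ ?_
  · refine (ContinuousMap.dist_le dist_nonneg).2 fun u => ?_
    exact abs_dist_sub_le x y (Mating.proj h u)
  · obtain ⟨u, rfl⟩ := Mating.proj_surjective h y
    have := ContinuousMap.dist_apply_le_dist (f := kuratowski h x)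
      (g := kuratowski h (Mating.proj h u)) u
    simpa [kuratowski, Real.dist_eq, abs_of_nonneg dist_nonneg] using this

/-- Distance profiles put all the spaces into the same `C(I, ℝ)`. The case `s = t` controls the
Hausdorff and Prokhorov terms, and `s ≠ t` the marked points. -/
lemma dist_kuratowski_proj (h h' : SnakeSpace) (s t : I) :
    dist (kuratowski h (Mating.proj h s)) (kuratowski h' (Mating.proj h' t)) ≤
      dist (matingMap h) (matingMap h') + matingDist h s t := by
  have h1 : dist (kuratowski h (Mating.proj h s)) (kuratowski h (Mating.proj h t)) =
      matingDist h s t := by rw [(isometry_kuratowski h).dist_eq, Mating.dist_proj]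
  have h2 : dist (kuratowski h (Mating.proj h t)) (kuratowski h' (Mating.proj h' t)) ≤
      dist (matingMap h) (matingMap h') :=
    (ContinuousMap.dist_le dist_nonneg).2 fun u =>
      ContinuousMap.dist_apply_le_dist (f := matingMap h) (g := matingMap h') (t, u)
  linarith [dist_triangle (kuratowski h (Mating.proj h s)) (kuratowski h (Mating.proj h t))
    (kuratowski h' (Mating.proj h' t))]

/-- Under `m` the pair `(α, β)` couples the two images at distance at most `δ`, so each set is
reached by one map only where the other reaches its `ε`-thickening, for every `ε > δ`. -/
lemma levyProkhorovEDist_map_le {Z Ω : Type*} [PseudoMetricSpace Z] [MeasurableSpace Z]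
    [BorelSpace Z] [MeasurableSpace Ω] (m : Measure Ω) {α β : Ω → Z} (hα : Measurable α)
    (hβ : Measurable β) {δ : ℝ} (hd : ∀ s, dist (α s) (β s) ≤ δ) :
    levyProkhorovEDist (m.map α) (m.map β) ≤ ENNReal.ofReal δ := by
  refine levyProkhorovEDist_le_of_forall _ _ _ fun ε B hε hε' hB => ?_
  have hδ : δ < ε.toReal := by
    rw [← ENNReal.ofReal_toReal hε'.ne] at hε
    exact (ENNReal.ofReal_lt_ofReal_iff'.1 hε).1
  rw [Measure.map_apply hα hB, Measure.map_apply hβ hB,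
    Measure.map_apply hα Metric.isOpen_thickening.measurableSet,
    Measure.map_apply hβ Metric.isOpen_thickening.measurableSet]
  constructor
  · refine (measure_mono fun s hs => ?_).trans le_self_add
    exact Metric.mem_thickening_iff.2 ⟨α s, hs, by rw [dist_comm]; exact (hd s).trans_lt hδ⟩
  · refine (measure_mono fun s hs => ?_).trans le_self_add
    exact Metric.mem_thickening_iff.2 ⟨β s, hs, (hd s).trans_lt hδ⟩

/-- The minimizers do not vary continuously with the paths, so they enter the bound as separate
coordinates. For fixed `h` it is a continuous function of `d_{h'}` and of the two marked times of
`h'`. -/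
lemma ghpDist_ψ_le (h h' : SnakeSpace) :
    ghpDist (ψ h) (ψ h') ≤ ENNReal.ofReal (dist (matingMap h) (matingMap h') +
      max (matingDist h (firstArgmin h.f) (firstArgmin h'.f))
        (matingDist h (firstArgmin h.g) (firstArgmin h'.g))) := by
  set δ := dist (matingMap h) (matingMap h')
  set m := max (matingDist h (firstArgmin h.f) (firstArgmin h'.f))
        (matingDist h (firstArgmin h.g) (firstArgmin h'.g))
  have hm : 0 ≤ m := le_max_of_le_left (matingDist_nonneg _ _ _)
  have key : ∀ s, dist (kuratowski h (Mating.proj h s)) (kuratowski h' (Mating.proj h' s)) ≤ δ :=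
    fun s => by simpa [matingDist_self] using dist_kuratowski_proj h h' s s
  have hle : ghpDist (ψ h) (ψ h') ≤
      max (max (Metric.hausdorffEDist (range (kuratowski h)) (range (kuratowski h')))
        (levyProkhorovEDist ((areaMeasure h).map (kuratowski h))
          ((areaMeasure h').map (kuratowski h'))))
        (⨆ i, edist (kuratowski h ((matingSpace h).pt i)) (kuratowski h' ((matingSpace h').pt i))) :=
    sInf_le ⟨matingSpace h, matingSpace h', rfl, rfl, C(I, ℝ), inferInstance, inferInstance,
      inferInstance, kuratowski h, kuratowski h', isometry_kuratowski h, isometry_kuratowski h',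
      rfl⟩
  refine hle.trans (max_le (max_le ?_ ?_) (iSup_le fun i => ?_))
  · refine Metric.hausdorffEDist_le_of_mem_edist ?_ ?_
    · rintro _ ⟨x, rfl⟩
      obtain ⟨s, rfl⟩ := Mating.proj_surjective h x
      refine ⟨_, ⟨Mating.proj h' s, rfl⟩, ?_⟩
      rw [edist_dist]
      exact ENNReal.ofReal_le_ofReal ((key s).trans (by linarith))
    · rintro _ ⟨x, rfl⟩
      obtain ⟨s, rfl⟩ := Mating.proj_surjective h' x
      refine ⟨_, ⟨Mating.proj h s, rfl⟩, ?_⟩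
      rw [edist_comm, edist_dist]
      exact ENNReal.ofReal_le_ofReal ((key s).trans (by linarith))
  · have e1 : ∀ k : SnakeSpace, (areaMeasure k).map (kuratowski k) =
        (volume : Measure I).map (kuratowski k ∘ Mating.proj k) := fun k =>
      Measure.map_map (isometry_kuratowski k).continuous.measurable
        (Mating.continuous_proj k).measurable
    rw [e1, e1]
    refine (levyProkhorovEDist_map_le _ ?_ ?_ key).trans
      (ENNReal.ofReal_le_ofReal (by linarith))
    · exact ((isometry_kuratowski h).continuous.comp (Mating.continuous_proj h)).measurable
    · exact ((isometry_kuratowski h').continuous.comp (Mating.continuous_proj h')).measurable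
  · rw [edist_dist]
    refine ENNReal.ofReal_le_ofReal ?_
    fin_cases i
    · exact (dist_kuratowski_proj h h' _ _).trans (by gcongr; exact le_max_left _ _)
    · exact (dist_kuratowski_proj h h' _ _).trans (by gcongr; exact le_max_right _ _)

/-- The map `h ↦ (d_h, s_*(f), s_*(g))` is measurable. By `ghpDist_ψ_le`, the preimage of an open
set under `ψ` is the preimage under this map of a union of open sets `W h`; the union may be
uncountable, as it is open anyway. -/
lemma measurable_ψ : Measurable ψ := by
  have hΨ : Measurable fun h : SnakeSpace => (matingMap h, firstArgmin h.f, firstArgmin h.g) :=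
    measurable_matingMap.prodMk ((measurable_firstArgmin.comp continuous_f.measurable).prodMk
      (measurable_firstArgmin.comp continuous_g.measurable))
  refine measurable_of_isOpen fun U hU => ?_
  have hU' : ∀ h : SnakeSpace, ∃ ε : ℝ, ψ h ∈ U → 0 < ε ∧ ∀ B, ghpDist (ψ h) B < ENNReal.ofReal ε →
      B ∈ U := fun h => by
    by_cases hh : ψ h ∈ U
    · obtain ⟨ε, hε, H⟩ := hU _ hh
      -- The radius may be infinite; truncating it at `1` makes it a positive real number.
      refine ⟨(min ε 1).toReal, fun _ => ⟨ENNReal.toReal_pos (by positivity) (by simp), fun B hB =>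
        H B (hB.trans_le ?_)⟩⟩
      rw [ENNReal.ofReal_toReal (by simp)]
      exact min_le_left _ _
    · exact ⟨0, fun h => absurd h hh⟩
  choose ε hε using hU'
  let W : SnakeSpace → Set (C(I × I, ℝ) × I × I) := fun h =>
    {y | dist (matingMap h) y.1 + max (matingDist h (firstArgmin h.f) y.2.1)
      (matingDist h (firstArgmin h.g) y.2.2) < ε h}
  have hW : ∀ h, IsOpen (W h) := fun h => by
    have c1 : Continuous fun y : C(I × I, ℝ) × I × I => matingDist h (firstArgmin h.f) y.2.1 :=
      (continuous_matingDist h).comp (by fun_prop : Continuous fun y : C(I × I, ℝ) × I × I =>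
        (firstArgmin h.f, y.2.1))
    have c2 : Continuous fun y : C(I × I, ℝ) × I × I => matingDist h (firstArgmin h.g) y.2.2 :=
      (continuous_matingDist h).comp (by fun_prop : Continuous fun y : C(I × I, ℝ) × I × I =>
        (firstArgmin h.g, y.2.2))
    exact isOpen_lt (by fun_prop) continuous_const
  have : ψ ⁻¹' U = (fun h : SnakeSpace => (matingMap h, firstArgmin h.f, firstArgmin h.g)) ⁻¹'
      ⋃ h ∈ ψ ⁻¹' U, W h := by
    ext h'
    simp only [mem_preimage, mem_iUnion, exists_prop, W, mem_ofPred_eq]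
    constructor
    · intro hh
      exact ⟨h', hh, by simpa [matingDist_self] using (hε h' hh).1⟩
    · rintro ⟨h, hh, hlt⟩
      refine (hε h hh).2 _ ((ghpDist_ψ_le h h').trans_lt ?_)
      exact (ENNReal.ofReal_lt_ofReal_iff (hε h hh).1).2 hlt
  rw [this]
  exact hΨ (isOpen_biUnion fun h _ => hW h).measurableSet

/-! ### Time reversal -/

/-- The time reversal `t ↦ f (1 - t)` of a path. -/
def rev (f : C(I, ℝ)) : C(I, ℝ) := f.comp ⟨σ, unitInterval.continuous_symm⟩

@[simp] lemma rev_apply (f : C(I, ℝ)) (t : I) : rev f t = f (σ t) := rfl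

@[simp] lemma rev_rev (f : C(I, ℝ)) : rev (rev f) = f := by ext t; simp

lemma continuous_rev : Continuous rev := ContinuousMap.continuous_precomp _

lemma infOn_rev (f : C(I, ℝ)) (a b : I) : infOn (rev f) a b = infOn f (σ b) (σ a) := by
  unfold infOn
  congr 1
  ext r
  constructor
  · rintro ⟨u, hu, rfl⟩
    exact ⟨σ u, ⟨unitInterval.symm_le_symm.2 hu.2, unitInterval.symm_le_symm.2 hu.1⟩, rfl⟩
  · rintro ⟨u, hu, rfl⟩
    exact ⟨σ u, ⟨unitInterval.le_symm_comm.1 hu.2, unitInterval.symm_le_comm.1 hu.1⟩, by simp⟩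

lemma symm_inf (s t : I) : σ (s ⊓ t) = σ s ⊔ σ t := by
  rcases le_total s t with h | h
  · rw [inf_eq_left.2 h, sup_eq_left.2 (unitInterval.symm_le_symm.2 h)]
  · rw [inf_eq_right.2 h, sup_eq_right.2 (unitInterval.symm_le_symm.2 h)]

lemma symm_sup (s t : I) : σ (s ⊔ t) = σ s ⊓ σ t := by
  rcases le_total s t with h | h
  · rw [sup_eq_right.2 h, inf_eq_right.2 (unitInterval.symm_le_symm.2 h)]
  · rw [sup_eq_left.2 h, inf_eq_left.2 (unitInterval.symm_le_symm.2 h)]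

lemma treeDist_rev (f : C(I, ℝ)) (s t : I) : treeDist (rev f) s t = treeDist f (σ s) (σ t) := by
  rw [treeDist_eq, treeDist_eq]
  simp only [infOn_rev, symm_inf, symm_sup, rev_apply, unitInterval.symm_zero,
    unitInterval.symm_one]
  rw [min_comm (infOn f (σ s ⊔ σ t) 1)]

/-- The time reversal of an encoding pair. -/
def revSnake (h : SnakeSpace) : SnakeSpace :=
  ⟨(rev h.f, rev h.g), by
    obtain ⟨⟨f, g⟩, ⟨h1, h2⟩, h3, h4⟩ := h
    simp_all [SnakeSpace.f, SnakeSpace.g]⟩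

@[simp] lemma revSnake_f (h : SnakeSpace) : (revSnake h).f = rev h.f := rfl

@[simp] lemma revSnake_g (h : SnakeSpace) : (revSnake h).g = rev h.g := rfl

@[simp] lemma revSnake_revSnake (h : SnakeSpace) : revSnake (revSnake h) = h := by
  apply Subtype.ext
  exact Prod.ext (rev_rev h.f) (rev_rev h.g)

lemma continuous_revSnake : Continuous revSnake :=
  ((continuous_rev.comp continuous_f).prodMk (continuous_rev.comp continuous_g)).subtype_mk _

lemma chainLengths_revSnake_subset (h : SnakeSpace) (s t : I) :
    chainLengths h (σ s) (σ t) ⊆ chainLengths (revSnake h) s t := by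
  rintro r ⟨k, a, b, ha, hb, hc, rfl⟩
  refine ⟨k, fun i => σ (a i), fun i => σ (b i), by simp [ha], by simp [hb], fun j hj => ?_, ?_⟩
  · simpa [treeDist_rev] using hc j hj
  · simp [treeDist_rev]

lemma matingDist_revSnake (h : SnakeSpace) (s t : I) :
    matingDist (revSnake h) s t = matingDist h (σ s) (σ t) := by
  unfold matingDist
  congr 1
  refine Subset.antisymm ?_ (chainLengths_revSnake_subset h s t)
  simpa using chainLengths_revSnake_subset (revSnake h) (σ s) (σ t)

/-- The isometry from `X_h` to the mating of trees of the reversed pair induced by `t ↦ 1 - t`. -/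
def matingRevMap (h : SnakeSpace) : Mating h → Mating (revSnake h) :=
  SeparationQuotient.lift (X := PreMating h) (fun s : I => Mating.proj (revSnake h) (σ s))
    fun s t hst => by
      have h0 : matingDist h s t = 0 := Metric.inseparable_iff.1 hst
      refine eq_of_dist_eq_zero ?_
      rw [Mating.dist_proj, matingDist_revSnake]
      exact (congrArg₂ (matingDist h) (unitInterval.symm_symm s)
        (unitInterval.symm_symm t)).trans h0

@[simp] lemma matingRevMap_proj (h : SnakeSpace) (s : I) :
    matingRevMap h (Mating.proj h s) = Mating.proj (revSnake h) (σ s) := rfl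

lemma isometry_matingRevMap (h : SnakeSpace) : Isometry (matingRevMap h) := by
  refine Isometry.of_dist_eq fun x y => ?_
  obtain ⟨s, rfl⟩ := Mating.proj_surjective h x
  obtain ⟨t, rfl⟩ := Mating.proj_surjective h y
  rw [matingRevMap_proj, matingRevMap_proj, Mating.dist_proj, Mating.dist_proj,
    matingDist_revSnake]
  simp

lemma surjective_matingRevMap (h : SnakeSpace) : Function.Surjective (matingRevMap h) := by
  intro y
  obtain ⟨s, rfl⟩ := Mating.proj_surjective _ y
  exact ⟨Mating.proj h (σ s), by simp⟩

lemma rev_isMin {f : C(I, ℝ)} {s : I} (hs : ∀ u, f s ≤ f u) (u : I) :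
    rev f (σ s) ≤ rev f u := by
  simpa using hs (σ u)

/-- Reversal preserves Lebesgue measure and sends minimizers to minimizers, though not the first to
the first. The marked points do not depend on the chosen minimizer, which is all that is needed. -/
lemma ψ_revSnake (h : SnakeSpace) : ψ (revSnake h) = ψ h := by
  symm
  refine Quotient.sound ⟨IsometryEquiv.mk' (matingRevMap h) (Function.surjInv
    (surjective_matingRevMap h)) (Function.surjInv_eq _) (isometry_matingRevMap h), ?_, ?_⟩
  · change (areaMeasure h).map (matingRevMap h) = areaMeasure (revSnake h)
    unfold areaMeasure
    rw [Measure.map_map (isometry_matingRevMap h).continuous.measurable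
      (Mating.continuous_proj h).measurable]
    have : matingRevMap h ∘ Mating.proj h = Mating.proj (revSnake h) ∘ σ := rfl
    rw [this, ← Measure.map_map (Mating.continuous_proj _).measurable
      unitInterval.continuous_symm.measurable, unitInterval.measurePreserving_symm.map_eq]
  · intro i
    fin_cases i
    · exact markedPoint₀_eq _ (rev_isMin (isMin_firstArgmin _))
    · exact markedPoint₁_eq _ (rev_isMin (isMin_firstArgmin _))

/-- The time `1/2`. -/
def half : I := ⟨1 / 2, by norm_num, by norm_num⟩

lemma symm_half : σ half = half := by
  apply Subtype.ext
  simp [half]; norm_num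

lemma orientationSign_eq (h : SnakeSpace) :
    orientationSign h = if firstArgmin h.g ≤ half then 1 else -1 := rfl

lemma zero_le_half : (0 : I) ≤ half := bot_le

lemma half_le_one : half ≤ 1 := le_top

/-- Without a tie all minimizers lie strictly on one side of `1/2`, so it does not matter that
reversal turns the last minimizer into the first. -/
lemma orientationSign_revSnake {h : SnakeSpace} (hh : infOn h.g 0 half ≠ infOn h.g half 1) :
    orientationSign (revSnake h) = -orientationSign h := by
  have key : ∀ s t : I, (∀ u, h.g s ≤ h.g u) → (∀ u, h.g t ≤ h.g u) → s ≤ half → ¬ half ≤ t := by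
    intro s t hs ht h1 h2
    refine hh (le_antisymm ?_ ?_)
    · obtain ⟨u, -, -, hu⟩ := exists_infOn_eq h.g half_le_one
      rw [← hu]
      exact (infOn_le _ bot_le h1).trans (hs u)
    · obtain ⟨u, -, -, hu⟩ := exists_infOn_eq h.g zero_le_half
      rw [← hu]
      exact (infOn_le _ h2 le_top).trans (ht u)
  have hm := isMin_firstArgmin h.g
  have hr : ∀ u, h.g (σ (firstArgmin (rev h.g))) ≤ h.g u := fun u => by
    simpa using isMin_firstArgmin (rev h.g) (σ u)
  rw [orientationSign_eq, orientationSign_eq, revSnake_g]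
  by_cases h1 : firstArgmin h.g ≤ half
  · rw [if_pos h1, if_neg fun h2 => ?_]
    have := key _ _ hm hr h1
    rw [unitInterval.le_symm_comm, symm_half] at this
    exact this h2
  · rw [if_neg h1, if_pos, neg_neg]
    have h3 : half ≤ σ (firstArgmin (rev h.g)) := (not_le.1 h1).le.trans (firstArgmin_le hr)
    rwa [unitInterval.le_symm_comm, symm_half] at h3

/-! ### The law of the snake is invariant under time reversal -/

lemma dense_Ioo_unitInterval : Dense (Ioo (0 : I) 1) := by
  intro t
  rw [closure_Ioo zero_ne_one]
  exact ⟨bot_le, le_top⟩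

lemma excursionLaw_unique {μ ν : Measure C(I, ℝ)} [IsFiniteMeasure μ] (hμ : IsExcursionLaw μ)
    (hν : IsExcursionLaw ν) : μ = ν := by
  refine ext_of_dense dense_Ioo_unitInterval fun t ht => ?_
  have hhalf : half ∈ Ioo (0 : I) 1 := by
    constructor <;> rw [← Subtype.coe_lt_coe] <;> norm_num [half]
  -- The densities are given for at least one time; inserting `half` covers the empty set of times.
  obtain ⟨n, hn⟩ : ∃ n, (insert half t).card = n + 1 :=
    Nat.exists_eq_succ_of_ne_zero (by simp)
  let e := (insert half t).orderIsoOfFin hn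
  have hmem : ∀ i, (e i : I) ∈ Ioo (0 : I) 1 := fun i => by
    rcases Finset.mem_insert.1 (e i).2 with h | h
    · rw [h]; exact hhalf
    · exact ht h
  have h1 := hμ n (fun i => e i) (fun i j hij => e.strictMono hij) (hmem _).1 (hmem _).2
  rw [← hν n (fun i => e i) (fun i j hij => e.strictMono hij) (hmem _).1 (hmem _).2] at h1
  have h2 := congrArg (Measure.map (fun (x : Fin (n + 1) → ℝ) (y : t) =>
    x (e.symm ⟨y, Finset.mem_insert_of_mem y.2⟩))) h1
  have hm : Measurable fun (f : C(I, ℝ)) (i : Fin (n + 1)) => f (e i) :=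
    measurable_pi_lambda _ fun i => measurable_eval_path _
  rw [Measure.map_map (by fun_prop) hm, Measure.map_map (by fun_prop) hm] at h2
  simpa [Function.comp_def] using h2

lemma killedDensity_symm (t x y : ℝ) : killedDensity t x y = killedDensity t y x := by
  unfold killedDensity
  rw [show (y - x) ^ 2 = (x - y) ^ 2 by ring, add_comm y x]

/-- Reversal exchanges the two hitting densities, and the transition density of the killed motion is
symmetric in its end points. -/
lemma excursionDensity_rev {n : ℕ} (t x : Fin (n + 1) → ℝ) :
    excursionDensity (fun i => 1 - t i.rev) (fun i => x i.rev) = excursionDensity t x := by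
  unfold excursionDensity
  have hp : (∀ i : Fin (n + 1), 0 < x i.rev) ↔ ∀ i, 0 < x i :=
    ⟨fun h i => by simpa using h i.rev, fun h i => h _⟩
  simp only [hp]
  split_ifs with h
  · simp only [Fin.rev_zero, Fin.rev_last, sub_sub_cancel]
    have : ∏ i : Fin n, killedDensity (1 - t i.succ.rev - (1 - t i.castSucc.rev))
        (x i.castSucc.rev) (x i.succ.rev) =
        ∏ i : Fin n, killedDensity (t i.succ - t i.castSucc) (x i.castSucc) (x i.succ) := by
      rw [← Equiv.prod_comp Fin.revPerm]
      refine Finset.prod_congr rfl fun i _ => ?_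
      simp only [Fin.revPerm_apply]
      rw [Fin.rev_succ, Fin.rev_castSucc, Fin.rev_rev, killedDensity_symm]
      congr 1
      ring
    rw [this]
    ring
  · rfl

lemma IsExcursionLaw.map_rev {ν : Measure C(I, ℝ)} (hν : IsExcursionLaw ν) :
    IsExcursionLaw (ν.map rev) := by
  intro n t ht h0 h1
  have h2 := hν n (fun i => σ (t i.rev))
    (fun i j hij => unitInterval.symm_lt_symm.2 (ht (Fin.rev_lt_rev.2 hij)))
    (by rw [unitInterval.lt_symm_comm, unitInterval.symm_zero]; simpa using h1)
    (by rw [unitInterval.symm_lt_comm, unitInterval.symm_one]; simpa using h0)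
  have hm : ∀ s : Fin (n + 1) → I, Measurable fun (f : C(I, ℝ)) i => f (s i) := fun s =>
    measurable_pi_lambda _ fun i => measurable_eval_path _
  let E : (Fin (n + 1) → ℝ) ≃ᵐ (Fin (n + 1) → ℝ) :=
    MeasurableEquiv.piCongrLeft (fun _ => ℝ) Fin.revPerm
  have hE : ∀ x i, E x i = x i.rev := fun x i => by
    have := MeasurableEquiv.piCongrLeft_apply_apply (β := fun _ : Fin (n + 1) => ℝ) Fin.revPerm x i.rev
    simpa using this
  have hEp : MeasurePreserving E volume volume :=
    volume_measurePreserving_piCongrLeft (fun _ => ℝ) Fin.revPerm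
  have h3 := congrArg (Measure.map E) h2
  rw [Measure.map_map E.measurable (hm _)] at h3
  rw [Measure.map_map (hm _) continuous_rev.measurable]
  have h4 : (E ∘ fun (e : C(I, ℝ)) i => e (σ (t i.rev))) = (fun e i => e (t i)) ∘ rev := by
    ext e i
    simp [hE]
  rw [← h4, h3]
  ext A hA
  rw [Measure.map_apply E.measurable hA, withDensity_apply _ (E.measurable hA),
    withDensity_apply _ hA]
  refine Eq.trans ?_ (hEp.setLIntegral_comp_preimage_emb E.measurableEmbedding _ A)
  refine lintegral_congr fun x => ?_
  rw [← excursionDensity_rev (fun i => (t i : ℝ)),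
    show (fun i => E x i.rev) = x from funext fun i => by simp [hE]]
  simp

lemma isGaussianProcess_map {Ω T : Type*} [MeasurableSpace Ω] {Q : Measure Ω} {F : Ω → C(I, ℝ)}
    (hF : Measurable F) {s : T → I} (h : IsGaussianProcess (fun t ω => F ω (s t)) Q) :
    IsGaussianProcess (fun (t : T) (z : C(I, ℝ)) => z (s t)) (Q.map F) := by
  refine ⟨fun J => ⟨?_⟩⟩
  have hm : Measurable fun (z : C(I, ℝ)) => J.restrict fun t => z (s t) :=
    measurable_pi_lambda _ fun i => measurable_eval_path _
  rw [Measure.map_map hm hF]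
  exact (h.hasGaussianLaw J).isGaussian_map

lemma IsLabelLaw.map_rev {e : C(I, ℝ)} {Q : Measure C(I, ℝ)} (h : IsLabelLaw e Q) :
    IsLabelLaw (rev e) (Q.map rev) := by
  have hr : Measurable rev := continuous_rev.measurable
  refine ⟨isGaussianProcess_map (s := id) hr (h.1.comp_right σ), fun t => ?_, fun s t => ?_⟩
  · rw [integral_map hr.aemeasurable (measurable_eval_path t).aestronglyMeasurable]
    exact h.2.1 (σ t)
  · rw [covariance_map (measurable_eval_path s).aestronglyMeasurable
      (measurable_eval_path t).aestronglyMeasurable hr.aemeasurable]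
    refine (h.2.2 (σ s) (σ t)).trans ?_
    change infOn e _ _ = infOn (rev e) _ _
    rw [infOn_rev, symm_inf, symm_sup]

lemma labelLaw_unique {e : C(I, ℝ)} {Q Q' : Measure C(I, ℝ)} (h : IsLabelLaw e Q)
    (h' : IsLabelLaw e Q') : Q = Q' := by
  have := h.1.isProbabilityMeasure
  refine ext_of_dense dense_univ fun t _ => ?_
  exact gaussian_vector_law_eq (h.1.hasGaussianLaw t) (h'.1.hasGaussianLaw t) (fun i => h.2.1 i)
    (fun i => h'.2.1 i) fun i j => (h.2.2 i j).trans (h'.2.2 i j).symm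

lemma measurable_f : Measurable SnakeSpace.f := continuous_f.measurable

lemma measurable_g : Measurable SnakeSpace.g := continuous_g.measurable

lemma snakeMeasure_ext {P P' : Measure SnakeSpace}
    (h : P.map (fun h => (h.f, h.g)) = P'.map (fun h => (h.f, h.g))) : P = P' := by
  ext A hA
  obtain ⟨B, hB, rfl⟩ := hA
  have := congrFun (congrArg DFunLike.coe h) B
  rwa [Measure.map_apply (measurable_f.prodMk measurable_g) hB,
    Measure.map_apply (measurable_f.prodMk measurable_g) hB] at this

/-- The excursion law is reversible because its finite-dimensional laws determine it. The label law
is determined by its covariance, so `κ (rev e)` is the reversal of `κ e` wherever both `e` and `rev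
e` have labels of the right law, that is, almost everywhere. -/
lemma IsSnakeLaw.map_revSnake {P : Measure SnakeSpace} (hP : IsSnakeLaw P) :
    P.map revSnake = P := by
  have := hP.isProbabilityMeasure
  obtain ⟨κ, hκ, hPκ, hlab⟩ := hP.labels
  have hr : Measurable rev := continuous_rev.measurable
  set μ := P.map SnakeSpace.f with hμ
  have : IsProbabilityMeasure μ := Measure.isProbabilityMeasure_map measurable_f.aemeasurable
  have hμr : μ.map rev = μ := (excursionLaw_unique hP.excursion hP.excursion.map_rev).symm
  have hmp : MeasurePreserving rev μ μ := ⟨hr, hμr⟩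
  have hκr : ∀ᵐ e ∂μ, κ (rev e) = (κ e).map rev := by
    filter_upwards [hlab, hmp.quasiMeasurePreserving.ae hlab] with e h1 h2
    exact labelLaw_unique h2 h1.map_rev
  refine snakeMeasure_ext ?_
  have hfg : Measurable fun h : SnakeSpace => (h.f, h.g) := measurable_f.prodMk measurable_g
  have hrr : Measurable (Prod.map rev rev) := hr.prodMap hr
  rw [Measure.map_map hfg continuous_revSnake.measurable]
  have h1 : ((fun h : SnakeSpace => (h.f, h.g)) ∘ revSnake) =
    Prod.map rev rev ∘ fun h : SnakeSpace => (h.f, h.g) := rfl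
  rw [h1, ← Measure.map_map hrr hfg, hPκ]
  ext A hA
  rw [Measure.map_apply hrr hA, Measure.compProd_apply (hrr hA), Measure.compProd_apply hA]
  rw [← hmp.lintegral_comp (Kernel.measurable_kernel_prodMk_left hA)]
  refine lintegral_congr_ae ?_
  filter_upwards [hκr] with e he
  rw [he, Measure.map_apply hr (measurable_prodMk_left hA)]
  rfl

section

/-! ### The spine of a coding function -/

/-- The covariance function `min_{[s∧t, s∨t]} e` of the labels. -/
def labelCov (e : C(I, ℝ)) (s t : I) : ℝ := infOn e (s ⊓ t) (s ⊔ t)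

lemma labelCov_comm (e : C(I, ℝ)) (s t : I) : labelCov e s t = labelCov e t s := by
  rw [labelCov, labelCov, inf_comm, sup_comm]

lemma labelCov_of_le (e : C(I, ℝ)) {s t : I} (h : s ≤ t) : labelCov e s t = infOn e s t := by
  rw [labelCov, inf_eq_left.2 h, sup_eq_right.2 h]

lemma infOn_self (e : C(I, ℝ)) (t : I) : infOn e t t = e t := by simp [infOn]

lemma labelCov_self (e : C(I, ℝ)) (t : I) : labelCov e t t = e t := by
  rw [labelCov_of_le e le_rfl, infOn_self]

lemma infOn_split (e : C(I, ℝ)) {a b c : I} (h1 : a ≤ b) (h2 : b ≤ c) :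
    infOn e a c = min (infOn e a b) (infOn e b c) := by
  refine le_antisymm (le_min ?_ ?_) ?_
  · exact le_infOn e h1 fun u hu hu' => infOn_le e hu (hu'.trans h2)
  · exact le_infOn e h2 fun u hu hu' => infOn_le e (h1.trans hu) hu'
  · refine le_infOn e (h1.trans h2) fun u hu hu' => ?_
    rcases le_total u b with h | h
    · exact (min_le_left _ _).trans (infOn_le e hu h)
    · exact (min_le_right _ _).trans (infOn_le e h hu')

lemma continuous_labelCov (e : C(I, ℝ)) (s : I) : Continuous fun t => labelCov e t s :=
  continuous_infOn continuous_const (continuous_id.inf continuous_const)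
    (continuous_id.sup continuous_const) fun _ => inf_le_sup

/-- The running minimum of `e` after time `1/2`. -/
def runMin (e : C(I, ℝ)) (t : I) : ℝ := infOn e half t

/-- The times `c ≥ 1/2` at which `e` attains its minimum over `[1/2, c]`. -/
def spine (e : C(I, ℝ)) : Set I := {c | half ≤ c ∧ ∀ u, half ≤ u → u ≤ c → e c ≤ e u}

variable {e : C(I, ℝ)}

lemma runMin_of_mem_spine {c : I} (hc : c ∈ spine e) : runMin e c = e c :=
  le_antisymm (infOn_le e hc.1 le_rfl) (le_infOn e hc.1 hc.2)

lemma half_mem_spine : half ∈ spine e :=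
  ⟨le_rfl, fun u h1 h2 => by rw [le_antisymm h1 h2]⟩

lemma isClosed_spine : IsClosed (spine e) := by
  have h1 : spine e = Ici half ∩ {c | e c ≤ infOn e half (max half c)} := by
    ext c
    refine and_congr_right fun hc => ?_
    change _ ↔ e c ≤ infOn e half (max half c)
    rw [max_eq_right hc]
    exact ⟨fun h => le_infOn e hc h, fun h u h1 h2 => h.trans (infOn_le e h1 h2)⟩
  rw [h1]
  exact isClosed_Ici.inter (isClosed_le e.continuous (continuous_infOn continuous_const
    continuous_const (continuous_const.max continuous_id) fun _ => le_max_left _ _))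

lemma exists_mem_spine_runMin {t : I} (ht : half ≤ t) :
    ∃ c ∈ spine e, c ≤ t ∧ e c = runMin e t := by
  obtain ⟨c, h1, h2, h3⟩ := exists_infOn_eq e ht
  exact ⟨c, ⟨h1, fun u hu hu' => h3.trans_le (infOn_le e hu (hu'.trans h2))⟩, h2, h3⟩

/-- The first time after `1/2` at height `d` works: an earlier value below `d` would give an earlier
passage at `d`. -/
lemma exists_mem_spine_eq {d : ℝ} (h1 : e 1 ≤ d) (h2 : d ≤ e half) : ∃ c ∈ spine e, e c = d := by
  have hcomp : IsCompact {t : I | half ≤ t ∧ e t = d} :=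
    (isClosed_Ici.inter (isClosed_eq e.continuous continuous_const)).isCompact
  have hne : {t : I | half ≤ t ∧ e t = d}.Nonempty := by
    obtain ⟨t, ht, ht2⟩ := intermediate_value_Icc' half_le_one e.continuous.continuousOn ⟨h1, h2⟩
    exact ⟨t, ht.1, ht2⟩
  obtain ⟨c, hc, hmin⟩ := hcomp.exists_isLeast hne
  refine ⟨c, ⟨hc.1, fun u hu hu' => ?_⟩, hc.2⟩
  by_contra hlt
  rw [hc.2, not_le] at hlt
  obtain ⟨t, ht, ht2⟩ := intermediate_value_Icc' hu e.continuous.continuousOn ⟨hlt.le, h2⟩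
  have : u = c := le_antisymm hu' ((hmin ⟨ht.1, ht2⟩).trans ht.2)
  rw [this, hc.2] at hlt
  exact lt_irrefl _ hlt

/-- In the tree the spine is a segment parametrised by height, and the lineage of `t` joins it at
height `runMin e t`. On the spine itself this gives the covariance of Brownian motion in the height.
-/
lemma labelCov_spine {c t : I} (hc : c ∈ spine e) (ht : half ≤ t) :
    labelCov e c t = min (e c) (runMin e t) := by
  rcases le_total c t with h | h
  · rw [labelCov_of_le e h, runMin, infOn_split e hc.1 h, ← runMin, runMin_of_mem_spine hc,
      ← min_assoc, min_self, min_eq_right (infOn_le e le_rfl h)]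
  · rw [labelCov_comm, labelCov_of_le e h]
    have h1 : infOn e t c = e c := le_antisymm (infOn_le e h le_rfl)
      (le_infOn e h fun u hu hu' => hc.2 u (ht.trans hu) hu')
    rw [h1, min_eq_left]
    exact le_infOn e ht fun u hu hu' => hc.2 u hu (hu'.trans h)

lemma labelCov_spine_spine {c d : I} (hc : c ∈ spine e) (hd : d ∈ spine e) :
    labelCov e c d = min (e c) (e d) := by
  rw [labelCov_spine hc hd.1, runMin_of_mem_spine hd]

/-- Times with different running minima belong to branches grafted at different heights, whose
lineages meet only on the spine. -/
lemma labelCov_of_runMin_ne {s t : I} (hs : half ≤ s) (ht : half ≤ t)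
    (h : runMin e s ≠ runMin e t) : labelCov e s t = min (runMin e s) (runMin e t) := by
  wlog hst : s ≤ t generalizing s t
  · rw [labelCov_comm, this ht hs h.symm (le_of_not_ge hst), min_comm]
  have h1 : runMin e t = min (runMin e s) (infOn e s t) := infOn_split e hs hst
  rw [labelCov_of_le e hst]
  rcases le_total (runMin e s) (infOn e s t) with h2 | h2
  · exact absurd (by rw [h1, min_eq_left h2]) h
  · rw [h1, min_eq_right h2, min_eq_right h2]

/-- A point of the spine before time `t` at which `e` attains its minimum over `[1/2, t]`. -/
def spineAnc (e : C(I, ℝ)) (t : I) : I :=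
  if h : half ≤ t then (exists_mem_spine_runMin (e := e) h).choose else half

lemma spineAnc_spec {t : I} (ht : half ≤ t) :
    spineAnc e t ∈ spine e ∧ spineAnc e t ≤ t ∧ e (spineAnc e t) = runMin e t := by
  rw [spineAnc, dif_pos ht]
  exact (exists_mem_spine_runMin (e := e) ht).choose_spec

/-- A point of the spine at height `d`. -/
def spinePt (e : C(I, ℝ)) (d : ℝ) : I :=
  if h : e 1 ≤ d ∧ d ≤ e half then (exists_mem_spine_eq h.1 h.2).choose else half

lemma spinePt_mem (d : ℝ) : spinePt e d ∈ spine e := by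
  rw [spinePt]
  split_ifs with h
  · exact (exists_mem_spine_eq h.1 h.2).choose_spec.1
  · exact half_mem_spine

lemma apply_spinePt {d : ℝ} (h1 : e 1 ≤ d) (h2 : d ≤ e half) : e (spinePt e d) = d := by
  rw [spinePt, dif_pos ⟨h1, h2⟩]
  exact (exists_mem_spine_eq h1 h2).choose_spec.2

lemma apply_le_half {c : I} (hc : c ∈ spine e) : e c ≤ e half := hc.2 half le_rfl hc.1

/-! ### Covariances of labels -/

variable {Q : Measure C(I, ℝ)}

lemma IsLabelLaw.memLp (h : IsLabelLaw e Q) (t : I) : MemLp (fun z : C(I, ℝ) => z t) 2 Q :=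
  (h.1.hasGaussianLaw_eval t).memLp_two

lemma IsLabelLaw.cov (h : IsLabelLaw e Q) (s t : I) :
    covariance (fun z : C(I, ℝ) => z s) (fun z => z t) Q = labelCov e s t := h.2.2 s t

lemma IsLabelLaw.cov_sub (h : IsLabelLaw e Q) (a b t : I) :
    covariance (fun z : C(I, ℝ) => z a - z b) (fun z => z t) Q =
      labelCov e a t - labelCov e b t := by
  have := h.1.isProbabilityMeasure
  rw [covariance_fun_sub_left (h.memLp a) (h.memLp b) (h.memLp t), h.cov, h.cov]

lemma IsLabelLaw.cov_sub_sub (h : IsLabelLaw e Q) (a b c d : I) :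
    covariance (fun z : C(I, ℝ) => z a - z b) (fun z => z c - z d) Q =
      labelCov e a c - labelCov e b c - (labelCov e a d - labelCov e b d) := by
  have := h.1.isProbabilityMeasure
  rw [covariance_fun_sub_right (X := fun z : C(I, ℝ) => z a - z b)
    ((h.memLp a).sub (h.memLp b)) (h.memLp c) (h.memLp d), h.cov_sub,
    h.cov_sub]

lemma IsLabelLaw.map_sub (h : IsLabelLaw e Q) (a b : I) :
    Q.map (fun z : C(I, ℝ) => z a - z b) =
      gaussianReal 0 (e a - 2 * labelCov e a b + e b).toNNReal := by
  have := h.1.isProbabilityMeasure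
  have hg : HasGaussianLaw (fun z : C(I, ℝ) => z a - z b) Q := h.1.hasGaussianLaw_fun_sub
  rw [hg.map_eq_gaussianReal, ← covariance_self hg.aemeasurable, h.cov_sub_sub,
    integral_sub ((h.memLp a).integrable (by norm_num)) ((h.memLp b).integrable (by norm_num)),
    h.2.1, h.2.1, sub_zero, labelCov_self, labelCov_self, labelCov_comm e b a]
  congr 2
  ring

/-- Almost surely the minimum of the labels over `[0, 1/2]` differs from their minimum over an
interval `[a, b]` on which `e` stays above its running minimum. -/
lemma IsLabelLaw.measure_tie_branch (h : IsLabelLaw e Q) {a b : I} (ha : half ≤ a) (hab : a ≤ b)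
    (hgap : runMin e b < infOn e a b) :
    Q {z | infOn z 0 half = infOn z a b} = 0 := by
  have := h.1.isProbabilityMeasure
  have hb := ha.trans hab
  obtain ⟨hτ, hτb, hτe⟩ := spineAnc_spec (e := e) hb
  set τ := spineAnc e b with hτdef
  -- By `hgap`, the running minimum at `b` was already reached before `a`, so `[a, b]` lies in one
  -- branch, grafted at `τ`.
  have hτa : τ < a := by
    by_contra hle
    have := infOn_le e (not_lt.1 hle) hτb
    linarith
  set v := e b - runMin e b with hv
  have hv0 : 0 < v := by
    have := infOn_le e hab le_rfl
    simp only [hv]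
    linarith
  have hτcov : labelCov e b τ = runMin e b := by
    rw [labelCov_comm, labelCov_spine hτ hb, hτe, min_self]
  -- `c t` is the regression coefficient of `z t` on `N = z b - z τ`, whose variance is `v`;
  -- subtracting `N • c` leaves a residual path independent of `N`. It vanishes on `[0, 1/2]` and is
  -- positive on `[a, b]`.
  let c : C(I, ℝ) := ⟨fun t => (labelCov e t b - labelCov e t τ) / v,
    ((continuous_labelCov e b).sub (continuous_labelCov e τ)).div_const v⟩
  have hc : ∀ t, c t = (labelCov e t b - labelCov e t τ) / v := fun t => rfl
  have hc0 : ∀ t ≤ half, c t = 0 := fun t ht => by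
    rw [hc, labelCov_of_le e (ht.trans hb), labelCov_of_le e (ht.trans hτ.1),
      infOn_split e ht hb, infOn_split e ht hτ.1]
    change (min _ (runMin e b) - min _ (runMin e τ)) / v = 0
    rw [runMin_of_mem_spine hτ, hτe, sub_self, zero_div]
  have hcpos : ∀ t, a ≤ t → t ≤ b → 0 < c t := fun t h1 h2 => by
    rw [hc]
    refine div_pos ?_ hv0
    have e1 : labelCov e t τ ≤ runMin e b := by
      rw [labelCov_comm, labelCov_spine hτ (ha.trans h1), hτe]
      exact min_le_left _ _
    have e2 : infOn e a b ≤ labelCov e t b := by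
      rw [labelCov_of_le e h2]
      exact le_infOn e h2 fun u hu hu' => infOn_le e (h1.trans hu) hu'
    linarith
  let N : C(I, ℝ) → ℝ := fun z => z b - z τ
  let Y : C(I, ℝ) → C(I, ℝ) := fun z => z - (z b - z τ) • c
  have hNm : Measurable N := (measurable_eval_path b).sub (measurable_eval_path τ)
  have hYm : Measurable Y := by
    have : Continuous Y := by fun_prop
    exact this.measurable
  have hNself : covariance N N Q = v := by
    rw [h.cov_sub_sub, hτcov, labelCov_comm e τ b, hτcov, labelCov_self, labelCov_self, hτe]
    ring
  have hgY : ∀ t, (fun z => Y z t) = fun z => z t - c t * N z := fun t => by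
    ext z
    simp only [Y, N, ContinuousMap.sub_apply, ContinuousMap.smul_apply, smul_eq_mul]
    ring
  have hind : IndepFun (fun z t => Y z t) (fun z (_ : Unit) => N z) Q := by
    refine IsGaussianProcess.indepFun_of_covariance_eq_zero (X := fun t z => Y z t)
      (Y := fun (_ : Unit) z => N z) ?_
      (fun s => ((measurable_eval_path s).comp hYm).aemeasurable) (fun _ => hNm.aemeasurable) ?_
    · refine isGaussianProcess_of_comb h.1 ?_
      rintro (t | _)
      · refine ⟨t, b, τ, 1, -c t, c t, fun z => ?_⟩
        change Y z t = _
        rw [congrFun (hgY t) z]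
        simp only [N]; ring
      · exact ⟨b, τ, τ, 1, -1, 0, fun z => by simp [N]; ring⟩
    · intro t _
      have hNL : MemLp N 2 Q := (h.memLp b).sub (h.memLp τ)
      rw [hgY t, covariance_fun_sub_left (h.memLp t) (hNL.const_mul _) hNL,
        covariance_const_mul_left, hNself, covariance_comm, h.cov_sub, hc, labelCov_comm e b,
        labelCov_comm e τ]
      field_simp
      ring
  have hind2 : IndepFun Y N Q := by
    have h1 := hind.comp measurable_id (measurable_pi_apply ())
    rw [IndepFun_iff_Indep] at h1 ⊢
    have h2 : MeasurableSpace.comap (fun z t => Y z t) MeasurableSpace.pi =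
        MeasurableSpace.comap Y instMeasurableSpacePath := by
      rw [← comap_eval_eq (X := I), MeasurableSpace.comap_comp]
      rfl
    rw [← h2]
    exact h1
  rw [indepFun_iff_map_prod_eq_prod_map_map hYm.aemeasurable hNm.aemeasurable] at hind2
  have hNlaw : Q.map N = gaussianReal 0 v.toNNReal := by
    rw [h.map_sub, hτcov, hτe]
    congr 2
    rw [hv]; ring
  have hv1 : v.toNNReal ≠ 0 := by simpa using hv0
  have := nullSingletonClass_gaussianReal (μ := 0) hv1
  let K : Set (C(I, ℝ) × ℝ) := {p | infOn (p.1 + p.2 • c) 0 half = infOn (p.1 + p.2 • c) a b}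
  have hK : MeasurableSet K := by
    refine (isClosed_eq (continuous_infOn (by fun_prop) continuous_const continuous_const
      fun _ => zero_le_half) (continuous_infOn (by fun_prop) continuous_const continuous_const
      fun _ => hab)).measurableSet
  have hKQ : {z | infOn z 0 half = infOn z a b} = (fun z => (Y z, N z)) ⁻¹' K := by
    ext z
    have : Y z + N z • c = z := by simp [Y, N]
    change _ ↔ infOn (Y z + N z • c) 0 half = infOn (Y z + N z • c) a b
    rw [this]
    rfl
  rw [hKQ, ← Measure.map_apply (hYm.prodMk hNm) hK, hind2, hNlaw, Measure.measure_prod_null hK]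
  -- For a fixed residual `y`, the minimum over `[0, 1/2]` is constant in the increment `x` and the
  -- minimum over `[a, b]` is strictly increasing. At most one `x` gives a tie, and the Gaussian law
  -- has no atoms.
  refine Filter.Eventually.of_forall fun y => ?_
  refine Set.Subsingleton.measure_zero ?_ _
  have hL : ∀ x : ℝ, infOn (y + x • c) 0 half = infOn y 0 half := fun x => by
    unfold infOn
    congr 1
    refine image_congr fun u hu => ?_
    simp [hc0 u hu.2]
  have hmono : ∀ x x' : ℝ, x < x' → infOn (y + x • c) a b < infOn (y + x' • c) a b := by
    intro x x' hx
    obtain ⟨u, hu1, hu2, hu3⟩ := exists_infOn_eq (y + x' • c) hab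
    rw [← hu3]
    refine (infOn_le _ hu1 hu2).trans_lt ?_
    simp only [ContinuousMap.add_apply, ContinuousMap.smul_apply, smul_eq_mul]
    have := mul_lt_mul_of_pos_right hx (hcpos u hu1 hu2)
    linarith
  intro x hx x' hx'
  have hx1 : infOn (y + x • c) 0 half = infOn (y + x • c) a b := hx
  have hx2 : infOn (y + x' • c) 0 half = infOn (y + x' • c) a b := hx'
  rw [hL] at hx1 hx2
  rcases lt_trichotomy x x' with hlt | heq | hlt
  · have := hmono _ _ hlt; linarith
  · exact heq
  · have := hmono _ _ hlt; linarith

end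

section

/-! ### Independent Gaussian variables -/

section GaussianSequences

variable {Ω : Type*} [MeasurableSpace Ω] {Q : Measure Ω}

lemma gaussian_lower_tail {v : NNReal} (hv : v ≠ 0) :
    gaussianReal 0 v (Iio (-√v)) = gaussianReal 0 1 (Iio (-1)) := by
  have h := gaussianReal_map_const_mul (μ := 0) (v := 1) (√v)
  have h2 : gaussianReal 0 v = (gaussianReal 0 1).map (√(v : ℝ) * ·) := by
    rw [h]
    congr 1
    · simp
    · ext; simp
  rw [h2, Measure.map_apply (by fun_prop) measurableSet_Iio]
  congr 1
  ext x
  have hs : 0 < √(v : ℝ) := Real.sqrt_pos.2 (by positivity)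
  simp only [mem_preimage, mem_Iio]
  constructor <;> intro h <;> nlinarith

lemma gaussian_lower_tail_pos : gaussianReal 0 1 (Iio (-1)) ≠ 0 := by
  intro h
  have := gaussianReal_absolutelyContinuous' 0 (v := 1) one_ne_zero h
  simp at this

/-- Falling below minus one standard deviation has the same positive probability for every `k`, so
the second Borel–Cantelli lemma applies. -/
lemma iIndepFun.frequently_lt {ξ : ℕ → Ω → ℝ} (hi : iIndepFun ξ Q)
    (hm : ∀ k, Measurable (ξ k)) {v : ℕ → NNReal} (hv : ∀ k, v k ≠ 0)
    (hlaw : ∀ k, Q.map (ξ k) = gaussianReal 0 (v k)) :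
    ∀ᵐ ω ∂Q, ∃ᶠ k in Filter.atTop, ξ k ω < -√(v k) := by
  have := hi.isProbabilityMeasure
  have hms : ∀ k, MeasurableSet (ξ k ⁻¹' Iio (-√(v k))) := fun k => hm k measurableSet_Iio
  have h1 : Q (Filter.limsup (fun k => ξ k ⁻¹' Iio (-√(v k))) Filter.atTop) = 1 := by
    refine measure_limsup_eq_one hms ?_ ?_
    · exact (iIndepSet_iff_meas_biInter hms).2 fun s => hi.meas_biInter
        fun i _ => ⟨Iio _, measurableSet_Iio, rfl⟩
    · have : ∀ k, Q (ξ k ⁻¹' Iio (-√(v k))) = gaussianReal 0 1 (Iio (-1)) := fun k => by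
        rw [← Measure.map_apply (hm k) measurableSet_Iio, hlaw, gaussian_lower_tail (hv k)]
      simp_rw [this]
      exact ENNReal.tsum_const_eq_top_of_ne_zero gaussian_lower_tail_pos
  rw [← prob_compl_eq_zero_iff (by exact MeasurableSet.measurableSet_limsup hms)] at h1
  filter_upwards [compl_mem_ae_iff.2 h1] with ω hω
  rw [compl_compl, Filter.mem_limsup_iff_frequently_mem] at hω
  exact hω

lemma iIndepFun_of_gaussian {ξ : ℕ → Ω → ℝ} (hg : IsGaussianProcess ξ Q)
    (hm : ∀ k, Measurable (ξ k)) (hc : ∀ j k, j ≠ k → covariance (ξ j) (ξ k) Q = 0) :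
    iIndepFun ξ Q := by
  have h := IsGaussianProcess.iIndepFun_of_covariance_eq_zero (P := Q) (S := fun _ : ℕ => Unit)
    (X := fun k _ => ξ k) (hg.comp_right fun p : (_ : ℕ) × Unit => p.1)
    (fun k _ => (hm k).aemeasurable) (fun j k hjk _ _ => hc j k hjk)
  exact h.comp (fun _ f => f ()) fun _ => measurable_pi_apply _

/-- Chernoff's bound for `X` and `-X`, with the exponent `ε / w` that is optimal for variance `w`.
The bound `w` stands in for `v`, which may vanish. -/
lemma measure_abs_ge_gaussian [IsProbabilityMeasure Q] {X : Ω → ℝ} (hX : Measurable X)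
    {v : NNReal} (hlaw : Q.map X = gaussianReal 0 v) {w ε : ℝ} (hw : 0 < w) (hvw : v ≤ w)
    (hε : 0 ≤ ε) :
    Q {ω | ε ≤ |X ω|} ≤ ENNReal.ofReal (2 * Real.exp (-ε ^ 2 / (2 * w))) := by
  have key : ∀ Y : Ω → ℝ, Measurable Y → Q.map Y = gaussianReal 0 v →
      Q {ω | ε ≤ Y ω} ≤ ENNReal.ofReal (Real.exp (-ε ^ 2 / (2 * w))) := by
    intro Y hY hl
    have hint : Integrable (fun ω => Real.exp (ε / w * Y ω)) Q := by
      have := integrable_exp_mul_gaussianReal (μ := 0) (v := v) (ε / w)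
      rw [← hl] at this
      exact this.comp_measurable hY
    have h1 := measure_ge_le_exp_mul_mgf ε (div_nonneg hε hw.le) hint
    rw [mgf_gaussianReal hl, ← Real.exp_add] at h1
    rw [← ofReal_measureReal]
    refine ENNReal.ofReal_le_ofReal (h1.trans (Real.exp_le_exp.2 ?_))
    have h2 : (v : ℝ) * (ε / w) ^ 2 / 2 ≤ w * (ε / w) ^ 2 / 2 := by gcongr
    have h3 : -(ε / w) * ε + w * (ε / w) ^ 2 / 2 = -ε ^ 2 / (2 * w) := by
      field_simp
      ring
    linarith
  have hneg : Q.map (fun ω => -X ω) = gaussianReal 0 v := by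
    have := gaussianReal_map_neg (μ := 0) (v := v)
    rw [← hlaw, Measure.map_map measurable_neg hX, neg_zero] at this
    exact this
  have hsub : {ω | ε ≤ |X ω|} ⊆ {ω | ε ≤ X ω} ∪ {ω | ε ≤ -X ω} := fun ω hω => by
    have : ε ≤ |X ω| := hω
    exact le_abs.1 this
  refine (measure_mono hsub).trans ((measure_union_le _ _).trans ?_)
  refine (add_le_add (key X hX hlaw) (key _ hX.neg hneg)).trans ?_
  rw [← ENNReal.ofReal_add (Real.exp_pos _).le (Real.exp_pos _).le, ← two_mul]

/-- A Brownian motion sampled along a fast decreasing sequence of times takes a negative value. -/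
lemma ae_exists_neg_of_cov_min {X : ℕ → Ω → ℝ} (hg : IsGaussianProcess X Q)
    (hm : ∀ k, Measurable (X k)) (h0 : ∀ k, ∫ ω, X k ω ∂Q = 0) {r : ℝ} (hr : 0 < r)
    (hc : ∀ j k, covariance (X j) (X k) Q = min (r * (1 / 2) ^ (j ^ 2)) (r * (1 / 2) ^ (k ^ 2))) :
    ∀ᵐ ω ∂Q, ∃ k, X k ω < 0 := by
  have := hg.isProbabilityMeasure
  -- Since `u (k + 1) = u k * 2^{-2k-1}`, the increment `Δ k = X k - X (k + 1)` has variance at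
  -- least `u k / 2`, while eventually `|X (k + 1)| < √(u k / 2)`. Whenever `Δ k` is below minus its
  -- standard deviation, `X k` is then negative.
  set u : ℕ → ℝ := fun k => r * (1 / 2) ^ (k ^ 2) with hu
  have hupos : ∀ k, 0 < u k := fun k => by simp only [hu]; positivity
  have hanti : Antitone u := fun j k hjk => by
    simp only [hu]
    gcongr ?_ * ?_
    exact pow_le_pow_of_le_one (by norm_num) (by norm_num) (Nat.pow_le_pow_left hjk 2)
  have hsucc : ∀ k, u (k + 1) = u k * (1 / 2 * (1 / 4) ^ k) := fun k => by
    simp only [hu]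
    rw [show (k + 1) ^ 2 = k ^ 2 + 2 * k + 1 by ring, pow_succ, pow_add, pow_mul]
    norm_num
    ring
  have hhalf : ∀ k, u (k + 1) ≤ u k / 2 := fun k => by
    rw [hsucc]
    have : ((1 : ℝ) / 4) ^ k ≤ 1 := pow_le_one₀ (by norm_num) (by norm_num)
    nlinarith [hupos k]
  have hL : ∀ k, MemLp (X k) 2 Q := fun k => (hg.hasGaussianLaw_eval k).memLp_two
  let Δ : ℕ → Ω → ℝ := fun k ω => X k ω - X (k + 1) ω
  have hΔm : ∀ k, Measurable (Δ k) := fun k => (hm k).sub (hm (k + 1))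
  have hcov : ∀ j k, covariance (Δ j) (Δ k) Q =
      min (u j) (u k) - min (u (j + 1)) (u k) - (min (u j) (u (k + 1)) -
        min (u (j + 1)) (u (k + 1))) := fun j k => by
    have hLj : MemLp (Δ j) 2 Q := (hL j).sub (hL (j + 1))
    rw [covariance_fun_sub_right hLj (hL k) (hL (k + 1)),
      covariance_fun_sub_left (hL j) (hL (j + 1)) (hL k),
      covariance_fun_sub_left (hL j) (hL (j + 1)) (hL (k + 1)), hc, hc, hc, hc]
  have hΔg : IsGaussianProcess Δ Q := isGaussianProcess_of_comb hg fun k =>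
    ⟨k, k + 1, k, 1, -1, 0, fun ω => by simp only [Δ]; ring⟩
  have hind : iIndepFun Δ Q := iIndepFun_of_gaussian hΔg hΔm fun j k hjk => by
    rw [hcov]
    wlog hlt : j < k generalizing j k
    · have := this k j hjk.symm (by omega)
      rw [min_comm (u j), min_comm (u (j + 1)), min_comm (u j), min_comm (u (j + 1))]
      linarith
    rw [min_eq_right (hanti hlt.le), min_eq_right (hanti (show j + 1 ≤ k by omega)),
      min_eq_right (hanti (show j ≤ k + 1 by omega)),
      min_eq_right (hanti (show j + 1 ≤ k + 1 by omega))]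
    ring
  have hvar : ∀ k, covariance (Δ k) (Δ k) Q = u k - u (k + 1) := fun k => by
    rw [hcov, min_self, min_self, min_eq_left (hanti (show k ≤ k + 1 by omega)),
      min_eq_right (hanti (show k ≤ k + 1 by omega))]
    ring
  have hlawΔ : ∀ k, Q.map (Δ k) = gaussianReal 0 (u k - u (k + 1)).toNNReal := fun k => by
    rw [(hΔg.hasGaussianLaw_eval k).map_eq_gaussianReal,
      ← covariance_self (hΔm k).aemeasurable, hvar]
    congr 1
    simp only [Δ]
    rw [integral_sub ((hL k).integrable (by norm_num)) ((hL _).integrable (by norm_num)), h0, h0,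
      sub_zero]
  have hlawX : ∀ k, Q.map (X k) = gaussianReal 0 (u k).toNNReal := fun k => by
    rw [(hg.hasGaussianLaw_eval k).map_eq_gaussianReal, ← covariance_self (hm k).aemeasurable, hc,
      min_self, h0]
  have hfreq := iIndepFun.frequently_lt hind hΔm (v := fun k => (u k - u (k + 1)).toNNReal)
    (fun k => by
      have := hhalf k
      have := hupos k
      simp only [ne_eq, Real.toNNReal_eq_zero, not_le]
      linarith) hlawΔ
  have hev : ∀ᵐ ω ∂Q, ∀ᶠ k in Filter.atTop, ω ∉ {ω | √(u k / 2) ≤ |X (k + 1) ω|} := by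
    refine ae_eventually_notMem (ne_top_of_le_ne_top (b := ∑' k : ℕ, ENNReal.ofReal
      (2 * (1 / 4 : ℝ) ^ k * 2)) ?_ (ENNReal.tsum_le_tsum fun k => ?_))
    · exact (((summable_geometric_of_lt_one (by norm_num) (by norm_num)).mul_left 2).mul_right
        2).tsum_ofReal_ne_top
    · refine (measure_abs_ge_gaussian (hm (k + 1)) (hlawX (k + 1)) (hupos (k + 1))
        (by rw [Real.coe_toNNReal _ (hupos _).le]) (Real.sqrt_nonneg _)).trans
        (ENNReal.ofReal_le_ofReal ?_)
      rw [Real.sq_sqrt (by have := hupos k; positivity), hsucc]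
      have h4 : (0 : ℝ) < (1 / 4) ^ k := by positivity
      have huk := hupos k
      have e1 : -(u k / 2) / (2 * (u k * (1 / 2 * (1 / 4) ^ k))) = -(1 / (2 * (1 / 4 : ℝ) ^ k)) := by
        field_simp
      rw [e1, Real.exp_neg]
      -- The crude bound `exp (-y) ≤ 1 / y`, with `y = 4ᵏ / 2`, already gives a geometric series.
      have e2 : 1 / (2 * (1 / 4 : ℝ) ^ k) ≤ Real.exp (1 / (2 * (1 / 4 : ℝ) ^ k)) :=
        (by linarith : _ ≤ 1 / (2 * (1 / 4 : ℝ) ^ k) + 1).trans (Real.add_one_le_exp _)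
      have e3 := inv_anti₀ (by positivity) e2
      rw [inv_div, div_one] at e3
      linarith
  filter_upwards [hfreq, hev] with ω h1 h2
  obtain ⟨k, hk1, hk2⟩ := (h1.and_eventually h2).exists
  refine ⟨k, ?_⟩
  have hk3 : |X (k + 1) ω| < √(u k / 2) := not_le.1 hk2
  have hle : √(u k / 2) ≤ √(u k - u (k + 1)) := Real.sqrt_le_sqrt (by linarith [hhalf k])
  rw [Real.coe_toNNReal _ (by linarith [hhalf k, hupos k])] at hk1
  have := (abs_lt.1 hk3).2
  simp only [Δ] at hk1
  linarith

end GaussianSequences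

end

section

/-! ### Modulus of continuity of the labels along the spine -/

variable {e : C(I, ℝ)} {Q : Measure C(I, ℝ)}

lemma IsLabelLaw.nonneg (h : IsLabelLaw e Q) (t : I) : 0 ≤ e t := by
  have := h.cov t t
  rw [labelCov_self, covariance_self (measurable_eval_path t).aemeasurable] at this
  rw [← this]
  exact variance_nonneg _ _

/-- Lévy's modulus at scale `2⁻ⁿ`. -/
def levyMod (n : ℕ) : ℝ := 2 * √(n * (1 / 2) ^ n)

lemma levyMod_nonneg (n : ℕ) : 0 ≤ levyMod n := by unfold levyMod; positivity

lemma levyMod_sq (n : ℕ) : levyMod n ^ 2 = 4 * (n * (1 / 2) ^ n) := by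
  rw [levyMod, mul_pow, Real.sq_sqrt (by positivity)]
  norm_num

/-- The squared ratio is `(n + 1) / (2 n)`, which is at most `(3/4)² = 9/16` exactly from `n = 8`
on. -/
lemma levyMod_succ {n : ℕ} (hn : 8 ≤ n) : levyMod (n + 1) ≤ 3 / 4 * levyMod n := by
  refine abs_le_of_sq_le_sq' ?_ (by have := levyMod_nonneg n; positivity) |>.2
  rw [mul_pow, levyMod_sq, levyMod_sq, pow_succ]
  have h1 : (8 : ℝ) ≤ n := by exact_mod_cast hn
  have h2 : (0 : ℝ) < (1 / 2) ^ n := by positivity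
  push_cast
  nlinarith

lemma tendsto_levyMod : Filter.Tendsto levyMod Filter.atTop (nhds 0) := by
  have h := tendsto_self_mul_const_pow_of_lt_one (r := (1 / 2 : ℝ)) (by norm_num) (by norm_num)
  have h2 := (h.sqrt).const_mul 2
  rw [Real.sqrt_zero, mul_zero] at h2
  exact h2

/-- The factor `2` in `levyMod` makes the Gaussian exponent `2 n`. The order of `2ⁿ` dyadic
intervals at scale `n` is then beaten because `2 e⁻² < 1`. -/
lemma IsLabelLaw.measure_abs_sub_ge (h : IsLabelLaw e Q) {a b : I} {n : ℕ}
    (hab : e a - 2 * labelCov e a b + e b ≤ (1 / 2) ^ n) :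
    Q {z | levyMod n ≤ |z a - z b|} ≤ ENNReal.ofReal (2 * Real.exp (-(2 * n))) := by
  have := h.1.isProbabilityMeasure
  have hw : (0 : ℝ) < (1 / 2) ^ n := by positivity
  refine (measure_abs_ge_gaussian ((measurable_eval_path a).sub (measurable_eval_path b))
    (h.map_sub a b) hw ?_ (levyMod_nonneg n)).trans (ENNReal.ofReal_le_ofReal ?_)
  · rw [Real.coe_toNNReal']
    exact max_le hab hw.le
  · rw [levyMod_sq]
    have : -(4 * (n * (1 / 2 : ℝ) ^ n)) / (2 * (1 / 2) ^ n) = -(2 * n) := by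
      field_simp
      ring
    rw [this]

lemma two_mul_exp_neg_two_lt : 2 * Real.exp (-2) < 1 := by
  have h1 : 1 + 1 ≤ Real.exp 1 := Real.add_one_le_exp 1
  have h2 : Real.exp (-2) = (Real.exp 1 * Real.exp 1)⁻¹ := by
    rw [← Real.exp_add, ← Real.exp_neg]; norm_num
  rw [h2, ← div_eq_mul_inv, div_lt_one (by positivity)]
  nlinarith

/-- The point of the spine at the dyadic height `k 2⁻ⁿ`. -/
def dyadicPt (e : C(I, ℝ)) (n k : ℕ) : I := spinePt e (k * (1 / 2) ^ n)

lemma dyadicPt_mem (e : C(I, ℝ)) (n k : ℕ) : dyadicPt e n k ∈ spine e := spinePt_mem _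

lemma IsLabelLaw.ae_dyadic_increments (h : IsLabelLaw e Q) (h1 : e 1 = 0) :
    ∀ᵐ z ∂Q, ∀ᶠ n in Filter.atTop, ∀ k : ℕ, ((k + 1 : ℕ) : ℝ) * (1 / 2) ^ n ≤ e half →
      |z (dyadicPt e n (k + 1)) - z (dyadicPt e n k)| ≤ levyMod n := by
  set K : ℕ → ℕ := fun n => ⌊e half * 2 ^ n⌋₊
  let A : ℕ → Set C(I, ℝ) := fun n => ⋃ k ∈ Finset.range (K n),
    {z | levyMod n ≤ |z (dyadicPt e n (k + 1)) - z (dyadicPt e n k)|}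
  have hK : ∀ n k : ℕ, k ∈ Finset.range (K n) ↔ ((k + 1 : ℕ) : ℝ) * (1 / 2) ^ n ≤ e half := by
    intro n k
    rw [Finset.mem_range, ← Nat.add_one_le_iff, Nat.le_floor_iff (by have := h.nonneg half; positivity),
      one_div, inv_pow, ← div_eq_mul_inv, div_le_iff₀ (by positivity)]
  have hA : ∀ n, Q (A n) ≤ ENNReal.ofReal (2 * e half * (2 * Real.exp (-2)) ^ n) := by
    intro n
    refine (measure_biUnion_finset_le _ _).trans ((Finset.sum_le_card_nsmul _ _
      (ENNReal.ofReal (2 * Real.exp (-(2 * n)))) fun k hk => ?_).trans ?_)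
    · rw [hK] at hk
      refine h.measure_abs_sub_ge ?_
      have hk0 : (0 : ℝ) ≤ k * (1 / 2) ^ n := by positivity
      have hle : (k : ℝ) * (1 / 2) ^ n ≤ ((k + 1 : ℕ) : ℝ) * (1 / 2) ^ n := by
        gcongr; omega
      have e1 : e (dyadicPt e n (k + 1)) = ((k + 1 : ℕ) : ℝ) * (1 / 2) ^ n :=
        apply_spinePt (by rw [h1]; linarith) hk
      have e2 : e (dyadicPt e n k) = (k : ℝ) * (1 / 2) ^ n :=
        apply_spinePt (by rw [h1]; linarith) (hle.trans hk)
      rw [labelCov_spine_spine (dyadicPt_mem _ _ _) (dyadicPt_mem _ _ _), e1, e2, min_eq_right hle]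
      push_cast
      linarith
    · rw [Finset.card_range, nsmul_eq_mul, ← ENNReal.ofReal_natCast, ← ENNReal.ofReal_mul (by positivity)]
      refine ENNReal.ofReal_le_ofReal ?_
      have hKle : (K n : ℝ) ≤ e half * 2 ^ n :=
        Nat.floor_le (by have := h.nonneg half; positivity)
      rw [mul_pow, ← Real.exp_nat_mul, show (n : ℝ) * -2 = -(2 * n) by ring]
      have := Real.exp_pos (-(2 * n : ℝ))
      nlinarith
  have hsum : ∑' n, Q (A n) ≠ ∞ := by
    refine ne_top_of_le_ne_top ?_ (ENNReal.tsum_le_tsum hA)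
    exact ((summable_geometric_of_lt_one (by positivity)
      two_mul_exp_neg_two_lt).mul_left _).tsum_ofReal_ne_top
  filter_upwards [ae_eventually_notMem hsum] with z hz
  filter_upwards [hz] with n hn k hk
  by_contra hlt
  refine hn (mem_biUnion (x := k) ((hK n k).2 hk) ?_)
  exact (not_le.1 hlt).le

/-- The dyadic approximation from below of the height of `c`. -/
def dyadicApprox (e : C(I, ℝ)) (n : ℕ) (c : I) : I := dyadicPt e n ⌊e c * 2 ^ n⌋₊

lemma dyadicApprox_mem (e : C(I, ℝ)) (n : ℕ) (c : I) : dyadicApprox e n c ∈ spine e :=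
  dyadicPt_mem _ _ _

lemma floor_mul_le {x : ℝ} (hx : 0 ≤ x) (n : ℕ) : (⌊x * 2 ^ n⌋₊ : ℝ) * (1 / 2) ^ n ≤ x := by
  rw [one_div, inv_pow, ← div_eq_mul_inv, div_le_iff₀ (by positivity)]
  exact Nat.floor_le (by positivity)

lemma lt_floor_mul (x : ℝ) (n : ℕ) : x < (⌊x * 2 ^ n⌋₊ : ℝ) * (1 / 2) ^ n + (1 / 2) ^ n := by
  have := Nat.lt_floor_add_one (x * 2 ^ n)
  rw [one_div, inv_pow, ← add_one_mul, ← div_eq_mul_inv, lt_div_iff₀ (by positivity)]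
  exact this

/-- Several spine times may share a height, and their labels are not yet known to agree, so
continuity of `z` does not yield convergence of the dyadic approximations. A second Borel–Cantelli
argument, at each fixed `c`, does. -/
lemma IsLabelLaw.ae_tendsto_dyadicApprox (h : IsLabelLaw e Q) (h1 : e 1 = 0) {c : I}
    (hc : c ∈ spine e) :
    ∀ᵐ z ∂Q, ∀ᶠ n in Filter.atTop, |z c - z (dyadicApprox e n c)| ≤ levyMod n := by
  have hA : ∀ n : ℕ, Q {z | levyMod n ≤ |z c - z (dyadicApprox e n c)|} ≤
      ENNReal.ofReal (2 * Real.exp (-2) ^ n) := fun n => by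
    have h2 := floor_mul_le (h.nonneg c) n
    have h3 := lt_floor_mul (e c) n
    have e2 : e (dyadicApprox e n c) = (⌊e c * 2 ^ n⌋₊ : ℝ) * (1 / 2) ^ n :=
      apply_spinePt (by rw [h1]; positivity) (h2.trans (apply_le_half hc))
    refine (h.measure_abs_sub_ge ?_).trans_eq ?_
    · rw [labelCov_spine_spine hc (dyadicApprox_mem _ _ _), e2, min_eq_right h2]
      linarith
    · rw [← Real.exp_nat_mul, show (n : ℝ) * -2 = -(2 * n) by ring]
  have hsum : ∑' n, Q {z | levyMod n ≤ |z c - z (dyadicApprox e n c)|} ≠ ∞ := by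
    refine ne_top_of_le_ne_top ?_ (ENNReal.tsum_le_tsum hA)
    exact ((summable_geometric_of_lt_one (by positivity) (by
      have := two_mul_exp_neg_two_lt
      have := Real.exp_pos (-2)
      linarith)).mul_left _).tsum_ofReal_ne_top
  filter_upwards [ae_eventually_notMem hsum] with z hz
  filter_upwards [hz] with n hn
  exact (not_le.1 hn).le

/-- Chaining: consecutive approximations coincide or are neighbours at the finer scale. The constant
`3` reproduces itself, since `(3 + 1) * (3/4) = 3`, and a fine scale supplied by `hlim` starts the
descent. -/
lemma abs_sub_dyadicApprox_le (he : ∀ t, 0 ≤ e t) {z : C(I, ℝ)} {n₀ : ℕ} (hn₀ : 8 ≤ n₀)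
    (hinc : ∀ n ≥ n₀, ∀ k : ℕ, ((k + 1 : ℕ) : ℝ) * (1 / 2) ^ n ≤ e half →
      |z (dyadicPt e n (k + 1)) - z (dyadicPt e n k)| ≤ levyMod n) {c : I} (hc : c ∈ spine e)
    (hlim : ∀ᶠ n in Filter.atTop, |z c - z (dyadicApprox e n c)| ≤ levyMod n) {n : ℕ}
    (hn : n₀ ≤ n) : |z c - z (dyadicApprox e n c)| ≤ 3 * levyMod n := by
  have step : ∀ j ≥ n₀, |z (dyadicApprox e (j + 1) c) - z (dyadicApprox e j c)| ≤
      levyMod (j + 1) := by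
    intro j hj
    have hx : 0 ≤ e c * 2 ^ j := by have := he c; positivity
    have hfl : ⌊e c * 2 ^ (j + 1)⌋₊ = 2 * ⌊e c * 2 ^ j⌋₊ ∨
        ⌊e c * 2 ^ (j + 1)⌋₊ = 2 * ⌊e c * 2 ^ j⌋₊ + 1 := by
      have a1 := Nat.floor_le hx
      have a2 := Nat.lt_floor_add_one (e c * 2 ^ j)
      have hx2 : 0 ≤ e c * 2 ^ (j + 1) := by have := he c; positivity
      have b1 : 2 * ⌊e c * 2 ^ j⌋₊ ≤ ⌊e c * 2 ^ (j + 1)⌋₊ := by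
        rw [Nat.le_floor_iff hx2, pow_succ]; push_cast; linarith
      have b2 : ⌊e c * 2 ^ (j + 1)⌋₊ < 2 * ⌊e c * 2 ^ j⌋₊ + 2 := by
        rw [Nat.floor_lt hx2, pow_succ]; push_cast; linarith
      omega
    have hsame : dyadicApprox e j c = dyadicPt e (j + 1) (2 * ⌊e c * 2 ^ j⌋₊) := by
      unfold dyadicApprox dyadicPt
      congr 1
      rw [pow_succ]; push_cast; ring
    rw [hsame]
    rcases hfl with hf | hf
    · rw [dyadicApprox, hf, sub_self, abs_zero]
      exact levyMod_nonneg _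
    · rw [dyadicApprox, hf]
      refine hinc (j + 1) (by omega) _ ?_
      rw [← hf]
      exact (floor_mul_le (he c) _).trans (apply_le_half hc)
  obtain ⟨N, hN, hnN⟩ := (hlim.and (Filter.eventually_ge_atTop n)).exists
  obtain ⟨m, rfl⟩ := Nat.exists_eq_add_of_le hnN
  clear hnN
  induction m generalizing n with
  | zero =>
    have := levyMod_nonneg n
    simp only [add_zero] at hN
    linarith
  | succ m ih =>
    have h1 := ih (n := n + 1) (by omega) (by rwa [show n + 1 + m = n + (m + 1) by omega])
    have h2 := step n hn
    have h3 := levyMod_succ (hn₀.trans hn)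
    have h4 := abs_sub_le (z c) (z (dyadicApprox e (n + 1) c)) (z (dyadicApprox e n c))
    linarith

/-- Lévy's modulus of continuity for the labels along the spine. -/
lemma IsLabelLaw.ae_modulus (h : IsLabelLaw e Q) (h1 : e 1 = 0) :
    ∀ᵐ z ∂Q, ∃ n₀, ∀ n ≥ n₀, ∀ c ∈ spine e, ∀ d ∈ spine e, |e c - e d| < (1 / 2) ^ n →
      |z c - z d| ≤ 7 * levyMod n := by
  obtain ⟨D, hDs, hDc, hDd⟩ :=
    (TopologicalSpace.IsSeparable.of_separableSpace (spine e)).exists_countable_dense_subset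
  have hlim : ∀ᵐ z ∂Q, ∀ c ∈ D, ∀ᶠ n in Filter.atTop,
      |z c - z (dyadicApprox e n c)| ≤ levyMod n :=
    (ae_ball_iff hDc).2 fun c hc => h.ae_tendsto_dyadicApprox h1 (hDs hc)
  filter_upwards [hlim, h.ae_dyadic_increments h1] with z hz1 hz2
  obtain ⟨n₁, hn₁⟩ := Filter.eventually_atTop.1 hz2
  refine ⟨max n₁ 8, fun n hn => ?_⟩
  -- `7 = 3 + 1 + 3`: two approximation errors, and one increment because the integer parts differ
  -- by at most one.
  have key : ∀ c ∈ D, ∀ d ∈ D, |e c - e d| < (1 / 2) ^ n → |z c - z d| ≤ 7 * levyMod n := by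
    intro c hc d hd hcd
    wlog hle : e c ≤ e d generalizing c d
    · rw [abs_sub_comm]
      exact this d hd c hc (by rwa [abs_sub_comm]) (le_of_not_ge hle)
    have hinc : ∀ m ≥ max n₁ 8, ∀ k : ℕ, ((k + 1 : ℕ) : ℝ) * (1 / 2) ^ m ≤ e half →
      |z (dyadicPt e m (k + 1)) - z (dyadicPt e m k)| ≤ levyMod m :=
      fun m hm => hn₁ m ((le_max_left _ _).trans hm)
    have b1 := abs_sub_dyadicApprox_le h.nonneg (le_max_right _ _) hinc (hDs hc) (hz1 c hc) hn
    have b2 := abs_sub_dyadicApprox_le h.nonneg (le_max_right _ _) hinc (hDs hd) (hz1 d hd) hn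
    have b3 : |z (dyadicApprox e n d) - z (dyadicApprox e n c)| ≤ levyMod n := by
      have hp : (0 : ℝ) < 2 ^ n := by positivity
      have f1 : ⌊e c * 2 ^ n⌋₊ ≤ ⌊e d * 2 ^ n⌋₊ := Nat.floor_mono (by gcongr)
      have f2 : ⌊e d * 2 ^ n⌋₊ < ⌊e c * 2 ^ n⌋₊ + 2 := by
        rw [Nat.floor_lt (by have := h.nonneg d; positivity)]
        have g1 := Nat.lt_floor_add_one (e c * 2 ^ n)
        rw [abs_sub_comm, abs_of_nonneg (by linarith), one_div, inv_pow, ← one_div,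
          lt_div_iff₀ hp] at hcd
        push_cast
        linarith
      obtain hf | hf : ⌊e d * 2 ^ n⌋₊ = ⌊e c * 2 ^ n⌋₊ ∨ ⌊e d * 2 ^ n⌋₊ = ⌊e c * 2 ^ n⌋₊ + 1 := by
        omega
      · rw [dyadicApprox, dyadicApprox, hf, sub_self, abs_zero]
        exact levyMod_nonneg _
      · rw [dyadicApprox, dyadicApprox, hf]
        refine hinc n hn _ ?_
        rw [← hf]
        exact (floor_mul_le (h.nonneg d) _).trans (apply_le_half (hDs hd))
    have t1 := abs_sub_le (z c) (z (dyadicApprox e n c)) (z d)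
    have t2 := abs_sub_le (z (dyadicApprox e n c)) (z (dyadicApprox e n d)) (z d)
    rw [abs_sub_comm] at b2 b3
    linarith
  -- The strict bound on heights is an open condition, so it holds along sequences from `D` and the
  -- estimate passes to the limit.
  intro c hc d hd hcd
  obtain ⟨x, hx, hxc⟩ := mem_closure_iff_seq_limit.1 (hDd hc)
  obtain ⟨y, hy, hyd⟩ := mem_closure_iff_seq_limit.1 (hDd hd)
  have hex := (e.continuous.tendsto c).comp hxc
  have hey := (e.continuous.tendsto d).comp hyd
  have hzx := (z.continuous.tendsto c).comp hxc
  have hzy := (z.continuous.tendsto d).comp hyd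
  have hev := ((hex.sub hey).abs).eventually (gt_mem_nhds hcd)
  refine le_of_tendsto (hzx.sub hzy).abs ?_
  filter_upwards [hev] with i hi
  exact key _ (hx i) _ (hy i) hi

end

/-! ### The first time at which a function on the rationals attains its infimum -/

/-- The rational numbers of the interval `[0, r]`. -/
abbrev RatIcc (r : ℚ) : Type := {q : ℚ // 0 ≤ q ∧ q ≤ r}

/-- `w` approaches its infimum on `[0, x]`. -/
def ReachesInf {r : ℚ} (w : RatIcc r → ℝ) (x : RatIcc r) : Prop :=
  ∀ (d : RatIcc r) (n : ℕ), ∃ c : RatIcc r, c.1 ≤ x.1 ∧ w c < w d + 1 / (n + 1)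

/-- The first time at which a function on `[0, r] ∩ ℚ` approaches its infimum. -/
def argminTime (r : ℚ) (w : RatIcc r → ℝ) : ℝ :=
  open Classical in ⨅ x : RatIcc r, if ReachesInf w x then (x.1 : ℝ) else r

lemma measurable_argminTime (r : ℚ) : Measurable (argminTime r) := by
  classical
  refine Measurable.iInf fun x => Measurable.ite ?_ measurable_const measurable_const
  have : {w : RatIcc r → ℝ | ReachesInf w x} =
      ⋂ (d : RatIcc r) (n : ℕ), ⋃ (c : RatIcc r) (_ : c.1 ≤ x.1), 
        {w : RatIcc r → ℝ | w c < w d + 1 / ((n : ℝ) + 1)} := by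
    ext w; simp [ReachesInf]
  rw [this]
  exact .iInter fun d => .iInter fun n => .iUnion fun c => .iUnion fun _ =>
    measurableSet_lt (measurable_pi_apply _) ((measurable_pi_apply _).add_const _)

/-- For continuous `W` the value is the first minimizer `c`. A rational `x > c` sees values near `W
c` at rationals just after `c`; a rational `x < c` cannot, as the minimum over `[0, x]` exceeds `W
c`. Using only rational arguments makes the law of this time a function of countably many joint
laws. -/
lemma argminTime_eq {r : ℚ} (hr : 0 ≤ r) {W : ℝ → ℝ} (hW : ContinuousOn W (Icc 0 r)) :
    argminTime r (fun q => W q.1) ∈ Icc (0 : ℝ) r ∧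
      ∀ d ∈ Icc (0 : ℝ) r, W (argminTime r fun q => W q.1) ≤ W d := by
  classical
  have hr' : (0 : ℝ) ≤ r := by exact_mod_cast hr
  obtain ⟨b, hb, hbmin⟩ := isCompact_Icc.exists_isMinOn (nonempty_Icc.2 hr') hW
  set A : Set ℝ := Icc 0 (r : ℝ) ∩ W ⁻¹' {W b} with hA
  have hAc : IsCompact A :=
    isCompact_Icc.of_isClosed_subset (hW.preimage_isClosed_of_isClosed isClosed_Icc
      isClosed_singleton) inter_subset_left
  obtain ⟨c, ⟨hc, hcb⟩, hcmin⟩ := hAc.exists_isLeast ⟨b, hb, rfl⟩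
  have hcle : ∀ d ∈ Icc (0 : ℝ) r, W c ≤ W d := fun d hd =>
    (show W c = W b from hcb).trans_le (hbmin hd)
  suffices hh : argminTime r (fun q => W q.1) = c by rw [hh]; exact ⟨hc, hcle⟩
  have hmem : ∀ q : RatIcc r, (q.1 : ℝ) ∈ Icc (0 : ℝ) r := fun q =>
    ⟨by exact_mod_cast q.2.1, by exact_mod_cast q.2.2⟩
  have : Nonempty (RatIcc r) := ⟨⟨0, le_rfl, hr⟩⟩
  have hbdd : BddBelow (range fun x : RatIcc r =>
      if ReachesInf (fun q : RatIcc r => W q.1) x then (x.1 : ℝ) else r) :=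
    ⟨0, by rintro _ ⟨x, rfl⟩; dsimp only; split_ifs; exacts [(hmem x).1, hr']⟩
  refine le_antisymm ?_ (le_ciInf fun x => ?_)
  · rcases hc.2.eq_or_lt with hcr | hcr
    · rw [hcr]
      refine (ciInf_le hbdd ⟨0, le_rfl, hr⟩).trans ?_
      split_ifs
      exacts [(hmem _).2, le_rfl]
    refine le_of_forall_gt_imp_ge_of_dense fun y hy => ?_
    obtain ⟨x, hx1, hx2⟩ := exists_rat_btwn (lt_min hcr hy)
    have hx : 0 ≤ x ∧ x ≤ r := by
      constructor
      · have := hc.1.trans hx1.le; exact_mod_cast this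
      · have := (hx2.trans_le (min_le_left _ _)).le; exact_mod_cast this
    refine (ciInf_le hbdd ⟨x, hx⟩).trans ?_
    rw [if_pos]
    · exact (hx2.trans_le (min_le_right _ _)).le
    intro d n
    have hlt : W c < W d.1 + 1 / (n + 1) := by
      have := hcle _ (hmem d)
      have : (0 : ℝ) < 1 / (n + 1) := by positivity
      linarith
    have hev := (hW c hc).eventually (gt_mem_nhds hlt)
    rw [eventually_nhdsWithin_iff, Metric.eventually_nhds_iff] at hev
    obtain ⟨δ, hδ, hev⟩ := hev
    obtain ⟨y, hy1, hy2⟩ := exists_rat_btwn (lt_min hx1 (lt_add_of_pos_right c hδ))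
    have hyx := hy2.trans_le (min_le_left _ _)
    have hyδ := hy2.trans_le (min_le_right _ _)
    have hy : 0 ≤ y ∧ y ≤ r := by
      constructor
      · have := hc.1.trans hy1.le; exact_mod_cast this
      · exact (show y ≤ x by exact_mod_cast hyx.le).trans hx.2
    refine ⟨⟨y, hy⟩, by exact_mod_cast hyx.le, hev ?_ (hmem ⟨y, hy⟩)⟩
    rw [Real.dist_eq, abs_of_pos (by linarith)]
    linarith
  · split_ifs with hx
    swap
    · exact hc.2
    by_contra! hlt
    have hx0 := (hmem x).1
    obtain ⟨m, hm, hmmin⟩ := (isCompact_Icc (a := (0 : ℝ)) (b := x.1)).exists_isMinOn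
      (nonempty_Icc.2 hx0) (hW.mono (Icc_subset_Icc_right (hmem x).2))
    have hmr : m ∈ Icc (0 : ℝ) r := ⟨hm.1, hm.2.trans (hmem x).2⟩
    have hgt : W c < W m := by
      refine lt_of_le_of_ne (hcle _ hmr) fun heq => ?_
      have := hcmin ⟨hmr, heq.symm.trans hcb⟩
      exact absurd hm.2 (by linarith)
    obtain ⟨n, hn⟩ := exists_nat_one_div_lt (show 0 < (W m - W c) / 2 by linarith)
    have hlt2 : W c < W m - 1 / (n + 1) - (W m - W c) / 4 := by linarith
    have hev := (hW c hc).eventually (gt_mem_nhds hlt2)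
    rw [eventually_nhdsWithin_iff, Metric.eventually_nhds_iff] at hev
    obtain ⟨δ, hδ, hev⟩ := hev
    obtain ⟨y, hy1, hy2⟩ := exists_rat_btwn (max_lt hlt (sub_lt_self c hδ))
    have hyx := (le_max_left _ _).trans_lt hy1
    have hyδ := (le_max_right _ _).trans_lt hy1
    have hy : 0 ≤ y ∧ y ≤ r := by
      constructor
      · have := hx0.trans hyx.le; exact_mod_cast this
      · have := hy2.le.trans hc.2; exact_mod_cast this
    obtain ⟨c', hc', hlt'⟩ := hx ⟨y, hy⟩ n
    have h1 := hmmin (show (c'.1 : ℝ) ∈ Icc (0 : ℝ) x.1 from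
      ⟨(hmem c').1, by exact_mod_cast hc'⟩)
    have h2 := hev (show dist (y : ℝ) c < δ by
      rw [Real.dist_eq, abs_of_neg (by linarith)]; linarith) (hmem ⟨y, hy⟩)
    change W m ≤ W c' at h1
    change W c' < W y + _ at hlt'
    linarith

section

/-! ### Steep excursions above a level -/

/-- Right after its running minimum drops to `h` up to `2⁻ᵏ`, the path `e` has at time `t` climbed
to `200 k 2⁻ᵏ` above `h`. -/
def Steep (e : C(I, ℝ)) (h : ℝ) (k : ℕ) (t : I) : Prop :=
  h < runMin e t ∧ runMin e t < h + (1 / 2) ^ k ∧ h + 200 * k * (1 / 2) ^ k < e t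

/-- A countable dense family of times after `1/2`. -/
def denseTime (i : ℕ) : I := max half (TopologicalSpace.denseSeq I i)

lemma half_le_denseTime (i : ℕ) : half ≤ denseTime i := le_max_left _ _

/-- `e` makes steep excursions above the level `h` at arbitrarily small scales. -/
def SteepAbove (e : C(I, ℝ)) (h : ℝ) : Prop :=
  ∀ n₀ : ℕ, ∃ k ≥ n₀, ∃ i, Steep e h k (denseTime i)

variable {e : C(I, ℝ)}

lemma continuous_runMin_max (e : C(I, ℝ)) : Continuous fun t => runMin e (max half t) :=
  continuous_infOn continuous_const continuous_const (continuous_const.max continuous_id)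
    fun _ => le_max_left _ _

/-- Steepness is an open condition on the time, so countably many branch times suffice. -/
lemma exists_denseTime_steep {h : ℝ} {k : ℕ} {t : I} (ht : half ≤ t) (hs : Steep e h k t) :
    ∃ i, Steep e h k (denseTime i) := by
  have hc := continuous_runMin_max e
  have hce : Continuous fun t => e (max half t) :=
    e.continuous.comp (continuous_const.max continuous_id)
  have hopen : IsOpen {t : I | Steep e h k (max half t)} :=
    (isOpen_lt continuous_const hc).inter ((isOpen_lt hc continuous_const).inter
      (isOpen_lt continuous_const hce))
  obtain ⟨i, hx⟩ := (TopologicalSpace.denseRange_denseSeq I).exists_mem_open hopen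
    ⟨t, by change Steep e h k (max half t); rwa [max_eq_right ht]⟩
  exact ⟨i, hx⟩

/-! ### Labels off the spine -/

/-- The increment of the labels from the spine to the time `t`. -/
def offSpine (e : C(I, ℝ)) (t : I) (z : C(I, ℝ)) : ℝ := z t - z (spineAnc e t)

lemma measurable_offSpine (e : C(I, ℝ)) (t : I) : Measurable (offSpine e t) :=
  (measurable_eval_path t).sub (measurable_eval_path _)

variable {Q : Measure C(I, ℝ)}

/-- The increment is carried by the part of the lineage of `t` above its grafting point, which is
disjoint from the spine. -/
lemma IsLabelLaw.cov_offSpine_spine (h : IsLabelLaw e Q) {t c : I} (ht : half ≤ t)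
    (hc : c ∈ spine e) : covariance (offSpine e t) (fun z => z c) Q = 0 := by
  obtain ⟨h1, -, h3⟩ := spineAnc_spec (e := e) ht
  rw [show offSpine e t = fun z : C(I, ℝ) => z t - z (spineAnc e t) from rfl, h.cov_sub,
    labelCov_comm, labelCov_spine hc ht, labelCov_spine_spine h1 hc, h3, min_comm, sub_self]

lemma IsLabelLaw.cov_offSpine (h : IsLabelLaw e Q) {s t : I} (hs : half ≤ s) (ht : half ≤ t)
    (hst : runMin e s ≠ runMin e t) : covariance (offSpine e s) (offSpine e t) Q = 0 := by
  obtain ⟨h1, -, h3⟩ := spineAnc_spec (e := e) hs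
  obtain ⟨h1', -, h3'⟩ := spineAnc_spec (e := e) ht
  change covariance (fun z : C(I, ℝ) => z s - z (spineAnc e s))
    (fun z => z t - z (spineAnc e t)) Q = 0
  rw [h.cov_sub_sub, labelCov_of_runMin_ne hs ht hst, labelCov_spine h1 ht,
    labelCov_comm e s, labelCov_spine h1' hs, labelCov_spine_spine h1 h1', h3, h3',
    min_comm (runMin e t)]
  ring

lemma IsLabelLaw.map_offSpine (h : IsLabelLaw e Q) {t : I} (ht : half ≤ t) :
    Q.map (offSpine e t) = gaussianReal 0 (e t - runMin e t).toNNReal := by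
  obtain ⟨h1, -, h3⟩ := spineAnc_spec (e := e) ht
  have h2 : labelCov e t (spineAnc e t) = runMin e t := by
    rw [labelCov_comm, labelCov_spine h1 ht, h3, min_self]
  rw [show offSpine e t = fun z : C(I, ℝ) => z t - z (spineAnc e t) from rfl, h.map_sub, h2, h3]
  congr 2
  ring

/-- If `e` is steep above `h` then almost surely some steep excursion carries a label increment
below minus its standard deviation. -/
lemma IsLabelLaw.ae_exists_offSpine_lt (h : IsLabelLaw e Q) {x : ℝ} (hx : SteepAbove e x) :
    ∀ᵐ z ∂Q, ∀ n₀ : ℕ, ∃ k ≥ n₀, ∃ i, Steep e x k (denseTime i) ∧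
      offSpine e (denseTime i) z < -√(e (denseTime i) - runMin e (denseTime i)) := by
  -- Steep times are chosen recursively with running minima strictly decreasing towards `x`. They
  -- then lie in distinct branches, so that their increments are independent.
  have hnext : ∀ (n : ℕ) (y : ℝ), ∃ p : ℕ × ℕ, n ≤ p.1 ∧ Steep e x p.1 (denseTime p.2) ∧
      (x < y → runMin e (denseTime p.2) < y) := by
    intro n y
    by_cases hy : x < y
    · obtain ⟨m, hm⟩ := exists_pow_lt_of_lt_one (sub_pos.2 hy) (show (1 / 2 : ℝ) < 1 by norm_num)
      obtain ⟨k, hk, i, hi⟩ := hx (max n m)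
      refine ⟨(k, i), (le_max_left _ _).trans hk, hi, fun _ => hi.2.1.trans ?_⟩
      have : (1 / 2 : ℝ) ^ k ≤ (1 / 2) ^ m :=
        pow_le_pow_of_le_one (by norm_num) (by norm_num) ((le_max_right _ _).trans hk)
      linarith
    · obtain ⟨k, hk, i, hi⟩ := hx n
      exact ⟨(k, i), hk, hi, fun h => absurd h hy⟩
  choose p hp1 hp2 hp3 using hnext
  let s : ℕ → ℕ × ℕ := fun n => Nat.rec (p 0 (x + 1))
    (fun n q => p (n + 1) (runMin e (denseTime q.2))) n
  have hs1 : ∀ n, n ≤ (s n).1 ∧ Steep e x (s n).1 (denseTime (s n).2) := by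
    intro n
    cases n with
    | zero => exact ⟨hp1 _ _, hp2 _ _⟩
    | succ n => exact ⟨hp1 _ _, hp2 _ _⟩
  have hs2 : StrictAnti fun n => runMin e (denseTime (s n).2) :=
    strictAnti_nat_of_succ_lt fun n => hp3 _ _ (hs1 n).2.1
  have hgp : IsGaussianProcess (fun n => offSpine e (denseTime (s n).2)) Q :=
    isGaussianProcess_of_comb h.1 fun n => ⟨denseTime (s n).2, spineAnc e (denseTime (s n).2),
      half, 1, -1, 0, fun z => by simp [offSpine]; ring⟩
  have hind := iIndepFun_of_gaussian hgp (fun n => measurable_offSpine _ _) fun j k hjk =>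
    h.cov_offSpine (half_le_denseTime _) (half_le_denseTime _) (hs2.injective.ne hjk)
  -- The shift to `n + 1` avoids the scale `0`, where steepness does not make the variance positive.
  have hpos : ∀ n, 0 < e (denseTime (s (n + 1)).2) - runMin e (denseTime (s (n + 1)).2) := by
    intro n
    obtain ⟨hn, -, h2, h3⟩ := hs1 (n + 1)
    have h4 : (0 : ℝ) < (1 / 2) ^ (s (n + 1)).1 := by positivity
    have h5 : (n + 1 : ℝ) ≤ (s (n + 1)).1 := by exact_mod_cast hn
    have h6 : (0 : ℝ) ≤ n := n.cast_nonneg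
    nlinarith
  have hind' : iIndepFun (fun n => offSpine e (denseTime (s (n + 1)).2)) Q :=
    hind.precomp (g := Nat.succ) Nat.succ_injective
  have hfr := iIndepFun.frequently_lt hind'
    (fun k => measurable_offSpine _ _)
    (v := fun n => (e (denseTime (s (n + 1)).2) - runMin e (denseTime (s (n + 1)).2)).toNNReal)
    (fun n => (Real.toNNReal_pos.2 (hpos n)).ne')
    (fun n => h.map_offSpine (half_le_denseTime _))
  filter_upwards [hfr] with z hz n₀
  obtain ⟨n, hn, hlt⟩ := Filter.frequently_atTop.1 hz n₀
  refine ⟨(s (n + 1)).1, hn.trans ((Nat.le_succ n).trans (hs1 (n + 1)).1), (s (n + 1)).2, (hs1 (n + 1)).2, ?_⟩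
  rwa [Real.coe_toNNReal _ (hpos n).le] at hlt

/-! ### The height at which the labels are minimal along the spine -/

/-- The height of the first minimum of the labels along the part of the spine below height `r`. -/
def minHeight (r : ℚ) (e z : C(I, ℝ)) : ℝ := argminTime r fun q => z (spinePt e q.1)

lemma measurable_spineLabels (r : ℚ) (e : C(I, ℝ)) :
    Measurable fun (z : C(I, ℝ)) (q : RatIcc r) => z (spinePt e q.1) :=
  measurable_pi_lambda _ fun _ => measurable_eval_path _

lemma measurable_minHeight (r : ℚ) (e : C(I, ℝ)) : Measurable (minHeight r e) :=
  (measurable_argminTime r).comp (measurable_spineLabels r e)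

/-- The spine labels at heights `p` and `q` have covariance `min p q` whatever `e` is, and
`minHeight` is one and the same functional of them. -/
lemma IsLabelLaw.map_minHeight_eq {e' : C(I, ℝ)} {Q' : Measure C(I, ℝ)} {r : ℚ}
    (h : IsLabelLaw e Q) (h' : IsLabelLaw e' Q') (h1 : e 1 = 0) (h1' : e' 1 = 0)
    (hr : r ≤ e half) (hr' : r ≤ e' half) :
    Q.map (minHeight r e) = Q'.map (minHeight r e') := by
  have key : ∀ {e : C(I, ℝ)} {Q : Measure C(I, ℝ)}, IsLabelLaw e Q → e 1 = 0 → r ≤ e half →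
      ∀ p q : RatIcc r, covariance (fun z : C(I, ℝ) => z (spinePt e p.1))
        (fun z => z (spinePt e q.1)) Q = min (p.1 : ℝ) q.1 := by
    intro e Q h h1 hr p q
    have hq : ∀ q : RatIcc r, e (spinePt e q.1) = q.1 := fun q =>
      apply_spinePt (by rw [h1]; exact_mod_cast q.2.1)
        (le_trans (by exact_mod_cast q.2.2) hr)
    rw [h.cov, labelCov_spine_spine (spinePt_mem _) (spinePt_mem _), hq, hq]
  have hlaw := gaussian_process_law_eq
    (X := fun (q : RatIcc r) (z : C(I, ℝ)) => z (spinePt e q.1))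
    (Y := fun (q : RatIcc r) (z : C(I, ℝ)) => z (spinePt e' q.1))
    (h.1.comp_right fun q : RatIcc r => spinePt e q.1)
    (h'.1.comp_right fun q : RatIcc r => spinePt e' q.1)
    (fun _ => measurable_eval_path _) (fun _ => measurable_eval_path _)
    (fun _ => h.2.1 _) (fun _ => h'.2.1 _)
    fun p q => (key h h1 hr p q).trans (key h' h1' hr' p q).symm
  calc Q.map (minHeight r e) = (Q.map _).map (argminTime r) :=
        (Measure.map_map (measurable_argminTime r) (measurable_spineLabels r e)).symm
    _ = (Q'.map _).map (argminTime r) := by rw [hlaw]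
    _ = _ := Measure.map_map (measurable_argminTime r) (measurable_spineLabels r e')

/-- The law of the height of the minimum does not depend on the excursion. -/
lemma exists_minHeight_law (r : ℚ) : ∃ lam : Measure ℝ, SFinite lam ∧
    ∀ e Q, IsLabelLaw e Q → e 1 = 0 → r ≤ e half → Q.map (minHeight r e) = lam := by
  by_cases hex : ∃ e Q, IsLabelLaw e Q ∧ e 1 = 0 ∧ r ≤ e half
  · obtain ⟨e, Q, h, h1, h2⟩ := hex
    have := h.1.isProbabilityMeasure
    exact ⟨Q.map (minHeight r e), inferInstance,
      fun e' Q' h' h1' h2' => h'.map_minHeight_eq h h1' h1 h2' h2⟩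
  · exact ⟨0, inferInstance, fun e Q h h1 h2 => absurd ⟨e, Q, h, h1, h2⟩ hex⟩

/-- `minHeight` is a function of the spine labels. These and the branch increments form one Gaussian
process with vanishing cross covariances. -/
lemma IsLabelLaw.indepFun_spine_offSpine (h : IsLabelLaw e Q) (r : ℚ) :
    IndepFun (minHeight r e) (fun z i => offSpine e (denseTime i) z) Q := by
  have hg : IsGaussianProcess (Sum.elim (fun (q : RatIcc r) (z : C(I, ℝ)) => z (spinePt e q.1))
      fun i => offSpine e (denseTime i)) Q := by
    refine isGaussianProcess_of_comb h.1 fun s => ?_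
    rcases s with q | i
    · exact ⟨spinePt e q.1, half, half, 1, 0, 0, fun z => by simp⟩
    · exact ⟨denseTime i, spineAnc e (denseTime i), half, 1, -1, 0, fun z => by
        simp [offSpine]; ring⟩
  have hi := hg.indepFun_of_covariance_eq_zero (fun _ => (measurable_eval_path _).aemeasurable)
    (fun i => (measurable_offSpine e (denseTime i)).aemeasurable) fun q i => by
      rw [covariance_comm]
      exact h.cov_offSpine_spine (half_le_denseTime i) (spinePt_mem _)
  exact hi.comp (measurable_argminTime r) measurable_id

/-- By independence the random height can be frozen: under the product law, `ae_exists_offSpine_lt`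
is applied at almost every fixed level. -/
lemma IsLabelLaw.ae_minHeight (h : IsLabelLaw e Q) (r : ℚ)
    (hgood : ∀ᵐ x ∂(Q.map (minHeight r e)), 0 < x ∧ x < e half → SteepAbove e x) :
    ∀ᵐ z ∂Q, 0 < minHeight r e z ∧ minHeight r e z < e half → ∀ n₀ : ℕ, ∃ k ≥ n₀, ∃ i,
      Steep e (minHeight r e z) k (denseTime i) ∧
      offSpine e (denseTime i) z < -√(e (denseTime i) - runMin e (denseTime i)) := by
  have := h.1.isProbabilityMeasure
  have hm1 := measurable_minHeight r e
  have hm2 : Measurable fun (z : C(I, ℝ)) i => offSpine e (denseTime i) z :=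
    measurable_pi_lambda _ fun i => measurable_offSpine e (denseTime i)
  have hprod := (indepFun_iff_map_prod_eq_prod_map_map hm1.aemeasurable hm2.aemeasurable).1
    (h.indepFun_spine_offSpine r)
  let G : Set (ℝ × (ℕ → ℝ)) := {p | 0 < p.1 ∧ p.1 < e half → ∀ n₀ : ℕ, ∃ k ≥ n₀, ∃ i,
      Steep e p.1 k (denseTime i) ∧ p.2 i < -√(e (denseTime i) - runMin e (denseTime i))}
  have hst : ∀ k i, MeasurableSet {p : ℝ × (ℕ → ℝ) | Steep e p.1 k (denseTime i)} := fun k i =>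
    (measurableSet_lt measurable_fst measurable_const).inter
      ((measurableSet_lt measurable_const (measurable_fst.add_const _)).inter
        (measurableSet_lt (measurable_fst.add_const _) measurable_const))
  have hG : MeasurableSet G := by
    have : G = {p | 0 < p.1 ∧ p.1 < e half}ᶜ ∪ ⋂ n₀ : ℕ, ⋃ k, ⋃ (_ : n₀ ≤ k), ⋃ i,
        ({p | Steep e p.1 k (denseTime i)} ∩
          {p | p.2 i < -√(e (denseTime i) - runMin e (denseTime i))}) := by
      ext p
      simp only [G, mem_ofPred_eq, imp_iff_not_or, mem_union, mem_compl_iff, mem_iInter, mem_iUnion,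
        mem_inter_iff, exists_prop]
    rw [this]
    refine ((measurableSet_lt measurable_const measurable_fst).inter
      (measurableSet_lt measurable_fst measurable_const)).compl.union
      (.iInter fun n₀ => .iUnion fun k => .iUnion fun _ => .iUnion fun i => (hst k i).inter ?_)
    exact measurableSet_lt ((measurable_pi_apply i).comp measurable_snd) measurable_const
  have hae : ∀ᵐ p ∂((Q.map (minHeight r e)).prod
      (Q.map fun (z : C(I, ℝ)) i => offSpine e (denseTime i) z)), p ∈ G := by
    refine (Measure.ae_prod_mem_iff_ae_ae_mem hG).2 ?_
    filter_upwards [hgood] with x hx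
    rw [ae_map_iff hm2.aemeasurable (measurable_prodMk_left hG)]
    by_cases hx0 : 0 < x ∧ x < e half
    · filter_upwards [h.ae_exists_offSpine_lt (hx hx0)] with z hz _
      exact hz
    · exact ae_of_all _ fun z h => absurd h hx0
  rw [← hprod] at hae
  exact ae_of_ae_map (hm1.prodMk hm2).aemeasurable hae

end

section

variable {e : C(I, ℝ)} {Q : Measure C(I, ℝ)}

/-! ### The labels reach a lower value off the spine -/

lemma one_mem_spine (he : ∀ t, 0 ≤ e t) (h1 : e 1 = 0) : (1 : I) ∈ spine e :=
  ⟨half_le_one, fun u _ _ => h1.trans_le (he u)⟩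

/-- Time `1` is the bottom of the spine, and Brownian motion started there takes negative values.
With the same fact at the top, seen downwards, it keeps the minimum over the spine away from both
end heights. -/
lemma IsLabelLaw.ae_exists_lt_one (h : IsLabelLaw e Q) (h1 : e 1 = 0) (hH : 0 < e half) :
    ∀ᵐ z ∂Q, ∃ c ∈ spine e, z c < z 1 := by
  have := h.1.isProbabilityMeasure
  have hu : ∀ k : ℕ, e (spinePt e (e half * (1 / 2) ^ (k ^ 2))) = e half * (1 / 2) ^ (k ^ 2) :=
    fun k => apply_spinePt (by rw [h1]; positivity)
      (mul_le_of_le_one_right hH.le (pow_le_one₀ (by norm_num) (by norm_num)))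
  have hs1 := one_mem_spine h.nonneg h1
  have key := ae_exists_neg_of_cov_min (Q := Q)
    (X := fun (k : ℕ) (z : C(I, ℝ)) => z (spinePt e (e half * (1 / 2) ^ (k ^ 2))) - z 1)
    (isGaussianProcess_of_comb h.1 fun k =>
      ⟨spinePt e (e half * (1 / 2) ^ (k ^ 2)), 1, 1, 1, -1, 0, fun z => by ring⟩)
    (fun k => (measurable_eval_path _).sub (measurable_eval_path _))
    (fun k => by
      rw [integral_sub ((h.memLp _).integrable (by norm_num)) ((h.memLp _).integrable (by norm_num)),
        h.2.1, h.2.1, sub_zero]) hH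
    (fun j k => by
      have p : ∀ k : ℕ, 0 ≤ e half * (1 / 2) ^ (k ^ 2) := fun k => by positivity
      rw [h.cov_sub_sub, labelCov_spine_spine (spinePt_mem _) (spinePt_mem _),
        labelCov_spine_spine (spinePt_mem _) hs1, labelCov_spine_spine hs1 (spinePt_mem _),
        labelCov_self, hu, hu, h1, min_eq_left (p k), min_eq_right (p j)]
      ring)
  filter_upwards [key] with z ⟨k, hk⟩
  exact ⟨_, spinePt_mem _, sub_neg.1 hk⟩

lemma IsLabelLaw.ae_exists_lt_half (h : IsLabelLaw e Q) (h1 : e 1 = 0) (hH : 0 < e half) :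
    ∀ᵐ z ∂Q, ∃ c ∈ spine e, z c < z half := by
  have := h.1.isProbabilityMeasure
  have hle : ∀ k : ℕ, e half * (1 / 2) ^ (k ^ 2) ≤ e half := fun k =>
    mul_le_of_le_one_right hH.le (pow_le_one₀ (by norm_num) (by norm_num))
  have hu : ∀ k : ℕ, e (spinePt e (e half - e half * (1 / 2) ^ (k ^ 2))) =
      e half - e half * (1 / 2) ^ (k ^ 2) :=
    fun k => apply_spinePt (by rw [h1]; linarith [hle k])
      (sub_le_self _ (by positivity))
  have key := ae_exists_neg_of_cov_min (Q := Q)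
    (X := fun (k : ℕ) (z : C(I, ℝ)) =>
      z (spinePt e (e half - e half * (1 / 2) ^ (k ^ 2))) - z half)
    (isGaussianProcess_of_comb h.1 fun k =>
      ⟨spinePt e (e half - e half * (1 / 2) ^ (k ^ 2)), half, half, 1, -1, 0, fun z => by ring⟩)
    (fun k => (measurable_eval_path _).sub (measurable_eval_path _))
    (fun k => by
      rw [integral_sub ((h.memLp _).integrable (by norm_num)) ((h.memLp _).integrable (by norm_num)),
        h.2.1, h.2.1, sub_zero]) hH
    (fun j k => by
      have p1 : (0 : ℝ) < e half * (1 / 2) ^ (j ^ 2) := by positivity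
      have p2 : (0 : ℝ) < e half * (1 / 2) ^ (k ^ 2) := by positivity
      rw [h.cov_sub_sub, labelCov_spine_spine (spinePt_mem _) (spinePt_mem _),
        labelCov_spine_spine (spinePt_mem _) half_mem_spine,
        labelCov_spine_spine half_mem_spine (spinePt_mem _), labelCov_self, hu, hu,
        min_eq_right (sub_le_self _ p2.le), min_eq_left (sub_le_self _ p1.le)]
      rcases le_total (e half * (1 / 2) ^ (j ^ 2)) (e half * (1 / 2) ^ (k ^ 2)) with hjk | hjk
      · rw [min_eq_left hjk, min_eq_right (by linarith)]; ring
      · rw [min_eq_right hjk, min_eq_left (by linarith)]; ring)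
  filter_upwards [key] with z ⟨k, hk⟩
  exact ⟨_, spinePt_mem _, sub_neg.1 hk⟩

/-- Lévy's modulus for `z` along the spine of `e`, from the scale `2^{-n₀}` on. -/
def HasSpineModulus (e z : C(I, ℝ)) (n₀ : ℕ) : Prop :=
  ∀ n ≥ n₀, ∀ c ∈ spine e, ∀ d ∈ spine e, |e c - e d| < (1 / 2) ^ n → |z c - z d| ≤ 7 * levyMod n

/-- Spine times of equal height code the same point of the tree. The modulus makes the label along
the spine a function of the height. -/
lemma HasSpineModulus.eq_of_eq {z : C(I, ℝ)} {n₀ : ℕ} (h : HasSpineModulus e z n₀) {c d : I}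
    (hc : c ∈ spine e) (hd : d ∈ spine e) (hcd : e c = e d) : z c = z d := by
  have hlim := tendsto_levyMod.const_mul 7
  rw [mul_zero] at hlim
  refine eq_of_abs_sub_nonpos (ge_of_tendsto hlim ?_)
  filter_upwards [Filter.eventually_ge_atTop n₀] with n hn
  exact h n hn c hc d hd (by rw [hcd, sub_self, abs_zero]; positivity)

lemma HasSpineModulus.continuousOn {z : C(I, ℝ)} {n₀ : ℕ} (h : HasSpineModulus e z n₀) {r : ℝ}
    (h1 : e 1 = 0) (hr : r ≤ e half) :
    ContinuousOn (fun d : ℝ => z (spinePt e d)) (Icc 0 r) := by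
  have hs : ∀ d ∈ Icc (0 : ℝ) r, e (spinePt e d) = d := fun d hd =>
    apply_spinePt (h1.trans_le hd.1) (hd.2.trans hr)
  have hlim := tendsto_levyMod.const_mul 7
  rw [mul_zero] at hlim
  refine Metric.continuousOn_iff.2 fun b hb ε hε => ?_
  obtain ⟨n, hn, hn2⟩ := ((hlim.eventually (gt_mem_nhds hε)).and
    (Filter.eventually_ge_atTop n₀)).exists
  refine ⟨(1 / 2) ^ n, by positivity, fun a ha hab => ?_⟩
  rw [Real.dist_eq] at hab ⊢
  exact (h n hn2 _ (spinePt_mem _) _ (spinePt_mem _) (by rwa [hs a ha, hs b hb])).trans_lt hn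

/-- A steep branch grafted within `2⁻ᵏ` above the height of the spine minimum starts from a label at
most `7 * levyMod k` above that minimum, and then drops by more than this. -/
lemma exists_lt_spine {z : C(I, ℝ)} (he : ∀ t, 0 ≤ e t) (h1 : e 1 = 0) {n₀ : ℕ}
    (hmod : HasSpineModulus e z n₀) (hz1 : ∃ c ∈ spine e, z c < z 1)
    (hz2 : ∃ c ∈ spine e, z c < z half)
    (hmin : ∀ r : ℚ, 0 ≤ r → r ≤ e half →
      0 < minHeight r e z ∧ minHeight r e z < e half → ∀ n₀ : ℕ, ∃ k ≥ n₀, ∃ i,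
      Steep e (minHeight r e z) k (denseTime i) ∧
      offSpine e (denseTime i) z < -√(e (denseTime i) - runMin e (denseTime i))) :
    ∃ t, half ≤ t ∧ ∀ c ∈ spine e, z t < z c := by
  obtain ⟨c, hc, hcmin⟩ := (isClosed_spine (e := e)).isCompact.exists_isMinOn ⟨half, half_mem_spine⟩
    z.continuous.continuousOn
  replace hcmin : ∀ d ∈ spine e, z c ≤ z d := fun d hd => hcmin hd
  have hs1 := one_mem_spine he h1
  have hc1 : z c < z 1 := by obtain ⟨d, hd, hlt⟩ := hz1; exact (hcmin d hd).trans_lt hlt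
  have hc2 : z c < z half := by obtain ⟨d, hd, hlt⟩ := hz2; exact (hcmin d hd).trans_lt hlt
  have hpos : 0 < e c := (he c).lt_of_ne fun h0 =>
    hc1.ne (hmod.eq_of_eq hc hs1 (h0.symm.trans h1.symm))
  have hltH : e c < e half := (apply_le_half hc).lt_of_ne fun h0 =>
    hc2.ne (hmod.eq_of_eq hc half_mem_spine h0)
  -- Cutting the spine at a rational height strictly between leaves countably many functionals
  -- `minHeight r` to control, and keeps the minimizing height below `e half`.
  obtain ⟨r, hr1, hr2⟩ := exists_rat_btwn hltH
  have hr0 : 0 ≤ r := by have := (hpos.trans hr1).le; exact_mod_cast this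
  obtain ⟨hx, hxmin⟩ := argminTime_eq hr0 (hmod.continuousOn h1 hr2.le)
  have hs : ∀ d ∈ Icc (0 : ℝ) r, e (spinePt e d) = d := fun d hd =>
    apply_spinePt (h1.trans_le hd.1) (hd.2.trans hr2.le)
  set x := argminTime r fun q => z (spinePt e q.1) with hxdef
  have hxc : z (spinePt e x) ≤ z c := by
    refine (hxmin (e c) ⟨hpos.le, hr1.le⟩).trans_eq ?_
    exact hmod.eq_of_eq (spinePt_mem _) hc (hs _ ⟨hpos.le, hr1.le⟩)
  have hx0 : 0 < x := hx.1.lt_of_ne fun h0 => by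
    have : z (spinePt e x) = z 1 :=
      hmod.eq_of_eq (spinePt_mem _) hs1 (by rw [hs x hx, h1, h0])
    linarith
  obtain ⟨k, hk, i, ⟨hk1, hk2, hk3⟩, hlt⟩ := hmin r hr0 hr2.le ⟨hx0, hx.2.trans_lt hr2⟩ (max n₀ 1)
  change x < _ at hk1
  change _ < x + _ at hk2
  change x + _ < _ at hk3
  set t := denseTime i
  obtain ⟨hτ1, -, hτ2⟩ := spineAnc_spec (e := e) (half_le_denseTime i)
  have hd := hmod k ((le_max_left _ _).trans hk) _ hτ1 _ (spinePt_mem x) (by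
    rw [hτ2, hs x hx, abs_of_pos (sub_pos.2 hk1)]; linarith)
  have hk1' : (1 : ℝ) ≤ k := by exact_mod_cast (le_max_right _ _).trans hk
  have hp : (0 : ℝ) < (1 / 2) ^ k := by positivity
  -- Origin of the constant `200`: the left side squared is `196 k 2⁻ᵏ`, and `e t - runMin e t >
  -- (200 k - 1) 2⁻ᵏ ≥ 199 k 2⁻ᵏ` because `k ≥ 1`.
  have hsq : 7 * levyMod k ≤ √(e t - runMin e t) := by
    refine Real.le_sqrt_of_sq_le ?_
    rw [mul_pow, levyMod_sq]
    nlinarith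
  refine ⟨t, half_le_denseTime i, fun d hd' => lt_of_lt_of_le ?_ (hcmin d hd')⟩
  have hab := (abs_le.1 hd).2
  unfold offSpine at hlt
  linarith

theorem IsLabelLaw.ae_exists_lt_spine (h : IsLabelLaw e Q) (h1 : e 1 = 0) (hH : 0 < e half)
    (hgood : ∀ r : ℚ, 0 ≤ r → r ≤ e half →
      ∀ᵐ x ∂(Q.map (minHeight r e)), 0 < x ∧ x < e half → SteepAbove e x) :
    ∀ᵐ z ∂Q, ∃ t, half ≤ t ∧ ∀ c ∈ spine e, z t < z c := by
  have hmin : ∀ᵐ z ∂Q, ∀ r : ℚ, 0 ≤ r → r ≤ e half →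
      0 < minHeight r e z ∧ minHeight r e z < e half →
      ∀ n₀ : ℕ, ∃ k ≥ n₀, ∃ i, Steep e (minHeight r e z) k (denseTime i) ∧
        offSpine e (denseTime i) z < -√(e (denseTime i) - runMin e (denseTime i)) := by
    refine ae_all_iff.2 fun r => ?_
    by_cases hr : 0 ≤ r ∧ r ≤ e half
    · filter_upwards [h.ae_minHeight r (hgood r hr.1 hr.2)] with z hz _ _
      exact hz
    · exact ae_of_all _ fun z h0 h2 => absurd ⟨h0, h2⟩ hr
  filter_upwards [hmin, h.ae_modulus h1, h.ae_exists_lt_one h1 hH, h.ae_exists_lt_half h1 hH]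
    with z z1 ⟨n₀, z2⟩ z3 z4
  exact exists_lt_spine h.nonneg h1 z2 z3 z4 z1

/-- A minimizer over `[1/2, 1]` is off the spine, so `e` exceeds its running minimum there, hence
near it by continuity. Taking the end points in a countable `D` lets the null events of
`measure_tie_branch` be united. -/
lemma exists_gap_interval {z : C(I, ℝ)} (he : ∀ t, 0 ≤ e t) (h1 : e 1 = 0) {D : Set I}
    (hD : Dense D) (hz : ∃ t, half ≤ t ∧ ∀ c ∈ spine e, z t < z c) :
    ∃ a ∈ D, ∃ b ∈ D, half ≤ a ∧ a ≤ b ∧ runMin e b < infOn e a b ∧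
      infOn z a b = infOn z half 1 := by
  obtain ⟨u, hu1, hu2, humin⟩ := exists_infOn_eq z half_le_one
  obtain ⟨t, ht, htlt⟩ := hz
  have hu : ∀ c ∈ spine e, z u < z c := fun c hc =>
    (humin.trans_le (infOn_le z ht le_top)).trans_lt (htlt c hc)
  have hus : u ∉ spine e := fun hmem => lt_irrefl _ (hu u hmem)
  have hlt : runMin e u < e u := by
    refine (infOn_le e hu1 le_rfl).lt_of_ne fun heq => hus ⟨hu1, fun v hv hv' => ?_⟩
    exact heq.symm.trans_le (infOn_le e hv hv')
  obtain ⟨m, hm1, hm2⟩ := exists_between hlt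
  have hhu : half < u := hu1.lt_of_ne fun h => hus (h ▸ half_mem_spine)
  have hu1' : u < 1 := hu2.lt_of_ne fun h => hus (h ▸ one_mem_spine he h1)
  have hev : {v | m < e v} ∈ nhds u := e.continuous.continuousAt.eventually (lt_mem_nhds hm2)
  obtain ⟨l, ⟨hl1, hl2⟩, hlm⟩ := exists_Ioc_subset_of_mem_nhds' hev hhu
  obtain ⟨r, ⟨hr1, hr2⟩, hrm⟩ := exists_Ico_subset_of_mem_nhds' hev hu1'
  obtain ⟨a, haD, ha1, ha2⟩ := hD.exists_between hl2
  obtain ⟨b, hbD, hb1, hb2⟩ := hD.exists_between hr1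
  have hab : a ≤ b := (ha2.trans hb1).le
  have hha : half ≤ a := hl1.trans ha1.le
  refine ⟨a, haD, b, hbD, hha, hab, ?_, ?_⟩
  · refine lt_of_lt_of_le ?_ (le_infOn e hab fun v hv hv' => ?_ : m ≤ infOn e a b)
    · refine lt_of_le_of_lt (le_infOn e hu1 fun v hv hv' => ?_) hm1
      exact infOn_le e hv (hv'.trans hb1.le)
    · rcases le_total v u with h | h
      · exact (hlm ⟨ha1.trans_le hv, h⟩).le
      · exact (hrm ⟨h, hv'.trans_lt hb2⟩).le
  · refine le_antisymm ((infOn_le z ha2.le hb1.le).trans_eq humin) (le_infOn z hab fun v hv _ => ?_)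
    exact infOn_le z (hha.trans hv) le_top

/-- Given the tree, almost surely the labels do not have the same minimum over both halves. -/
theorem IsLabelLaw.measure_tie (h : IsLabelLaw e Q) (h1 : e 1 = 0) (hH : 0 < e half)
    (hgood : ∀ r : ℚ, 0 ≤ r → r ≤ e half →
      ∀ᵐ x ∂(Q.map (minHeight r e)), 0 < x ∧ x < e half → SteepAbove e x) :
    Q {z | infOn z 0 half = infOn z half 1} = 0 := by
  obtain ⟨D, hDc, hDd⟩ := TopologicalSpace.exists_countable_dense I
  have key : ∀ᵐ z ∂Q, ∀ a ∈ D, ∀ b ∈ D, half ≤ a → a ≤ b → runMin e b < infOn e a b →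
      infOn z 0 half ≠ infOn z a b := by
    refine (ae_ball_iff hDc).2 fun a _ => (ae_ball_iff hDc).2 fun b _ => ?_
    by_cases hab : half ≤ a ∧ a ≤ b ∧ runMin e b < infOn e a b
    · have := h.measure_tie_branch hab.1 hab.2.1 hab.2.2
      filter_upwards [measure_eq_zero_iff_ae_notMem.1 this] with z hz _ _ _
      exact hz
    · exact ae_of_all _ fun z x1 x2 x3 => absurd ⟨x1, x2, x3⟩ hab
  refine measure_eq_zero_iff_ae_notMem.2 ?_
  filter_upwards [key, h.ae_exists_lt_spine h1 hH hgood] with z z1 z2 heq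
  obtain ⟨a, ha, b, hb, x1, x2, x3, x4⟩ := exists_gap_interval h.nonneg h1 hDd z2
  exact z1 a ha b hb x1 x2 x3 (heq.trans x4.symm)

end

section

/-! ### A random walk crossing successive levels -/

lemma lintegral_fin_succ {n : ℕ} {F : ℝ × (Fin n → ℝ) → ℝ≥0∞} (hF : Measurable F) :
    ∫⁻ y : Fin (n + 1) → ℝ, F (y 0, Fin.tail y) = ∫⁻ x, ∫⁻ y, F (x, y) := by
  have h := (volume_preserving_piFinSuccAbove (fun _ : Fin (n + 1) => ℝ) 0).lintegral_comp hF
  have h2 := lintegral_prod (μ := (volume : Measure ℝ)) (ν := (volume : Measure (Fin n → ℝ))) F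
    hF.aemeasurable
  rw [← h2]
  exact h

/-- The density of the trajectory of a random walk started from `x` with step density `g`. -/
def stepWeight (g : ℝ → ℝ≥0∞) : (n : ℕ) → ℝ → (Fin n → ℝ) → ℝ≥0∞
  | 0, _, _ => 1
  | n + 1, x, y => g (y 0 - x) * stepWeight g n (y 0) (Fin.tail y)

lemma measurable_stepWeight {g : ℝ → ℝ≥0∞} (hg : Measurable g) (n : ℕ) :
    Measurable fun p : ℝ × (Fin n → ℝ) => stepWeight g n p.1 p.2 := by
  induction n with
  | zero => exact measurable_const
  | succ n ih =>
    have h0 : Measurable fun p : ℝ × (Fin (n + 1) → ℝ) => p.2 0 :=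
      (measurable_pi_apply 0).comp measurable_snd
    have ht : Measurable fun p : ℝ × (Fin (n + 1) → ℝ) => Fin.tail p.2 :=
      measurable_pi_lambda _ fun j => (measurable_pi_apply j.succ).comp measurable_snd
    exact (hg.comp (h0.sub measurable_fst)).mul (ih.comp (h0.prodMk ht))

lemma stepWeight_eq_prod (g : ℝ → ℝ≥0∞) (n : ℕ) (x : Fin (n + 1) → ℝ) :
    stepWeight g n (x 0) (Fin.tail x) = ∏ i : Fin n, g (x i.succ - x i.castSucc) := by
  induction n with
  | zero => simp [stepWeight]
  | succ n ih =>
    rw [Fin.prod_univ_succ, stepWeight]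
    congr 1
    exact ih (Fin.tail x)

/-- The walk started from `x` in the stage `k` makes small steps, stays below `a k` while it waits
for its passage below `b (k + 1)` in each stage `k ≠ m`, and reaches the stage `N`. -/
def StageSurvives (a b : ℕ → ℝ) (m N : ℕ) (η : ℝ) : (n : ℕ) → ℕ → ℝ → (Fin n → ℝ) → Prop
  | 0, k, _, _ => N ≤ k
  | n + 1, k, x, y => N ≤ k ∨ (|y 0 - x| ≤ η ∧ (k = m ∨ y 0 ≤ a k) ∧
      ((y 0 < b (k + 1) ∧ StageSurvives a b m N η n (k + 1) (y 0) (Fin.tail y)) ∨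
        (b (k + 1) ≤ y 0 ∧ StageSurvives a b m N η n k (y 0) (Fin.tail y))))

variable {a b : ℕ → ℝ} {m N : ℕ} {η : ℝ}

lemma measurableSet_stageSurvives (n k : ℕ) :
    MeasurableSet {p : ℝ × (Fin n → ℝ) | StageSurvives a b m N η n k p.1 p.2} := by
  induction n generalizing k with
  | zero => exact .const _
  | succ n ih =>
    have h0 : Measurable fun p : ℝ × (Fin (n + 1) → ℝ) => p.2 0 :=
      (measurable_pi_apply 0).comp measurable_snd
    have ht : Measurable fun p : ℝ × (Fin (n + 1) → ℝ) => Fin.tail p.2 :=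
      measurable_pi_lambda _ fun j => (measurable_pi_apply j.succ).comp measurable_snd
    have hs : ∀ k, MeasurableSet {p : ℝ × (Fin (n + 1) → ℝ) |
        StageSurvives a b m N η n k (p.2 0) (Fin.tail p.2)} := fun k =>
      (h0.prodMk ht) (ih k)
    exact (MeasurableSet.const _).union ((measurableSet_le
      (continuous_abs.measurable.comp (h0.sub measurable_fst)) measurable_const).inter
      (((MeasurableSet.const _).union (measurableSet_le h0 measurable_const)).inter
      (((measurableSet_lt h0 measurable_const).inter (hs _)).union
      ((measurableSet_le measurable_const h0).inter (hs _)))))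

variable {g : ℝ → ℝ≥0∞}

lemma lintegral_stepWeight_le (hg : Measurable g) (hg1 : ∫⁻ z, g z ≤ 1) (n : ℕ) (x : ℝ) :
    ∫⁻ y, stepWeight g n x y ≤ 1 := by
  induction n generalizing x with
  | zero => simp [stepWeight, volume_pi]
  | succ n ih =>
    have hm := measurable_stepWeight hg n
    have h1 := lintegral_fin_succ (F := fun p : ℝ × (Fin n → ℝ) =>
      g (p.1 - x) * stepWeight g n p.1 p.2) ((hg.comp (measurable_fst.sub_const x)).mul hm)
    refine h1.trans_le ?_
    calc ∫⁻ u, ∫⁻ y, g (u - x) * stepWeight g n u y ≤ ∫⁻ u, g (u - x) := by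
          refine lintegral_mono fun u => ?_
          rw [lintegral_const_mul _
            (show Measurable fun y => stepWeight g n u y from hm.comp measurable_prodMk_left)]
          exact mul_le_of_le_one_right' (ih u)
      _ ≤ 1 := by rwa [lintegral_sub_right_eq_self g x]

/-- A symmetric step decreases the mean of an affine function, truncated where it is positive. -/
lemma lintegral_affine_le (hg : Measurable g) (hg1 : ∫⁻ z, g z ≤ 1) (hge : ∀ z, g (-z) = g z)
    {L : ℝ → ℝ} (hL : Measurable L) (hmid : ∀ x z, L (x + z) + L (x - z) = 2 * L x) {x : ℝ}
    (hpos : ∀ y, |y - x| ≤ η → 0 ≤ L y) :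
    ∫⁻ y, {y | |y - x| ≤ η}.indicator (fun y => g (y - x) * ENNReal.ofReal (L y)) y ≤
      ENNReal.ofReal (L x) := by
  have hset : MeasurableSet {y : ℝ | |y - x| ≤ η} :=
    measurableSet_le (continuous_abs.measurable.comp (measurable_id.sub_const x)) measurable_const
  set F : ℝ → ℝ≥0∞ := {y | |y - x| ≤ η}.indicator (fun y => g (y - x) * ENNReal.ofReal (L y))
  have hF : Measurable F :=
    ((hg.comp (measurable_id.sub_const x)).mul hL.ennreal_ofReal).indicator hset
  have hrefl : ∫⁻ y, F (2 * x - y) = ∫⁻ y, F y := lintegral_sub_left_eq_self F (2 * x)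
  -- The integral is folded by the reflection `y ↦ 2 x - y`: the two reflected values of `L` average
  -- to `L x`, and the step density is even.
  have hle : ∀ y, F y + F (2 * x - y) ≤ g (y - x) * (2 * ENNReal.ofReal (L x)) := by
    intro y
    have hsym : |2 * x - y - x| = |y - x| := by rw [← abs_neg]; congr 1; ring
    by_cases hy : |y - x| ≤ η
    · have hy' : |2 * x - y - x| ≤ η := by rwa [hsym]
      have e1 : F y = g (y - x) * ENNReal.ofReal (L y) := indicator_of_mem (s := {y | |y - x| ≤ η}) hy _
      have e2 : F (2 * x - y) = g (2 * x - y - x) * ENNReal.ofReal (L (2 * x - y)) :=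
        indicator_of_mem (s := {y | |y - x| ≤ η}) hy' _
      rw [e1, e2, show 2 * x - y - x = -(y - x) by ring, hge, ← mul_add,
        ← ENNReal.ofReal_add (hpos _ hy) (hpos _ hy'),
        show L y + L (2 * x - y) = 2 * L x by
          rw [← hmid x (y - x)]; congr 2 <;> ring,
        ENNReal.ofReal_mul (by norm_num), ENNReal.ofReal_ofNat]
    · have e1 : F y = 0 := indicator_of_notMem (s := {y | |y - x| ≤ η}) hy _
      have e2 : F (2 * x - y) = 0 :=
        indicator_of_notMem (s := {y | |y - x| ≤ η}) (by
          change ¬ |2 * x - y - x| ≤ η; rwa [hsym]) _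
      rw [e1, e2, add_zero]
      exact bot_le
  have h2 : 2 * ∫⁻ y, F y ≤ 2 * ENNReal.ofReal (L x) := by
    calc 2 * ∫⁻ y, F y = ∫⁻ y, F y + F (2 * x - y) := by
          rw [lintegral_add_left hF, hrefl, two_mul]
      _ ≤ ∫⁻ y, g (y - x) * (2 * ENNReal.ofReal (L x)) := lintegral_mono hle
      _ = (∫⁻ y, g y) * (2 * ENNReal.ofReal (L x)) := by
          rw [lintegral_mul_const _
              (show Measurable fun y => g (y - x) from hg.comp (measurable_id.sub_const x)),
            lintegral_sub_right_eq_self g x]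
      _ ≤ 2 * ENNReal.ofReal (L x) := mul_le_of_le_one_left' hg1
  exact (ENNReal.mul_le_mul_iff_right (by norm_num) (by norm_num)).1 h2

open Classical in
/-- A family of affine functions, one for each stage, that dominates the survival probabilities. -/
lemma lintegral_stageSurvives_le (hg : Measurable g) (hg1 : ∫⁻ z, g z ≤ 1)
    (hge : ∀ z, g (-z) = g z) {L : ℕ → ℝ → ℝ} (hL : ∀ k, Measurable (L k))
    (hmid : ∀ k x z, L k (x + z) + L k (x - z) = 2 * L k x)
    (hlast : ∀ x, L N x = 1)
    (hpos : ∀ k, m ≤ k → k < N → ∀ x, (k = m ∨ x ≤ a k) → ∀ y, |y - x| ≤ η → 0 ≤ L k y)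
    (hnext : ∀ k, m ≤ k → k < N → ∀ y, b (k + 1) - η ≤ y → y ≤ b (k + 1) → L (k + 1) y ≤ L k y)
    (hb : ∀ k, m ≤ k → k + 1 < N → b (k + 2) ≤ b (k + 1) - η)
    (hab : ∀ k, m ≤ k → k + 1 < N → b (k + 1) ≤ a (k + 1))
    (n k : ℕ) (hmk : m ≤ k) (hkN : k ≤ N) (x : ℝ)
    (hx : k < N → (k = m ∨ x ≤ a k) ∧ b (k + 1) ≤ x) :
    ∫⁻ y, (if StageSurvives a b m N η n k x y then stepWeight g n x y else 0) ≤
      ENNReal.ofReal (L k x) := by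
  rcases hkN.eq_or_lt with rfl | hkN
  · rw [hlast, ENNReal.ofReal_one]
    refine le_trans (lintegral_mono fun y => ?_) (lintegral_stepWeight_le hg hg1 n x)
    split_ifs
    exacts [le_rfl, bot_le]
  induction n generalizing k x with
  | zero => simp [StageSurvives, not_le.2 hkN]
  | succ n ih =>
    obtain ⟨hxa, hxb⟩ := hx hkN
    have hm := measurable_stepWeight hg n
    let S : ℕ → ℝ → (Fin n → ℝ) → ℝ≥0∞ := fun k x y =>
      if StageSurvives a b m N η n k x y then stepWeight g n x y else 0
    have hS : ∀ k, Measurable fun p : ℝ × (Fin n → ℝ) => S k p.1 p.2 := fun k =>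
      Measurable.ite (measurableSet_stageSurvives n k) hm measurable_const
    let F : ℝ × (Fin n → ℝ) → ℝ≥0∞ := fun p =>
      if |p.1 - x| ≤ η ∧ (k = m ∨ p.1 ≤ a k) then
        g (p.1 - x) * (if p.1 < b (k + 1) then S (k + 1) p.1 p.2 else S k p.1 p.2) else 0
    have hF : Measurable F := by
      refine Measurable.ite ?_ ?_ measurable_const
      · exact (measurableSet_le (continuous_abs.measurable.comp (measurable_fst.sub_const x))
          measurable_const).inter
          ((MeasurableSet.const _).union (measurableSet_le measurable_fst measurable_const))
      · exact (hg.comp (measurable_fst.sub_const x)).mul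
          (Measurable.ite (measurableSet_lt measurable_fst measurable_const) (hS _) (hS _))
    have hFeq : ∀ y : Fin (n + 1) → ℝ, (if StageSurvives a b m N η (n + 1) k x y then
        stepWeight g (n + 1) x y else 0) = F (y 0, Fin.tail y) := by
      intro y
      simp only [StageSurvives, not_le.2 hkN, false_or, stepWeight, F, S]
      by_cases h1 : |y 0 - x| ≤ η ∧ (k = m ∨ y 0 ≤ a k)
      · by_cases h2 : y 0 < b (k + 1)
        · simp [h1, h2, not_le.2 h2, mul_ite]
        · simp [h1, h2, not_lt.1 h2, mul_ite]
      · rw [if_neg h1, if_neg fun h => h1 ⟨h.1, h.2.1⟩]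
    simp_rw [hFeq]
    rw [lintegral_fin_succ hF]
    refine le_trans (lintegral_mono fun u => ?_) (lintegral_affine_le hg hg1 hge (hL k) (hmid k)
      (hpos k hmk hkN x hxa))
    by_cases h1 : |u - x| ≤ η
    swap
    · simp [F, h1]
    rw [indicator_of_mem (s := {y | |y - x| ≤ η}) h1]
    by_cases h2 : k = m ∨ u ≤ a k
    swap
    · simp [F, h2]
    simp only [F, h1, h2, and_self, if_true]
    by_cases h3 : u < b (k + 1)
    · simp only [h3, if_true]
      rw [lintegral_const_mul _
        (show Measurable fun y => S (k + 1) u y from (hS (k + 1)).comp measurable_prodMk_left)]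
      gcongr
      -- The walk was above `b (k + 1)` and moves by at most `η`, so it overshoots by at most `η`.
      -- On this window `hnext` lets `L (k + 1)` be replaced by `L k`.
      have hu : b (k + 1) - η ≤ u := by
        have := (abs_le.1 h1).1
        linarith
      refine le_trans ?_ (ENNReal.ofReal_le_ofReal (hnext k hmk hkN u hu h3.le))
      rcases (Nat.succ_le_of_lt hkN).eq_or_lt with h4 | h4
      · rw [show k + 1 = N from h4, hlast, ENNReal.ofReal_one]
        refine le_trans (lintegral_mono fun y => ?_) (lintegral_stepWeight_le hg hg1 n u)
        simp only [S]
        split_ifs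
        exacts [le_rfl, bot_le]
      · exact ih (k + 1) (hmk.trans k.le_succ) h4.le u
          (fun _ => ⟨Or.inr (h3.le.trans (hab k hmk h4)), (hb k hmk h4).trans hu⟩) h4
    · simp only [h3, if_false]
      rw [lintegral_const_mul _
        (show Measurable fun y => S k u y from (hS k).comp measurable_prodMk_left)]
      gcongr
      exact ih k hmk hkN.le u (fun _ => ⟨h2, not_lt.1 h3⟩) hkN

end

section

/-! ### The probability of crossing all dyadic levels without a steep excursion -/

/-- The level `h + 2⁻ᵏ`. -/
def crossLevel (h : ℝ) (k : ℕ) : ℝ := h + (1 / 2) ^ k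

/-- The height of a steep excursion at scale `2⁻ᵏ`. -/
def steepLevel (h : ℝ) (k : ℕ) : ℝ := h + 200 * k * (1 / 2) ^ k

/-- A product that dominates the probability that there is no steep excursion. -/
def flatBound (k : ℕ) : ℝ := ∏ i ∈ Finset.range k, (1 - 1 / (800 * ((i : ℝ) + 1)))

lemma flatFactor_pos (i : ℕ) : (0 : ℝ) < 1 - 1 / (800 * ((i : ℝ) + 1)) := by
  have h : (0 : ℝ) ≤ i := i.cast_nonneg
  rw [sub_pos, div_lt_one (by positivity)]
  linarith

lemma flatBound_pos (k : ℕ) : 0 < flatBound k := Finset.prod_pos fun i _ => flatFactor_pos i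

lemma flatBound_succ (k : ℕ) :
    flatBound (k + 1) = flatBound k * (1 - 1 / (800 * ((k : ℝ) + 1))) := Finset.prod_range_succ _ _

/-- The logarithm is bounded by minus a multiple of the harmonic series. A height of order `k 2⁻ᵏ`
still gives a non-summable loss, and also dominates the modulus of the labels. -/
lemma tendsto_flatBound : Filter.Tendsto flatBound Filter.atTop (nhds 0) := by
  have h1 := Real.tendsto_sum_range_one_div_nat_succ_atTop.const_mul_atTop
    (show (0 : ℝ) < 1 / 800 by norm_num)
  have h2 := Real.tendsto_exp_neg_atTop_nhds_zero.comp h1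
  refine squeeze_zero (fun k => (flatBound_pos k).le) (fun k => ?_) h2
  rw [Function.comp_apply, Finset.mul_sum, ← Finset.sum_neg_distrib, Real.exp_sum, flatBound]
  refine Finset.prod_le_prod (fun i _ => (flatFactor_pos i).le) fun i _ => ?_
  have := Real.one_sub_le_exp_neg (1 / 800 * (1 / ((i : ℝ) + 1)))
  rwa [← one_div_mul_one_div (800 : ℝ)]

/-- Affine functions of the position that dominate the survival probabilities of the stages. -/
def stageBound (h : ℝ) (m M : ℕ) (η : ℝ) (k : ℕ) (x : ℝ) : ℝ :=
  if M < k then 1 else if k = m then flatBound M / flatBound m else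
    flatBound M / flatBound k * ((steepLevel h k + η - x) / (steepLevel h k + η - crossLevel h (k + 1)))

variable {h : ℝ} {m M : ℕ} {η : ℝ}

lemma steep_sub_cross_pos {k : ℕ} (hk : 1 ≤ k) (hη : 0 ≤ η) :
    0 < steepLevel h k + η - crossLevel h (k + 1) := by
  unfold steepLevel crossLevel
  have h1 : (1 : ℝ) ≤ k := by exact_mod_cast hk
  have h2 : (0 : ℝ) < (1 / 2) ^ k := by positivity
  rw [pow_succ]
  nlinarith

lemma le_stageBound {k : ℕ} (hmk : m ≤ k) (hkM : k ≤ M) (hη : 0 ≤ η) {y : ℝ}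
    (hy : y ≤ crossLevel h (k + 1)) :
    flatBound M / flatBound k ≤ stageBound h m M η k y := by
  rw [stageBound, if_neg (not_lt.2 hkM)]
  split_ifs with h1
  · rw [h1]
  · have := steep_sub_cross_pos (h := h) (k := k) (by omega) hη
    refine le_mul_of_one_le_right (div_pos (flatBound_pos _) (flatBound_pos _)).le ?_
    rw [one_le_div this]
    linarith

/-- Gambler's ruin: with `P = 2^{-(k+1)}`, from `h + P` the level `h + P/2` is reached before `h +
200 (k + 1) P` with probability at most `1 - 1 / (400 (k + 1))`. `flatBound` keeps half of this
gain; the other half pays for overshoots of size `η ≤ P / 8`. -/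
lemma stageBound_succ_le {k : ℕ} (hmk : m ≤ k) (hkM : k + 1 ≤ M) (hη : 0 ≤ η)
    (hη2 : η ≤ (1 / 2) ^ (M + 1) / 8) {y : ℝ} (hy : crossLevel h (k + 1) - η ≤ y) :
    stageBound h m M η (k + 1) y ≤ flatBound M / flatBound k := by
  have hp := steep_sub_cross_pos (h := h) (k := k + 1) (by omega) hη
  rw [stageBound, if_neg (not_lt.2 hkM), if_neg (by omega), flatBound_succ]
  have h1 : flatBound M / flatBound k = flatBound M /
      (flatBound k * (1 - 1 / (800 * ((k : ℝ) + 1)))) * (1 - 1 / (800 * ((k : ℝ) + 1))) := by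
    rw [div_mul_eq_mul_div, mul_div_mul_right _ _ (flatFactor_pos k).ne']
  rw [h1]
  refine mul_le_mul_of_nonneg_left ?_ (div_pos (flatBound_pos _)
    (mul_pos (flatBound_pos _) (flatFactor_pos k))).le
  rw [div_le_iff₀ hp]
  have hf := (flatFactor_pos k).le
  have hη3 : η ≤ (1 / 2) ^ (k + 1) / 8 := hη2.trans (by
    have : (1 / 2 : ℝ) ^ (M + 1) ≤ (1 / 2) ^ (k + 1) :=
      pow_le_pow_of_le_one (by norm_num) (by norm_num) (by omega)
    linarith)
  have hP : (0 : ℝ) < (1 / 2) ^ (k + 1) := by positivity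
  set P : ℝ := (1 / 2) ^ (k + 1)
  have hk : (0 : ℝ) ≤ k := k.cast_nonneg
  have e1 : steepLevel h (k + 1) + η - crossLevel h (k + 1 + 1) =
      (200 * ((k : ℝ) + 1) - 1 / 2) * P + η := by
    unfold steepLevel crossLevel
    rw [pow_succ _ (k + 1)]
    push_cast
    simp only [P]
    ring
  have e2 : steepLevel h (k + 1) + η - y ≤ (200 * ((k : ℝ) + 1) - 1) * P + 2 * η := by
    have : steepLevel h (k + 1) = h + 200 * ((k : ℝ) + 1) * P := by
      unfold steepLevel; push_cast; rfl
    have : crossLevel h (k + 1) = h + P := rfl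
    linarith
  refine e2.trans ?_
  rw [e1, mul_add]
  have e3 : (1 - 1 / (800 * ((k : ℝ) + 1))) * ((200 * ((k : ℝ) + 1) - 1 / 2) * P) =
      (200 * ((k : ℝ) + 1) - 1 / 2) * P - P / 4 + P / (1600 * ((k : ℝ) + 1)) := by
    field_simp
    ring
  have e4 : 0 ≤ P / (1600 * ((k : ℝ) + 1)) := by positivity
  have e5 := mul_nonneg hf hη
  linarith

open Classical in
lemma lintegral_flat_le {g : ℝ → ℝ≥0∞} (hg : Measurable g) (hg1 : ∫⁻ z, g z ≤ 1)
    (hge : ∀ z, g (-z) = g z) (hη : 0 ≤ η) (hη2 : η ≤ (1 / 2) ^ (M + 1) / 8) (hmM : m ≤ M) (n : ℕ)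
    {x : ℝ} (hx : crossLevel h (m + 1) ≤ x) :
    ∫⁻ y, (if StageSurvives (steepLevel h) (crossLevel h) m (M + 1) η n m x y then
      stepWeight g n x y else 0) ≤ ENNReal.ofReal (flatBound M / flatBound m) := by
  have hpow : ∀ k, k ≤ M + 1 → (1 / 2 : ℝ) ^ (M + 1) ≤ (1 / 2) ^ k := fun k hk =>
    pow_le_pow_of_le_one (by norm_num) (by norm_num) hk
  -- Stage `m` has no barrier, since the starting height is only bounded below, so its bound is a
  -- constant; stage `M + 1` is terminal, with bound `1`.
  refine (lintegral_stageSurvives_le (a := steepLevel h) (b := crossLevel h) (N := M + 1) (η := η)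
    (L := stageBound h m M η) hg hg1 hge (fun k => ?_) (fun k x z => ?_) (fun x => ?_)
    (fun k hmk hkN x hx y hy => ?_) (fun k hmk hkN y hy1 hy2 => ?_) (fun k hmk hkN => ?_)
    (fun k hmk hkN => ?_) n m le_rfl (hmM.trans M.le_succ) x fun _ => ⟨Or.inl rfl, hx⟩).trans_eq ?_
  · unfold stageBound
    split_ifs <;> fun_prop
  · unfold stageBound
    split_ifs <;> ring
  · rw [stageBound, if_pos M.lt_succ_self]
  · rw [stageBound, if_neg (by omega)]
    have h0 := flatBound_pos M
    split_ifs with h1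
    · exact (div_pos h0 (flatBound_pos _)).le
    · have hp := steep_sub_cross_pos (h := h) (k := k) (by omega) hη
      have h2 := hx.resolve_left h1
      have h3 := (abs_le.1 hy).2
      exact mul_nonneg (div_pos h0 (flatBound_pos _)).le (div_nonneg (by linarith) hp.le)
  · refine le_trans ?_ (le_stageBound hmk (Nat.lt_succ_iff.1 hkN) hη hy2)
    rcases (Nat.lt_succ_iff.1 hkN).eq_or_lt with rfl | hlt
    · rw [stageBound, if_pos (Nat.lt_succ_self _), div_self (flatBound_pos _).ne']
    · exact stageBound_succ_le hmk hlt hη hη2 hy1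
  · have h1 := hpow (k + 2) (by omega)
    have h2 : (0 : ℝ) < (1 / 2) ^ (M + 1) := by positivity
    have h3 : (1 / 2 : ℝ) ^ (k + 1) = 2 * (1 / 2) ^ (k + 2) := by rw [pow_succ _ (k + 1)]; ring
    unfold crossLevel
    linarith
  · unfold crossLevel steepLevel
    have h2 : (0 : ℝ) < (1 / 2) ^ (k + 1) := by positivity
    have h1 : (0 : ℝ) ≤ k := k.cast_nonneg
    push_cast
    nlinarith
  · rw [stageBound, if_neg (by omega), if_pos rfl]

end

/-! ### Comparison of the excursion with a Gaussian random walk -/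

lemma exists_hitDensity_le {t : ℝ} (ht : 0 < t) :
    ∃ C : ℝ, 0 ≤ C ∧ ∀ x, 0 < x → 0 ≤ hitDensity t x ∧ hitDensity t x ≤ C := by
  refine ⟨(1 + 2 * t) / √(2 * Real.pi * t ^ 3), by positivity, fun x hx => ⟨?_, ?_⟩⟩
  · unfold hitDensity; positivity
  · have h1 : 0 < √(2 * Real.pi * t ^ 3) := by positivity
    rw [hitDensity, div_mul_eq_mul_div]
    refine div_le_div_of_nonneg_right ?_ h1.le
    have h2 : 1 + x ^ 2 / (2 * t) ≤ Real.exp (x ^ 2 / (2 * t)) := by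
      rw [add_comm]; exact Real.add_one_le_exp _
    rw [neg_div, Real.exp_neg, ← div_eq_mul_inv, div_le_iff₀ (Real.exp_pos _)]
    refine le_trans ?_ (mul_le_mul_of_nonneg_left h2 (by positivity))
    have h3 : (1 + 2 * t) * (1 + x ^ 2 / (2 * t)) = 1 + x ^ 2 / (2 * t) + 2 * t + x ^ 2 := by
      field_simp; ring
    rw [h3]
    have h4 : 0 ≤ x ^ 2 / (2 * t) := by positivity
    nlinarith [sq_nonneg (x - 1)]

lemma killedDensity_nonneg {t x y : ℝ} (ht : 0 < t) (hx : 0 < x) (hy : 0 < y) :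
    0 ≤ killedDensity t x y := by
  refine div_nonneg (sub_nonneg.2 (Real.exp_le_exp.2 ?_)) (Real.sqrt_nonneg _)
  refine div_le_div_of_nonneg_right ?_ (by positivity)
  nlinarith [mul_pos hx hy]

lemma killedDensity_le {t : NNReal} (x y : ℝ) :
    killedDensity t x y ≤ gaussianPDFReal 0 t (y - x) := by
  rw [killedDensity, gaussianPDFReal, sub_zero, inv_mul_eq_div]
  refine div_le_div_of_nonneg_right ?_ (Real.sqrt_nonneg _)
  linarith [Real.exp_pos (-(y + x) ^ 2 / (2 * t))]

/-- The killed density is below the Gaussian one, and the hitting densities at the two ends are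
bounded. The constant depends only on the end times, not on the mesh, so the grid may be refined
freely. -/
lemma exists_excursionDensity_le {s : ℝ} (hs0 : 0 < s) {T : ℝ} (hT : T < 1) :
    ∃ K : ℝ, 0 ≤ K ∧ ∀ (n : ℕ) (t : Fin (n + 1) → ℝ) (v : NNReal), v ≠ 0 → t 0 = s →
      t (Fin.last n) = T → (∀ i : Fin n, t i.succ - t i.castSucc = v) → ∀ x : Fin (n + 1) → ℝ,
        ENNReal.ofReal (excursionDensity t x) ≤
          ENNReal.ofReal K * stepWeight (gaussianPDF 0 v) n (x 0) (Fin.tail x) := by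
  obtain ⟨C₁, h1, H1⟩ := exists_hitDensity_le hs0
  obtain ⟨C₂, h2, H2⟩ := exists_hitDensity_le (sub_pos.2 hT)
  refine ⟨2 * √(2 * Real.pi) * C₁ * C₂, by positivity, fun n t v hv ht0 htl hti x => ?_⟩
  rw [excursionDensity]
  split_ifs with hx
  swap
  · simp
  rw [stepWeight_eq_prod]
  simp only [gaussianPDF]
  rw [← ENNReal.ofReal_prod_of_nonneg fun i _ => gaussianPDFReal_nonneg _ _ _,
    ← ENNReal.ofReal_mul (by positivity)]
  refine ENNReal.ofReal_le_ofReal ?_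
  simp only [hti, ht0, htl]
  have hv' : (0 : ℝ) < v := by positivity
  have hk : ∀ i : Fin n, 0 ≤ killedDensity v (x i.castSucc) (x i.succ) := fun i =>
    killedDensity_nonneg hv' (hx _) (hx _)
  have hprod : ∏ i : Fin n, killedDensity v (x i.castSucc) (x i.succ) ≤
      ∏ i : Fin n, gaussianPDFReal 0 v (x i.succ - x i.castSucc) :=
    Finset.prod_le_prod (fun i _ => hk i) fun i _ => killedDensity_le _ _
  have hp0 : 0 ≤ ∏ i : Fin n, killedDensity v (x i.castSucc) (x i.succ) :=
    Finset.prod_nonneg fun i _ => hk i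
  obtain ⟨a1, a2⟩ := H1 _ (hx 0)
  obtain ⟨b1, b2⟩ := H2 _ (hx (Fin.last n))
  calc 2 * √(2 * Real.pi) * hitDensity s (x 0) * (∏ i : Fin n, killedDensity v (x i.castSucc)
        (x i.succ)) * hitDensity (1 - T) (x (Fin.last n))
      ≤ 2 * √(2 * Real.pi) * C₁ * (∏ i : Fin n, gaussianPDFReal 0 v (x i.succ - x i.castSucc)) *
        C₂ := by
          gcongr
          exact mul_nonneg (by positivity) (hp0.trans hprod)
    _ = _ := by ring

/-! ### Flat paths survive all the stages -/

lemma crossLevel_anti (h : ℝ) : Antitone (crossLevel h) := fun j k hjk => by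
  have : (1 / 2 : ℝ) ^ k ≤ (1 / 2) ^ j := pow_le_pow_of_le_one (by norm_num) (by norm_num) hjk
  unfold crossLevel
  linarith

/-- In a stage `k > m`, the path has passed below `h + 2⁻ᵏ` but, even between grid times, not below
`h + 2⁻ᵏ⁻¹ - η > h`. Its running minimum is thus in the steep window, so rising above `steepLevel h
k` would be a steep time. This invariant, `hinv`, is carried along the grid. -/
lemma stageSurvives_of_flat {e : C(I, ℝ)} {h η : ℝ} {m M : ℕ}
    (hη2 : η ≤ (1 / 2) ^ (M + 1) / 8) {τ : ℕ → I} (hτ : ∀ i, half ≤ τ i)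
    (hτm : ∀ i, τ i ≤ τ (i + 1))
    (hmod : ∀ i u, τ i ≤ u → u ≤ τ (i + 1) → |e u - e (τ i)| ≤ η ∧ |e u - e (τ (i + 1))| ≤ η)
    (hflat : ∀ k > m, ∀ t, half ≤ t → ¬ Steep e h k t) (n i k : ℕ) (hmk : m ≤ k)
    (hend : e (τ (i + n)) < crossLevel h (M + 1))
    (hinv : k ≤ M → crossLevel h (k + 1) ≤ e (τ i) ∧
      (∀ u, half ≤ u → u ≤ τ i → crossLevel h (k + 1) - η ≤ e u) ∧
      (k = m ∨ ∃ u, half ≤ u ∧ u ≤ τ i ∧ e u < crossLevel h k)) :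
    StageSurvives (steepLevel h) (crossLevel h) m (M + 1) η n k (e (τ i))
      fun j => e (τ (i + 1 + j)) := by
  have hp : (0 : ℝ) < (1 / 2) ^ (M + 1) := by positivity
  induction n generalizing i k with
  | zero =>
    by_contra hk
    have hk' : k ≤ M := by simpa [StageSurvives] using hk
    exact absurd ((hinv hk').1.trans_lt hend) (not_lt.2 (crossLevel_anti h (by omega)))
  | succ n ih =>
    rcases Nat.lt_or_ge M k with hk | hk
    · exact Or.inl hk
    obtain ⟨h1, h2, h3⟩ := hinv hk
    have htail : ∀ j : Fin n, (fun j : Fin (n + 1) => e (τ (i + 1 + j))) j.succ =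
        e (τ (i + 1 + 1 + j)) := fun j => by
      simp only [Fin.val_succ]
      rw [show i + 1 + ((j : ℕ) + 1) = i + 1 + 1 + j by omega]
    have htail' : Fin.tail (fun j : Fin (n + 1) => e (τ (i + 1 + j))) =
        fun j : Fin n => e (τ (i + 1 + 1 + j)) := funext htail
    have hend' : e (τ (i + 1 + n)) < crossLevel h (M + 1) := by
      rwa [show i + 1 + n = i + (n + 1) by omega]
    have h4 := (abs_le.1 (hmod i _ (hτm i) le_rfl).1).1
    have hlow : ∀ u, half ≤ u → u ≤ τ (i + 1) → crossLevel h (k + 1) - η ≤ e u := by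
      intro u hu hu'
      rcases le_total u (τ i) with hui | hui
      · exact h2 u hu hui
      · have := (abs_le.1 (hmod i u hui hu').1).1
        linarith
    have hcross : h < crossLevel h (k + 1) - η := by
      have := crossLevel_anti h (show k + 1 ≤ M + 1 by omega)
      have : crossLevel h (M + 1) = h + (1 / 2) ^ (M + 1) := rfl
      linarith
    refine Or.inr ⟨(hmod i _ (hτm i) le_rfl).1, ?_, ?_⟩
    · refine or_iff_not_imp_left.2 fun hkm => ?_
      obtain ⟨u, hu1, hu2, hu3⟩ := h3.resolve_left hkm
      by_contra hlt
      refine hflat k (by omega) (τ (i + 1)) (hτ _) ⟨?_, ?_, not_le.1 hlt⟩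
      · exact hcross.trans_le (le_infOn e (hτ _) hlow)
      · exact (infOn_le e hu1 (hu2.trans (hτm i))).trans_lt hu3
    · rw [htail']
      rcases lt_or_ge (e (τ (i + 1))) (crossLevel h (k + 1)) with hlt | hge
      · refine Or.inl ⟨hlt, ih (i + 1) (k + 1) (by omega) hend' fun hk' => ⟨?_, fun u hu hu' => ?_,
          Or.inr ⟨τ (i + 1), hτ _, le_rfl, hlt⟩⟩⟩
        · have e1 : crossLevel h (k + 1) = crossLevel h (k + 1 + 1) + (1 / 2) ^ (k + 1 + 1) := by
            unfold crossLevel; rw [pow_succ _ (k + 1)]; ring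
          have e2 : (1 / 2 : ℝ) ^ (M + 1) ≤ (1 / 2) ^ (k + 1 + 1) :=
            pow_le_pow_of_le_one (by norm_num) (by norm_num) (by omega)
          linarith
        · have := crossLevel_anti h (Nat.le_succ (k + 1))
          linarith [hlow u hu hu']
      · exact Or.inr ⟨hge, ih (i + 1) k hmk hend' fun _ => ⟨hge, hlow,
          h3.imp_right fun ⟨u, hu1, hu2, hu3⟩ => ⟨u, hu1, hu2.trans (hτm i), hu3⟩⟩⟩

/-! ### Flat excursions are negligible -/

lemma gaussianPDF_neg (v : NNReal) (z : ℝ) : gaussianPDF 0 v (-z) = gaussianPDF 0 v z := by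
  simp [gaussianPDF, gaussianPDFReal]

/-- The excursions that start from a height in `[h + 2^{-(m+1)}, R]` at time `1/2`, are below `h` at
time `T`, and are never steep above `h` at a scale beyond `m`. -/
def flatPaths (h : ℝ) (m : ℕ) (R : ℝ) (T : I) : Set C(I, ℝ) :=
  {e | crossLevel h (m + 1) ≤ e half ∧ e half ≤ R ∧ e T < h ∧
    ∀ k > m, ∀ t, half ≤ t → ¬ Steep e h k t}

/-- The cap `R` makes the integral over the starting height finite, and `K` is uniform in `M` and in
the grid. -/
lemma IsExcursionLaw.exists_measure_survives_le {ν : Measure C(I, ℝ)} (hν : IsExcursionLaw ν)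
    {h : ℝ} (hh : 0 < h) (m : ℕ) (R : ℝ) {T : I} (hT1 : T < 1) :
    ∃ K : ℝ, ∀ (M n : ℕ) (t : Fin (n + 1) → I) (v : NNReal) (η : ℝ), m ≤ M → 0 ≤ η →
      η ≤ (1 / 2) ^ (M + 1) / 8 → StrictMono t → t 0 = half → t (Fin.last n) = T → v ≠ 0 →
      (∀ i : Fin n, (t i.succ : ℝ) - t i.castSucc = v) →
      ν {e | (crossLevel h (m + 1) ≤ e half ∧ e half ≤ R) ∧
        StageSurvives (steepLevel h) (crossLevel h) m (M + 1) η n m (e half)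
          fun j => e (t j.succ)} ≤ ENNReal.ofReal (K * flatBound M) := by
  classical
  obtain ⟨K, hK, H⟩ := exists_excursionDensity_le (s := (half : ℝ)) (by norm_num [half])
    (T := (T : ℝ)) (by exact_mod_cast hT1)
  refine ⟨K * max R 0 / flatBound m, fun M n t v η hmM hη hη2 ht ht0 htl hv hti => ?_⟩
  let A : Set (ℝ × (Fin n → ℝ)) := {p | (crossLevel h (m + 1) ≤ p.1 ∧ p.1 ≤ R) ∧
    StageSurvives (steepLevel h) (crossLevel h) m (M + 1) η n m p.1 p.2}
  have hA : MeasurableSet A := ((measurableSet_le measurable_const measurable_fst).inter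
    (measurableSet_le measurable_fst measurable_const)).inter (measurableSet_stageSurvives n m)
  have hg : Measurable (gaussianPDF 0 v) := measurable_gaussianPDF 0 v
  have hg1 : ∫⁻ z, gaussianPDF 0 v z ≤ 1 := (lintegral_gaussianPDF_eq_one 0 hv).le
  have hW := measurable_stepWeight hg n
  let F : ℝ × (Fin n → ℝ) → ℝ≥0∞ := fun p =>
    ENNReal.ofReal K * if p ∈ A then stepWeight (gaussianPDF 0 v) n p.1 p.2 else 0
  have hF : Measurable F := (Measurable.ite hA hW measurable_const).const_mul _
  have htailm : Measurable fun x : Fin (n + 1) → ℝ => (x 0, Fin.tail x) :=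
    (measurable_pi_apply 0).prodMk (measurable_pi_lambda _ fun j => measurable_pi_apply j.succ)
  have hev : Measurable fun (e : C(I, ℝ)) i => e (t i) :=
    measurable_pi_lambda _ fun i => measurable_eval_path _
  have hpre : {e : C(I, ℝ) | (crossLevel h (m + 1) ≤ e half ∧ e half ≤ R) ∧
        StageSurvives (steepLevel h) (crossLevel h) m (M + 1) η n m (e half)
          fun j => e (t j.succ)} =
      (fun (e : C(I, ℝ)) i => e (t i)) ⁻¹' ((fun x => (x 0, Fin.tail x)) ⁻¹' A) := by
    ext e
    simp only [mem_preimage, A, mem_ofPred_eq, ht0]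
    rfl
  have hc : 0 < crossLevel h (m + 1) := by unfold crossLevel; positivity
  rw [hpre, ← Measure.map_apply hev (htailm hA), hν n t ht (by
    rw [ht0, ← Subtype.coe_lt_coe]; norm_num [half]) (by rwa [htl]),
    withDensity_apply _ (htailm hA), ← lintegral_indicator (htailm hA)]
  calc ∫⁻ x, _ ≤ ∫⁻ x : Fin (n + 1) → ℝ, F (x 0, Fin.tail x) := by
        refine lintegral_mono fun x => ?_
        by_cases hx : (x 0, Fin.tail x) ∈ A
        · rw [indicator_of_mem (show x ∈ (fun x => (x 0, Fin.tail x)) ⁻¹' A from hx)]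
          simp only [F, hx, if_true]
          exact H n (fun i => (t i : ℝ)) v hv (by rw [ht0]) (by rw [htl]) hti x
        · rw [indicator_of_notMem (show x ∉ (fun x => (x 0, Fin.tail x)) ⁻¹' A from hx)]
          exact bot_le
    _ = ∫⁻ u, ∫⁻ y, F (u, y) := lintegral_fin_succ hF
    _ ≤ ∫⁻ u, (Icc 0 R).indicator
          (fun _ => ENNReal.ofReal K * ENNReal.ofReal (flatBound M / flatBound m)) u := by
        refine lintegral_mono fun u => ?_
        by_cases hu : crossLevel h (m + 1) ≤ u ∧ u ≤ R
        · rw [indicator_of_mem (show u ∈ Icc 0 R from ⟨hc.le.trans hu.1, hu.2⟩)]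
          have hm2 : Measurable fun y => if StageSurvives (steepLevel h) (crossLevel h) m (M + 1) η
              n m u y then stepWeight (gaussianPDF 0 v) n u y else 0 :=
            (Measurable.ite (measurableSet_stageSurvives n m) hW measurable_const).comp
              measurable_prodMk_left
          simp only [F, A, mem_ofPred_eq, hu, true_and, and_self]
          rw [lintegral_const_mul _ hm2]
          gcongr
          exact lintegral_flat_le hg hg1 (gaussianPDF_neg v) hη hη2 hmM n hu.1
        · simp [F, A, hu]
    _ = ENNReal.ofReal K * ENNReal.ofReal (flatBound M / flatBound m) * ENNReal.ofReal R := by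
        rw [lintegral_indicator measurableSet_Icc, setLIntegral_const, Real.volume_Icc, sub_zero]
    _ = ENNReal.ofReal (K * max R 0 / flatBound m * flatBound M) := by
        have h1 := flatBound_pos M
        have h2 := flatBound_pos m
        rw [show ENNReal.ofReal R = ENNReal.ofReal (max R 0) by
            rcases le_total R 0 with h | h <;> simp [h, ENNReal.ofReal_of_nonpos],
          ← ENNReal.ofReal_mul hK, ← ENNReal.ofReal_mul (by positivity)]
        congr 1
        field_simp

/-- The uniform subdivision of `[1/2, T]` into `n` intervals, continued by `T`. -/
def gridTime (T : I) (n : ℕ) (i : ℕ) : I :=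
  Set.projIcc 0 1 zero_le_one (1 / 2 + ((T : ℝ) - 1 / 2) * (min i n : ℕ) / n)

/-- For fixed `M`, flat paths are exhausted by the sets `B j` of those oscillating by at most `η`
over times `1 / (j + 1)`, to which a grid finer than this applies. The bound does not depend on `j`,
and tends to zero with `M`. -/
theorem IsExcursionLaw.measure_flatPaths {ν : Measure C(I, ℝ)} (hν : IsExcursionLaw ν)
    {h : ℝ} (hh : 0 < h) (m : ℕ) (R : ℝ) {T : I} (hT : half < T) (hT1 : T < 1) :
    ν (flatPaths h m R T) = 0 := by
  obtain ⟨K, H⟩ := hν.exists_measure_survives_le hh m R hT1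
  have hT' : (1 / 2 : ℝ) < T := by
    have : (half : ℝ) < T := hT
    simpa [half] using this
  have hgrid : ∀ n : ℕ, 0 < n → ∀ i, (gridTime T n i : ℝ) =
      1 / 2 + ((T : ℝ) - 1 / 2) * (min i n : ℕ) / n := by
    intro n hn i
    have hn' : (0 : ℝ) < n := by exact_mod_cast hn
    have h1 : ((min i n : ℕ) : ℝ) / n ≤ 1 := by
      rw [div_le_one hn']; exact_mod_cast min_le_right _ _
    have h0 : (0 : ℝ) ≤ ((min i n : ℕ) : ℝ) / n := by positivity
    have h2 := T.2.2
    rw [gridTime, projIcc_of_mem]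
    rw [mul_div_assoc]
    constructor <;> nlinarith
  have key : ∀ M ≥ m, ν (flatPaths h m R T) ≤ ENNReal.ofReal (K * flatBound M) := by
    intro M hM
    set η : ℝ := (1 / 2) ^ (M + 1) / 8 with hηdef
    have hη : 0 < η := by positivity
    let B : ℕ → Set C(I, ℝ) := fun j => {e | e ∈ flatPaths h m R T ∧
      ∀ s t : I, |(s : ℝ) - t| ≤ 1 / (j + 1) → |e s - e t| ≤ η}
    have hBmono : Monotone B := fun i j hij e he => ⟨he.1, fun s t hst => he.2 s t (hst.trans (by
      have : (i : ℝ) ≤ j := by exact_mod_cast hij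
      gcongr))⟩
    have hBU : flatPaths h m R T ⊆ ⋃ j, B j := by
      intro e he
      obtain ⟨δ, hδ, hu⟩ := Metric.uniformContinuous_iff.1
        (CompactSpace.uniformContinuous_of_continuous e.continuous) η hη
      obtain ⟨j, hj⟩ := exists_nat_one_div_lt hδ
      refine mem_iUnion.2 ⟨j, he, fun s t hst => ?_⟩
      have := hu (a := s) (b := t) (by
        rw [Subtype.dist_eq, Real.dist_eq]; exact hst.trans_lt hj)
      rw [Real.dist_eq] at this
      exact this.le
    refine (measure_mono hBU).trans ?_
    rw [hBmono.measure_iUnion]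
    refine iSup_le fun j => ?_
    set n := j + 1 with hn
    have hn0 : (0 : ℝ) < n := by rw [hn]; positivity
    set δ : ℝ := ((T : ℝ) - 1 / 2) / n with hδ
    have hδ0 : 0 < δ := div_pos (by linarith) hn0
    have hδ1 : δ ≤ 1 / (j + 1) := by
      rw [hδ, hn]
      push_cast
      gcongr
      linarith [T.2.2]
    have hg : ∀ i, (gridTime T n i : ℝ) = 1 / 2 + (min i n : ℕ) * δ := fun i => by
      rw [hgrid n (by omega), hδ]; ring
    have hstep : ∀ i, gridTime T n i ≤ gridTime T n (i + 1) ∧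
        (gridTime T n (i + 1) : ℝ) - gridTime T n i ≤ δ := by
      intro i
      rw [← Subtype.coe_le_coe, hg, hg]
      rcases Nat.lt_or_ge i n with hi | hi
      · rw [min_eq_left hi.le, min_eq_left hi]
        push_cast
        constructor <;> linarith
      · rw [min_eq_right hi, min_eq_right (by omega)]
        constructor <;> linarith
    have hg0 : gridTime T n 0 = half := by
      rw [Subtype.ext_iff, hg]; simp [half]
    have hgn : gridTime T n n = T := by
      rw [Subtype.ext_iff, hg, min_self, hδ]; field_simp; ring
    refine (measure_mono ?_).trans (H M n (fun i => gridTime T n i) ⟨δ, hδ0.le⟩ η hM hη.le le_rfl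
      ?_ hg0 hgn (fun h0 => hδ0.ne' (congrArg NNReal.toReal h0)) ?_)
    · rintro e ⟨⟨he1, he2, he3, he4⟩, hemod⟩
      refine ⟨⟨he1, he2⟩, ?_⟩
      have hmono : Monotone (gridTime T n) := monotone_nat_of_le_succ fun i => (hstep i).1
      have hsurv := stageSurvives_of_flat (M := M) (η := η) le_rfl (τ := gridTime T n)
        (fun i => hg0 ▸ hmono (Nat.zero_le i)) (fun i => (hstep i).1) (fun i u hu hu' => ?_) he4 n 0 m
        le_rfl ?_ fun _ => ⟨by rwa [hg0], fun u hu hu' => ?_, Or.inl rfl⟩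
      · rw [hg0] at hsurv
        convert hsurv using 4
        simp [add_comm]
      · have h1 : (gridTime T n i : ℝ) ≤ u := hu
        have h2 : (u : ℝ) ≤ gridTime T n (i + 1) := hu'
        have h3 := (hstep i).2
        constructor <;> refine hemod _ _ ((abs_le.2 ⟨?_, ?_⟩).trans hδ1) <;> linarith
      · rw [zero_add, hgn]
        have : (0 : ℝ) < (1 / 2) ^ (M + 1) := by positivity
        unfold crossLevel
        linarith
      · rw [hg0] at hu'
        rw [le_antisymm hu' hu]
        linarith
    · intro i i' hii
      rw [← Subtype.coe_lt_coe, hg, hg, min_eq_left (by omega), min_eq_left (by omega)]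
      have : ((i : ℕ) : ℝ) < (i' : ℕ) := by exact_mod_cast hii
      nlinarith
    · intro i
      rw [hg, hg, Fin.val_succ, Fin.val_castSucc, min_eq_left (by omega), min_eq_left (by omega)]
      push_cast
      change _ = δ
      ring
  have hlim : Filter.Tendsto (fun M => ENNReal.ofReal (K * flatBound M)) Filter.atTop (nhds 0) := by
    have := ENNReal.tendsto_ofReal (tendsto_flatBound.const_mul K)
    rwa [mul_zero, ENNReal.ofReal_zero] at this
  refine le_antisymm (ge_of_tendsto hlim ?_) bot_le
  filter_upwards [Filter.eventually_ge_atTop m] with M hM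
  exact key M hM

/-- Above each level below its height at time `1/2`, the excursion is almost surely steep. -/
theorem IsExcursionLaw.ae_steepAbove {ν : Measure C(I, ℝ)} (hν : IsExcursionLaw ν)
    (h1 : ∀ᵐ e ∂ν, e 1 = 0) {h : ℝ} (hh : 0 < h) : ∀ᵐ e ∂ν, h < e half → SteepAbove e h := by
  obtain ⟨D, hDc, hDd⟩ := TopologicalSpace.exists_countable_dense I
  have key : ∀ᵐ e ∂ν, ∀ (m R : ℕ), ∀ T ∈ D, half < T → T < 1 → e ∉ flatPaths h m R T := by
    refine ae_all_iff.2 fun m => ae_all_iff.2 fun R => (ae_ball_iff hDc).2 fun T _ => ?_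
    by_cases hT : half < T ∧ T < 1
    · filter_upwards [measure_eq_zero_iff_ae_notMem.1 (hν.measure_flatPaths hh m R hT.1 hT.2)] with e he _ _
      exact he
    · exact ae_of_all _ fun e x1 x2 => absurd ⟨x1, x2⟩ hT
  filter_upwards [key, h1] with e he he1 hlt
  by_contra hsteep
  simp only [SteepAbove, not_forall, not_exists, not_and] at hsteep
  -- Failure of steepness beyond `n₀` places `e` in one of countably many null sets: `l` makes the
  -- starting height large enough for the scale, `R` bounds it, and `T` near `1` has `e T < h`.
  obtain ⟨n₀, hn₀⟩ := hsteep
  obtain ⟨R, hR⟩ := exists_nat_ge (e half)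
  obtain ⟨l, hl⟩ := exists_pow_lt_of_lt_one (sub_pos.2 hlt) (show (1 / 2 : ℝ) < 1 by norm_num)
  have hev : ∀ᶠ t in nhds (1 : I), e t < h :=
    e.continuous.continuousAt.eventually (gt_mem_nhds (by rwa [he1]))
  have hh1 : half < 1 := by rw [← Subtype.coe_lt_coe]; norm_num [half]
  obtain ⟨T₀, ⟨hT1, hT2⟩, hT3⟩ := exists_Ioc_subset_of_mem_nhds' hev hh1
  obtain ⟨T, hTD, hT4, hT5⟩ := hDd.exists_between hT2
  refine he (max n₀ l) R T hTD (hT1.trans_lt hT4) hT5 ⟨?_, hR, hT3 ⟨hT4, hT5.le⟩, fun k hk t ht hs => ?_⟩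
  · have : (1 / 2 : ℝ) ^ (max n₀ l + 1) ≤ (1 / 2) ^ l :=
      pow_le_pow_of_le_one (by norm_num) (by norm_num) (by omega)
    unfold crossLevel
    linarith
  · obtain ⟨i, hi⟩ := exists_denseTime_steep ht hs
    exact hn₀ k ((le_max_left _ _).trans hk.le) i hi

/-! ### The labels do not have the same minimum over both halves -/

lemma IsExcursionLaw.ae_half_pos {ν : Measure C(I, ℝ)} (hν : IsExcursionLaw ν) :
    ∀ᵐ e ∂ν, 0 < e half := by
  have hm : Measurable fun (e : C(I, ℝ)) (_ : Fin 1) => e half :=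
    measurable_pi_lambda _ fun _ => measurable_eval_path _
  have hS : MeasurableSet {x : Fin 1 → ℝ | 0 < x 0} :=
    measurableSet_lt measurable_const (measurable_pi_apply 0)
  have h := hν 0 (fun _ => half) (fun i j hij => absurd hij (by omega))
    (by rw [← Subtype.coe_lt_coe]; norm_num [half]) (by rw [← Subtype.coe_lt_coe]; norm_num [half])
  have h2 : ∀ᵐ x ∂(ν.map fun e (_ : Fin 1) => e half), 0 < x 0 := by
    change (ν.map fun e (_ : Fin 1) => e half) {x : Fin 1 → ℝ | 0 < x 0}ᶜ = 0
    rw [h, withDensity_apply _ hS.compl]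
    refine (setLIntegral_congr_fun hS.compl (g := fun _ => 0) fun x hx => ?_).trans
      lintegral_zero
    change ENNReal.ofReal (excursionDensity _ x) = 0
    rw [excursionDensity, if_neg fun h => hx (h 0), ENNReal.ofReal_zero]
  exact ae_of_ae_map hm.aemeasurable h2

lemma measurableSet_steepAbove : MeasurableSet {p : C(I, ℝ) × ℝ | SteepAbove p.1 p.2} := by
  have : {p : C(I, ℝ) × ℝ | SteepAbove p.1 p.2} = ⋂ n₀ : ℕ, ⋃ k, ⋃ (_ : n₀ ≤ k), ⋃ i,
      {p | Steep p.1 p.2 k (denseTime i)} := by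
    ext p
    simp only [SteepAbove, mem_ofPred_eq, mem_iInter, mem_iUnion, exists_prop]
  rw [this]
  refine .iInter fun n₀ => .iUnion fun k => .iUnion fun _ => .iUnion fun i => ?_
  have h1 : Measurable fun p : C(I, ℝ) × ℝ => runMin p.1 (denseTime i) :=
    (continuous_infOn continuous_id continuous_const continuous_const
      fun _ => half_le_denseTime i).measurable.comp measurable_fst
  have h2 : Measurable fun p : C(I, ℝ) × ℝ => p.1 (denseTime i) :=
    (measurable_eval_path _).comp measurable_fst
  exact (measurableSet_lt measurable_snd h1).inter
    ((measurableSet_lt h1 (measurable_snd.add_const _)).inter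
      (measurableSet_lt (measurable_snd.add_const _) h2))

/-- Steepness is known for almost every `e` at each fixed level, but is needed at a random level
that depends on `e`. Given `e`, this level has a law `lam` free of `e`, so Fubini exchanges the two
quantifiers. -/
theorem IsSnakeLaw.ae_infOn_ne {P : Measure SnakeSpace} (hP : IsSnakeLaw P) :
    ∀ᵐ h ∂P, infOn h.g 0 half ≠ infOn h.g half 1 := by
  have := hP.isProbabilityMeasure
  obtain ⟨κ, hκ, hPκ, hlab⟩ := hP.labels
  set μ := P.map SnakeSpace.f with hμ
  have hμp : IsProbabilityMeasure μ := Measure.isProbabilityMeasure_map measurable_f.aemeasurable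
  have h1 : ∀ᵐ e ∂μ, e 1 = 0 := by
    have hs : MeasurableSet {e : C(I, ℝ) | e 1 = 0} :=
      measurable_eval_path 1 (measurableSet_singleton 0)
    rw [hμ, ae_map_iff measurable_f.aemeasurable hs]
    exact ae_of_all _ fun h => h.2.1.2
  have hsteep : ∀ᵐ e ∂μ, ∀ r : ℚ, 0 ≤ r → (r : ℝ) ≤ e half →
      ∀ᵐ x ∂((κ e).map (minHeight r e)), 0 < x ∧ x < e half → SteepAbove e x := by
    refine ae_all_iff.2 fun r => ?_
    obtain ⟨lam, hlam, H⟩ := exists_minHeight_law r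
    have hcomm : ∀ᵐ e ∂μ, ∀ᵐ x ∂lam, 0 < x ∧ x < e half → SteepAbove e x := by
      refine (Measure.ae_ae_comm ?_).2 (ae_of_all _ fun x => ?_)
      · have hm : Measurable fun p : C(I, ℝ) × ℝ => p.1 half :=
          (measurable_eval_path _).comp measurable_fst
        have : {p : C(I, ℝ) × ℝ | 0 < p.2 ∧ p.2 < p.1 half → SteepAbove p.1 p.2} =
            ({p | 0 < p.2} ∩ {p | p.2 < p.1 half})ᶜ ∪ {p | SteepAbove p.1 p.2} := by
          ext p
          simp only [mem_ofPred_eq, imp_iff_not_or, mem_union, mem_compl_iff, mem_inter_iff]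
        rw [this]
        exact ((measurableSet_lt measurable_const measurable_snd).inter
          (measurableSet_lt measurable_snd hm)).compl.union measurableSet_steepAbove
      · by_cases hx : 0 < x
        · filter_upwards [hP.excursion.ae_steepAbove h1 hx] with e he h
          exact he h.2
        · exact ae_of_all _ fun e h => absurd h.1 hx
    filter_upwards [hcomm, hlab, h1] with e e1 e2 e3 _ hr
    rwa [H e (κ e) e2 e3 hr]
  have hmeas : MeasurableSet {z : C(I, ℝ) | infOn z 0 half = infOn z half 1} :=
    (isClosed_eq (continuous_infOn continuous_id continuous_const continuous_const
      fun _ => zero_le_half) (continuous_infOn continuous_id continuous_const continuous_const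
      fun _ => half_le_one)).measurableSet
  have hm2 : MeasurableSet {p : C(I, ℝ) × C(I, ℝ) | infOn p.2 0 half = infOn p.2 half 1} :=
    measurable_snd hmeas
  have hnull : ∀ᵐ p ∂(P.map fun h => (h.f, h.g)), infOn p.2 0 half ≠ infOn p.2 half 1 := by
    rw [hPκ]
    refine Measure.ae_compProd_of_ae_ae hm2.compl ?_
    filter_upwards [hlab, h1, hP.excursion.ae_half_pos, hsteep] with e e1 e2 e3 e4
    exact measure_eq_zero_iff_ae_notMem.1 (e1.measure_tie e2 e3 e4)
  exact ae_of_ae_map (measurable_f.prodMk measurable_g).aemeasurable hnull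

/-! ### Independence and symmetry -/

lemma orientationSign_mem (h : SnakeSpace) : orientationSign h = 1 ∨ orientationSign h = -1 := by
  unfold orientationSign
  split_ifs <;> simp

/-- Reversal matches `{ψ ∈ A, ε = 1}` with `{ψ ∈ A, ε = -1}` up to a null set, so each has half the
mass of `{ψ ∈ A}`. The case `A = univ` is the law of the sign. -/
lemma IsSnakeLaw.measure_inter_orientationSign {P : Measure SnakeSpace} (hP : IsSnakeLaw P)
    {A : Set (GHPSpace 2)} (hA : MeasurableSet A) (t : Set ℤ) :
    P (ψ ⁻¹' A ∩ orientationSign ⁻¹' t) =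
      P (ψ ⁻¹' A) * ((2⁻¹ : ℝ≥0∞) • (Measure.dirac (1 : ℤ) + Measure.dirac (-1 : ℤ))) t := by
  have hψ := measurable_ψ hA
  have hε : ∀ s, MeasurableSet (orientationSign ⁻¹' s) := fun s =>
    measurable_orientationSign (MeasurableSpace.measurableSet_top (s := s))
  set S := ψ ⁻¹' A with hS
  have hsymm : P (S ∩ orientationSign ⁻¹' {1}) = P (S ∩ orientationSign ⁻¹' {-1}) := by
    conv_lhs => rw [← hP.map_revSnake]
    rw [Measure.map_apply continuous_revSnake.measurable (hψ.inter (hε _))]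
    refine measure_congr ?_
    filter_upwards [hP.ae_infOn_ne] with h hh
    refine propext ?_
    change ψ (revSnake h) ∈ A ∧ orientationSign (revSnake h) = 1 ↔
      ψ h ∈ A ∧ orientationSign h = -1
    rw [ψ_revSnake, orientationSign_revSnake hh, neg_eq_iff_eq_neg]
  have hsplit : ∀ t : Set ℤ, P (S ∩ orientationSign ⁻¹' t) =
      P (S ∩ orientationSign ⁻¹' (t ∩ {1})) + P (S ∩ orientationSign ⁻¹' (t ∩ {-1})) := by
    intro t
    rw [← measure_union _ (hψ.inter (hε _))]
    · congr 1
      ext h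
      rcases orientationSign_mem h with h1 | h1 <;> simp [h1]
    · refine disjoint_left.2 fun h h1 h2 => ?_
      have e1 : orientationSign h = 1 := h1.2.2
      have e2 : orientationSign h = -1 := h2.2.2
      omega
  have htot : P S = 2 * P (S ∩ orientationSign ⁻¹' {1}) := by
    have := hsplit univ
    rw [preimage_univ, inter_univ, univ_inter, univ_inter, ← hsymm] at this
    rw [this, two_mul]
  have hhalf : P S * 2⁻¹ = P (S ∩ orientationSign ⁻¹' {1}) := by
    rw [htot, mul_comm, ← mul_assoc, ENNReal.inv_mul_cancel (by norm_num) (by norm_num), one_mul]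
  rw [hsplit, Measure.smul_apply, Measure.add_apply, Measure.dirac_apply, Measure.dirac_apply,
    smul_eq_mul, ← mul_assoc, hhalf, mul_add]
  congr 1
  · by_cases h1 : (1 : ℤ) ∈ t
    · simp [h1]
    · simp [h1]
  · by_cases h1 : (-1 : ℤ) ∈ t
    · simp [h1, hsymm]
    · simp [h1]

lemma IsSnakeLaw.map_orientationSign {P : Measure SnakeSpace} (hP : IsSnakeLaw P) :
    P.map orientationSign = (2⁻¹ : ℝ≥0∞) • (Measure.dirac (1 : ℤ) + Measure.dirac (-1 : ℤ)) := by
  have := hP.isProbabilityMeasure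
  ext t ht
  have := hP.measure_inter_orientationSign (A := univ) .univ t
  rwa [preimage_univ, univ_inter, measure_univ, one_mul,
    ← Measure.map_apply measurable_orientationSign ht] at this

end BrownianSphere

end

/-- Under the law of the Brownian snake, the doubly marked Brownian sphere `ψ(h)` and the
orientation sign `ε_h` are random variables, they are independent, and `ε_h` has the Rademacher
distribution. -/
theorem propositionT (P : MeasureTheory.Measure BrownianSphere.SnakeSpace)
    (hP : BrownianSphere.IsSnakeLaw P) :
    Measurable BrownianSphere.ψ ∧ Measurable BrownianSphere.orientationSign ∧
    ProbabilityTheory.IndepFun BrownianSphere.ψ BrownianSphere.orientationSign P ∧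
    P.map BrownianSphere.orientationSign =
      (2⁻¹ : ENNReal) • (MeasureTheory.Measure.dirac (1 : ℤ) + MeasureTheory.Measure.dirac (-1 : ℤ)) := by
  refine ⟨BrownianSphere.measurable_ψ, BrownianSphere.measurable_orientationSign, ?_,
    hP.map_orientationSign⟩
  rw [ProbabilityTheory.indepFun_iff_measure_inter_preimage_eq_mul]
  intro s t hs ht
  rw [hP.measure_inter_orientationSign hs, ← hP.map_orientationSign,
    MeasureTheory.Measure.map_apply BrownianSphere.measurable_orientationSign ht]
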